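/- **Setting.** Let $\Lambda\subset\mathbb R^2$ be the triangular lattice. A *triangulation* of a region $\Omega\subseteq\mathbb R^2$ (for example the closed region bounded by a simple closed polygon with vertices in $\Lambda$) is a set of nondegenerate triangles with vertices in $\Lambda$ that fill $\Omega$, any two of which meet in a common (possibly empty) face, and such that every point of $\Lambda\cap\Omega$ is a vertex; it is *equilateral* if all its edges have the same length. A *flip* on a convex quadrilateral that is the union of two adjacent triangles replaces the diagonal separating them by the other diagonal and so transforms a triangulation of $\Omega$ into another one. Flips are identified with their quadrilaterals. A *flip path* is a starting triangulation with a finite sequence of successively performable flips; it *generates* an edge if its last triangulation contains the edge. A *flip plan* that generates an edge from $T$ is a finite partially ordered set of flips whose linear orderings are exactly those flip paths from $T$ that generate the edge and consist of exactly the flips of the set, each performed once. It is a *minimum* flip plan if each of its linear orderings has the least length among all flip paths from $T$ that generate the edge. **Edges.** An edge $e=(x,y)$ at $v\in\Lambda$ is the segment from $v$ to $v+xu+yw$, where $x,y\ge 0$ are coprime integers and $(u,w)$ is one of the three anticlockwise pairs of consecutive lattice unit vectors (at angle $60^\circ$) in the directions $0^\circ,60^\circ,120^\circ,180^\circ$.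 Let $\phi(e)=x/y$ if $x<y$ and $\phi(e)=y/x$ otherwise; $\phi_e^{-1}$ sends a reduced fraction $a/b\in[0,1]$ to the edge $(a,b)$ if $x<y$ and to $(b,a)$ otherwise, with the same pair $(u,w)$. For $e\ne(1,0),(0,1)$ the *Farey neighbor edges* of $e$ are $(0,1),(1,0)$ if $e=(1,1)$, and otherwise the images under $\phi_e^{-1}$ of the two terms adjacent to $\phi(e)$ in the Farey sequence of order the denominator of $\phi(e)$. The *Farey parallelogram* $P_{e,v}$ has vertices $v,\,v+e_1,\,v+e,\,v+e_2$, with $e_1,e_2$ the Farey neighbor edges. **Algorithms.** The *Farey plan* $C$ of $e$ is empty if $e\in\{(1,0),(0,1)\}$. Otherwise start with $C$ empty, $X=(\tfrac01,\tfrac11)$, $d=\tfrac11$, and repeat until $C$ contains $\phi(e)$: append $d$ to $C$; replace $d$ by the mediant of $d$ and the term directly after $d$ in $X$ if $\phi(e)>d$, directly before $d$ otherwise; insert the new $d$ in $X$. The *Flip plan* $\pi_{e,v}$, for $C=(f_1,\dots,f_n)$, is empty if $n=0$, and is the single flip on $P_{(1,1),v}$ if $n=1$. If $n\ge 2$, let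 $e_1=\phi_e^{-1}(f_{n-1})$ and let $e_2$ be the shorter boundary edge of $P_{e,v}$; then $\pi_{e,v}$ has the root flip on $P_{e,v}$, whose children are the root flips of $\pi_{e_1,v}$ and $\pi_{e_1,v+e_2}$, obtained recursively from the Farey plan $(f_1,\dots,f_{n-1})$. Equal flips are identified, and the partial order is the one in which descendants are smaller. **Theorem (Unique Minimum Flip Plan for an Edge).** Let $T$ be an equilateral triangulation of $\Omega$, and let $e$ be an edge at $v\in\Lambda$ whose segment is contained in $\Omega$. Then there is a unique minimum flip plan that generates $e$ at $v$ from $T$. It is the partially ordered set $\pi_{e,v}$; thus every minimum flip plan for $e$ at $v$ contains exactly the flips of $\pi_{e,v}$. All flips of $\pi_{e,v}$ are performed on Farey parallelograms of edges other than $(1,0)$ and $(0,1)$. -/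

import Mathlib

namespace LatticeFlip

/-! ### The triangular lattice

The lattice point `(a, b)` stands for `a • u + b • w`, where `u` and `w` are unit vectors of the
Euclidean plane at an angle of sixty degrees, and the plane itself is described by its real
coordinates with respect to `u` and `w`. -/

/-- Points of the triangular lattice. -/
abbrev Pt := ℤ × ℤ

/-- The plane. -/
abbrev Plane := ℝ × ℝ

/-- A lattice point as a point of the plane. -/
def toPlane (p : Pt) : Plane := ((p.1 : ℝ), (p.2 : ℝ))

/-- The squared Euclidean length of a lattice vector. -/
def lenSq (p : Pt) : ℤ := p.1 ^ 2 + p.1 * p.2 + p.2 ^ 2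

/-- The convex polygon spanned by a finite set of lattice points. -/
def hull (s : Finset Pt) : Set Plane := convexHull ℝ (toPlane '' (s : Set Pt))

/-! ### Lattice triangulations -/

/-- A lattice triangulation of a region `Ω` of the plane, given by its triangular facets: they are
nondegenerate lattice triangles, any two of them meet in a common face (possibly empty), they fill
`Ω`, and every lattice point of `Ω` is a vertex. -/
@[ext]
structure Triangulation (Ω : Set Plane) where
  triangles : Set (Finset Pt)
  card_eq_three : ∀ t ∈ triangles, t.card = 3
  affineIndependent : ∀ t ∈ triangles, AffineIndependent ℝ (fun p : t => toPlane p)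
  inter_eq : ∀ s ∈ triangles, ∀ t ∈ triangles, hull s ∩ hull t = hull (s ∩ t)
  cover : ⋃ t ∈ triangles, hull t = Ω
  full : ∀ p : Pt, toPlane p ∈ Ω → ∃ t ∈ triangles, p ∈ t

/-- The segment joining `a` and `b` is an edge of the triangulation. -/
def Triangulation.HasEdge {Ω : Set Plane} (T : Triangulation Ω) (a b : Pt) : Prop :=
  a ≠ b ∧ ∃ t ∈ T.triangles, a ∈ t ∧ b ∈ t

/-- All edges of the triangulation have the same length. -/
def Triangulation.IsEquilateral {Ω : Set Plane} (T : Triangulation Ω) : Prop :=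
  ∀ a b c d : Pt, T.HasEdge a b → T.HasEdge c d → lenSq (b - a) = lenSq (d - c)

/-! ### Flips and flip paths -/

/-- A flip is recorded by the vertex set of the quadrilateral on which it is performed. -/
abbrev Quad := Finset Pt

/-- `T'` arises from `T` by a diagonal flip on the quadrilateral `Q`: here `Q` has the vertices
`a, b, c, d` in cyclic order, it is convex (its two diagonals cross), it is the union of the facets
`abc` and `acd` of `T`, and its diagonal `ac` is replaced by the diagonal `bd`. -/
def IsFlip {Ω : Set Plane} (T : Triangulation Ω) (Q : Quad) (T' : Triangulation Ω) : Prop :=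
  ∃ a b c d : Pt,
    Q = {a, b, c, d} ∧
    (openSegment ℝ (toPlane a) (toPlane c) ∩ openSegment ℝ (toPlane b) (toPlane d)).Nonempty ∧
    {a, b, c} ∈ T.triangles ∧ {a, c, d} ∈ T.triangles ∧
    T'.triangles = (T.triangles \ {{a, b, c}, {a, c, d}}) ∪ {{a, b, d}, {b, c, d}}

/-- `IsFlipPath T L T'`: performing the flips in the list `L` one after the other, beginning with
the first, is possible and leads from `T` to `T'`. -/
inductive IsFlipPath {Ω : Set Plane} : Triangulation Ω → List Quad → Triangulation Ω → Prop
  | nil (T : Triangulation Ω) : IsFlipPath T [] T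
  | cons {T T' T'' : Triangulation Ω} {Q : Quad} {L : List Quad} :
      IsFlip T Q T' → IsFlipPath T' L T'' → IsFlipPath T (Q :: L) T''

/-- The flips in `L`, performed in this order, form a flip path from `T` that generates the edge
joining `a` and `b`, which means that the target triangulation contains it. -/
def Generates {Ω : Set Plane} (T : Triangulation Ω) (L : List Quad) (a b : Pt) : Prop :=
  ∃ T' : Triangulation Ω, IsFlipPath T L T' ∧ T'.HasEdge a b

/-! ### Flip plans -/

/-- A finite set of flips with a relation between flips. -/
@[ext]
structure FlipPoset where
  flips : Finset Quad
  le : Quad → Quad → Prop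

/-- The relation is a partial order on the set of flips (and relates nothing else). -/
structure FlipPoset.IsPoset (π : FlipPoset) : Prop where
  mem_of_le : ∀ P Q, π.le P Q → P ∈ π.flips ∧ Q ∈ π.flips
  refl : ∀ P ∈ π.flips, π.le P P
  trans : ∀ P Q R, π.le P Q → π.le Q R → π.le P R
  antisymm : ∀ P Q, π.le P Q → π.le Q P → P = Q

/-- The list consists of exactly the flips in `π`, each of them once. -/
def FlipPoset.ListsFlips (π : FlipPoset) (L : List Quad) : Prop :=
  L.Nodup ∧ ∀ Q, Q ∈ L ↔ Q ∈ π.flips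

/-- A valid linear ordering of `π`: smaller flips come first. -/
def FlipPoset.IsLinearOrdering (π : FlipPoset) (L : List Quad) : Prop :=
  π.ListsFlips L ∧ L.Pairwise (fun P Q => ¬ π.le Q P)

/-- `π` is a flip plan that generates the edge joining `a` and `b` from `T`: it is a partially
ordered set of flips whose valid linear orderings are exactly the flip paths that generate the edge
from `T` and contain exactly the flips in `π`. -/
def FlipPoset.IsFlipPlan {Ω : Set Plane} (π : FlipPoset) (T : Triangulation Ω) (a b : Pt) : Prop :=
  π.IsPoset ∧ ∀ L : List Quad, π.IsLinearOrdering L ↔ (Generates T L a b ∧ π.ListsFlips L)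

/-- A minimum flip plan: each of its valid linear orderings is a shortest flip path among all
flip paths that generate the edge from `T`. -/
def FlipPoset.IsMinimumFlipPlan {Ω : Set Plane} (π : FlipPoset) (T : Triangulation Ω)
    (a b : Pt) : Prop :=
  π.IsFlipPlan T a b ∧
    ∀ L : List Quad, π.IsLinearOrdering L → ∀ L' : List Quad, Generates T L' a b →
      L.length ≤ L'.length

/-! ### Edges -/

/-- The three defining coordinate pairs of unit vectors, each in anticlockwise order. -/
def coordPair : Fin 3 → Pt × Pt
  | 0 => ((1, 0), (0, 1))
  | 1 => ((0, 1), (-1, 1))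
  | 2 => ((-1, 1), (-1, 0))

/-- An edge (up to lattice shifts): nonnegative coprime coefficients with respect to a defining
coordinate pair. -/
structure Edge where
  pair : Fin 3
  x : ℕ
  y : ℕ
  coprime : x.Coprime y

/-- The edge as a lattice vector. -/
def Edge.vec (e : Edge) : Pt :=
  (e.x : ℤ) • (coordPair e.pair).1 + (e.y : ℤ) • (coordPair e.pair).2

/-! ### Farey sequences and Farey parallelograms -/

/-- The set of terms of the Farey sequence of order `n`; the sequence lists them in increasing
order. -/
def fareySeq (n : ℕ) : Finset ℚ :=
  ((Finset.range (n + 1) ×ˢ Finset.Icc 1 n).image (fun p => (p.1 : ℚ) / (p.2 : ℚ))).filter (· ≤ 1)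

/-- The term directly before `d` in the increasing sequence with terms `X`. -/
def termBefore (X : Finset ℚ) (d : ℚ) : ℚ := (X.filter (· < d)).max.unbotD 0

/-- The term directly after `d` in the increasing sequence with terms `X`. -/
def termAfter (X : Finset ℚ) (d : ℚ) : ℚ := (X.filter (d < ·)).min.untopD 1

/-- The mediant of two reduced fractions. -/
def mediant (p q : ℚ) : ℚ := ((p.num + q.num : ℤ) : ℚ) / ((p.den + q.den : ℕ) : ℚ)

/-- The Farey-flip map. -/
def Edge.toFarey (e : Edge) : ℚ := if e.x < e.y then (e.x : ℚ) / e.y else (e.y : ℚ) / e.x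

/-- The inverse of the Farey-flip map that belongs to the edge `e`. -/
def Edge.ofFarey (e : Edge) (q : ℚ) : Edge :=
  if e.x < e.y then ⟨e.pair, q.num.natAbs, q.den, q.reduced⟩
  else ⟨e.pair, q.den, q.num.natAbs, q.reduced.symm⟩

/-- The Farey neighbor edges of `e` in the Farey sequence where `e` first appears, whose order is
the denominator of the fraction of `e`. The edge `(1, 1)`, whose fraction is the last term, has the
neighbors `(0, 1)` and `(1, 0)`. Only meaningful if `e` is not of unit length. -/
def Edge.neighbors (e : Edge) : Edge × Edge :=
  if e.x = 1 ∧ e.y = 1 then (⟨e.pair, 0, 1, by simp⟩, ⟨e.pair, 1, 0, by simp⟩)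
  else (e.ofFarey (termBefore (fareySeq e.toFarey.den) e.toFarey),
    e.ofFarey (termAfter (fareySeq e.toFarey.den) e.toFarey))

/-- The edge is `(1, 0)` or `(0, 1)`. -/
def Edge.IsUnit (e : Edge) : Prop := (e.x = 1 ∧ e.y = 0) ∨ (e.x = 0 ∧ e.y = 1)

instance (e : Edge) : Decidable e.IsUnit := by unfold Edge.IsUnit; infer_instance

/-- The shorter boundary edge of the Farey parallelogram for `e`. -/
def Edge.shorterNeighbor (e : Edge) : Edge :=
  if lenSq e.neighbors.1.vec ≤ lenSq e.neighbors.2.vec then e.neighbors.1 else e.neighbors.2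

/-- The Farey parallelogram for `e` at `v`: `e` is a diagonal, and the boundary edges are copies of
the Farey neighbor edges of `e`. -/
def fareyParallelogram (e : Edge) (v : Pt) : Quad :=
  {v, v + e.neighbors.1.vec, v + e.vec, v + e.neighbors.2.vec}

/-! ### The Farey plan of an edge -/

/-- The state of the Farey plan algorithm: the plan `C`, the sequence `X`, the fraction `d`. -/
structure FareyState where
  C : List ℚ
  X : Finset ℚ
  d : ℚ

/-- One round of the algorithm for the fraction `f`; nothing happens once `C` contains `f`. -/
def fareyStep (f : ℚ) (s : FareyState) : FareyState :=
  if f ∈ s.C then s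
  else
    let d' := if f > s.d then mediant s.d (termAfter s.X s.d) else mediant s.d (termBefore s.X s.d)
    ⟨s.C ++ [s.d], insert d' s.X, d'⟩

/-- The Farey plan of an edge. The plan has at most as many terms as the denominator of the
fraction of `e` says, so the loop has ended after that many rounds. -/
def fareyPlan (e : Edge) : List ℚ :=
  if e.IsUnit then []
  else ((fareyStep e.toFarey)^[e.toFarey.den] ⟨[], fareySeq 1, 1⟩).C

/-! ### The flip plan of an edge -/

/-- A directed acyclic graph of flips; an arc is a pair (child, parent). Equal flips are
identified, because the flips form a set. -/
structure FlipDag where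
  flips : Finset Quad
  arcs : Finset (Quad × Quad)

/-- The recursion of the flip plan algorithm. The Farey plan is given with its last term first. -/
def flipDag : List ℚ → Edge → Pt → FlipDag
  | [], _, _ => ⟨∅, ∅⟩
  | [_], e, v => ⟨{fareyParallelogram e v}, ∅⟩
  | _ :: g :: C, e, v =>
    let s := fareyParallelogram e v
    let e₁ := e.ofFarey g
    let w := v + e.shorterNeighbor.vec
    let D₁ := flipDag (g :: C) e₁ v
    let D₂ := flipDag (g :: C) e₁ w
    ⟨{s} ∪ D₁.flips ∪ D₂.flips,
      {(fareyParallelogram e₁ v, s), (fareyParallelogram e₁ w, s)} ∪ D₁.arcs ∪ D₂.arcs⟩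

/-- The partially ordered set of flips that the flip plan algorithm outputs for the edge `e` at
`v`: a flip is below another one if it is a descendant of it. -/
def flipPlan (e : Edge) (v : Pt) : FlipPoset :=
  let D := flipDag (fareyPlan e).reverse e v
  ⟨D.flips, fun P Q => P ∈ D.flips ∧ Q ∈ D.flips ∧
    Relation.ReflTransGen (fun A B => (A, B) ∈ D.arcs) P Q⟩

end LatticeFlip

open LatticeFlip

namespace LatticeFlip

/-! ### A binary tree of lattice bases -/

/-! An edge that is not of unit length is the sum of a lattice basis reached from a coordinate pair
`(U, W)` by Stern–Brocot steps `(p, q) ↦ (p, p + q)` or `(p + q, q)`. The two basis vectors are its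
Farey neighbors, they span its Farey parallelogram, and the recursion of the flip plan undoes the
last step: the sum of the previous basis occurs as two parallel sides of the parallelogram, and
these are the edges that the two children generate. So the flip plan is `treeDag`
(`exists_flipDag_eq_treeDag`).

Every flip of the plan is necessary (`IsFlipPath.mem_of_hasEdge`). Triangulations reachable from an
equilateral one are unimodular, so every flip happens on a parallelogram spanned by a lattice basis.
If a flip creates the edge `e = p + q` with tree basis `(p, q)`, its sides are `(p + k e, q - k e)`
for an integer `k`. For `k = 0` it is the expected flip, and its sides, in particular both copies of
the parent vector, are already edges. For `k ≠ 0` one side is a tree vector further down, whose plan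
contains the plan of `e`, and it is already an edge. Induction along the path finishes the argument,
since edges of the initial triangulation have level at most 1 while tree vectors have level at least
2.

The plan is performable in every linear ordering (`exists_isFlipPath_of_isLinearOrdering`). Its unit
rhombi are rhombi whose short diagonal is crossed by the edge, so their triangles belong to the
initial triangulation (`removed_nil_subset`). Of the two triangles removed by any other flip, each
child adds one. Level ranges and vertex sums show that a triangle is removed by at most one flip of
the plan, and that a triangle added by one flip can only be removed by a parent of that flip.

Conversely, a flip path that lists the flips once performs children before parents
(`IsFlipPath.children_mem`), so the flip paths are exactly the linear orderings. Uniqueness then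
follows: a minimum plan contains all necessary flips and cannot be larger, so it has the same flips
and the same linear orderings, and these determine the partial order. -/

/-- The determinant of two lattice vectors. -/
def cr (a b : Pt) : ℤ := a.1 * b.2 - a.2 * b.1

/-- The lattice basis reached from `(U, W)` by the steps in the list, the first step last. -/
def treeBasis (U W : Pt) : List Bool → Pt × Pt
  | [] => (U, W)
  | true :: l => ((treeBasis U W l).1, (treeBasis U W l).1 + (treeBasis U W l).2)
  | false :: l => ((treeBasis U W l).1 + (treeBasis U W l).2, (treeBasis U W l).2)

/-- The sum of the two vectors of a basis. -/
def treeVec (U W : Pt) (l : List Bool) : Pt := (treeBasis U W l).1 + (treeBasis U W l).2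

/-- The parallelogram at `v` spanned by a basis. -/
def treeQuad (U W : Pt) (l : List Bool) (v : Pt) : Quad :=
  {v, v + (treeBasis U W l).1, v + treeVec U W l, v + (treeBasis U W l).2}

/-- The basis vector kept by a step. -/
def treeShift (U W : Pt) (b : Bool) (l : List Bool) : Pt :=
  if b then (treeBasis U W l).1 else (treeBasis U W l).2

/-- The flip plan in terms of bases. -/
def treeDag (U W : Pt) : List Bool → Pt → FlipDag
  | [], v => ⟨{treeQuad U W [] v}, ∅⟩
  | b :: l, v =>
    ⟨{treeQuad U W (b :: l) v} ∪ (treeDag U W l v).flips ∪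
        (treeDag U W l (v + treeShift U W b l)).flips,
      {(treeQuad U W l v, treeQuad U W (b :: l) v),
        (treeQuad U W l (v + treeShift U W b l), treeQuad U W (b :: l) v)} ∪
        (treeDag U W l v).arcs ∪ (treeDag U W l (v + treeShift U W b l)).arcs⟩

/-! ### Farey intervals -/

/-- `FareyPath l C a b c d`: bisecting the Farey interval from `0/1` to `1/1` as told by `l` leads
to the interval from `a/b` to `c/d`, and `C` lists the fractions met before its mediant. -/
inductive FareyPath : List Bool → List ℚ → ℕ → ℕ → ℕ → ℕ → Prop
  | base : FareyPath [] [1] 0 1 1 1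
  | left {l C a b c d} : FareyPath l C a b c d →
      FareyPath (true :: l) (((a + c : ℕ) : ℚ) / ((b + d : ℕ) : ℚ) :: C) a b (a + c) (b + d)
  | right {l C a b c d} : FareyPath l C a b c d →
      FareyPath (false :: l) (((a + c : ℕ) : ℚ) / ((b + d : ℕ) : ℚ) :: C) (a + c) (b + d) c d

/-- Mediants preserve the determinant equation, which is the source of all coprimality facts below.
The bound on the length of `C` shows that as many rounds of the loop as the denominator of the
mediant suffice. -/
theorem FareyPath.bounds {l C a b c d} (h : FareyPath l C a b c d) :
    c * b = a * d + 1 ∧ 1 ≤ b ∧ 1 ≤ d ∧ c ≤ d ∧ a < b ∧ C.length + 1 ≤ b + d := by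
  induction h with
  | base => simp
  | left h ih =>
    obtain ⟨h1, h2, h3, h4, h5, h6⟩ := ih
    refine ⟨by nlinarith, by omega, by omega, by omega, by omega, by simp; omega⟩
  | right h ih =>
    obtain ⟨h1, h2, h3, h4, h5, h6⟩ := ih
    refine ⟨by nlinarith, by omega, by omega, by omega, by omega, by simp; omega⟩

theorem coprime_left {a b c d : ℕ} (h : c * b = a * d + 1) : a.Coprime b := by
  have : (Nat.gcd a b) ∣ 1 := by
    have h1 : Nat.gcd a b ∣ c * b := (Nat.gcd_dvd_right a b).mul_left c
    have h2 : Nat.gcd a b ∣ a * d := (Nat.gcd_dvd_left a b).mul_right d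
    rw [h] at h1
    exact (Nat.dvd_add_right h2).1 h1
  exact Nat.dvd_one.1 this

theorem coprime_right {a b c d : ℕ} (h : c * b = a * d + 1) : c.Coprime d :=
  (coprime_left (a := d) (b := c) (c := b) (d := a) (by linarith)).symm

theorem coprime_mediant {a b c d : ℕ} (h : c * b = a * d + 1) : (a + c).Coprime (b + d) :=
  coprime_left (c := c) (d := d) (by nlinarith)

theorem num_natCast_div {a b : ℕ} (h : a.Coprime b) (hb : 1 ≤ b) : ((a : ℚ) / b).num = a := by
  have := Rat.num_div_eq_of_coprime (a := a) (b := b) (by omega) (by simpa using h)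
  simpa using this

theorem den_natCast_div {a b : ℕ} (h : a.Coprime b) (hb : 1 ≤ b) : ((a : ℚ) / b).den = b := by
  have := Rat.den_div_eq_of_coprime (a := a) (b := b) (by omega) (by simpa using h)
  have := this
  simp at this
  exact_mod_cast this

theorem mediant_natCast_div {a b c d : ℕ} (h : a.Coprime b) (hb : 1 ≤ b) (h' : c.Coprime d)
    (hd : 1 ≤ d) : mediant ((a : ℚ) / b) ((c : ℚ) / d) = ((a + c : ℕ) : ℚ) / ((b + d : ℕ) : ℚ) := by
  unfold mediant
  rw [num_natCast_div h hb, num_natCast_div h' hd, den_natCast_div h hb, den_natCast_div h' hd]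
  push_cast
  rfl

theorem natCast_div_lt {a b c d : ℕ} (hb : 1 ≤ b) (hd : 1 ≤ d) :
    (a : ℚ) / b < (c : ℚ) / d ↔ a * d < c * b := by
  rw [div_lt_div_iff₀ (by positivity) (by positivity)]
  exact_mod_cast Iff.rfl

theorem natCast_div_le {a b c d : ℕ} (hb : 1 ≤ b) (hd : 1 ≤ d) :
    (a : ℚ) / b ≤ (c : ℚ) / d ↔ a * d ≤ c * b := by
  rw [div_le_div_iff₀ (by positivity) (by positivity)]
  exact_mod_cast Iff.rfl

theorem termBefore_eq {X : Finset ℚ} {d x : ℚ} (hx : x ∈ X) (h : x < d)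
    (hX : ∀ y ∈ X, y < d → y ≤ x) : termBefore X d = x := by
  have hm : (X.filter (· < d)).max = (x : WithBot ℚ) := by
    apply le_antisymm
    · apply Finset.max_le
      intro y hy
      rw [Finset.mem_filter] at hy
      exact WithBot.coe_le_coe.2 (hX y hy.1 hy.2)
    · exact Finset.le_max (Finset.mem_filter.2 ⟨hx, h⟩)
  rw [termBefore, hm]
  rfl

theorem termAfter_eq {X : Finset ℚ} {d x : ℚ} (hx : x ∈ X) (h : d < x)
    (hX : ∀ y ∈ X, d < y → x ≤ y) : termAfter X d = x := by
  have hm : (X.filter (d < ·)).min = (x : WithTop ℚ) := by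
    apply le_antisymm
    · exact Finset.min_le (Finset.mem_filter.2 ⟨hx, h⟩)
    · apply Finset.le_min
      intro y hy
      rw [Finset.mem_filter] at hy
      exact WithTop.coe_le_coe.2 (hX y hy.1 hy.2)
  rw [termAfter, hm]
  rfl

theorem mem_fareySeq {n : ℕ} {x : ℚ} :
    x ∈ fareySeq n ↔ ∃ a b : ℕ, a ≤ n ∧ 1 ≤ b ∧ b ≤ n ∧ a ≤ b ∧ x = (a : ℚ) / b := by
  simp only [fareySeq, Finset.mem_filter, Finset.mem_image, Finset.mem_product, Finset.mem_range,
    Finset.mem_Icc, Prod.exists]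
  constructor
  · rintro ⟨⟨a, b, ⟨h1, h2, h3⟩, rfl⟩, h⟩
    refine ⟨a, b, by omega, h2, h3, ?_, rfl⟩
    rw [div_le_one (by positivity)] at h
    exact_mod_cast h
  · rintro ⟨a, b, h1, h2, h3, h4, rfl⟩
    refine ⟨⟨a, b, ⟨by omega, h2, h3⟩, rfl⟩, ?_⟩
    rw [div_le_one (by positivity)]
    exact_mod_cast h4

theorem fareySeq_one : fareySeq 1 = {0, 1} := by
  ext x
  rw [mem_fareySeq]
  simp only [Finset.mem_insert, Finset.mem_singleton]
  constructor
  · rintro ⟨a, b, h1, h2, h3, h4, rfl⟩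
    obtain rfl : b = 1 := by omega
    obtain rfl | rfl : a = 0 ∨ a = 1 := by omega
    · left; simp
    · right; simp
  · rintro (rfl | rfl)
    · exact ⟨0, 1, by simp⟩
    · exact ⟨1, 1, by simp⟩

/-- A fraction `p/q` strictly between `a/b` and the mediant would have a denominator too large for
the sequence: the determinant equation writes `q` as a combination of two positive integers with
coefficients `b` and `b + d`. -/
theorem termBefore_fareySeq {a b c d : ℕ} (h : c * b = a * d + 1) (hb : 1 ≤ b) (hd : 1 ≤ d)
    (hab : a < b) :
    termBefore (fareySeq (b + d)) (((a + c : ℕ) : ℚ) / ((b + d : ℕ) : ℚ)) = (a : ℚ) / b := by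
  apply termBefore_eq
  · exact mem_fareySeq.2 ⟨a, b, by omega, hb, by omega, hab.le, rfl⟩
  · rw [natCast_div_lt hb (by omega)]
    nlinarith
  · intro y hy hlt
    obtain ⟨p, q, h1, h2, h3, h4, rfl⟩ := mem_fareySeq.1 hy
    rw [natCast_div_lt h2 (by omega)] at hlt
    rw [natCast_div_le h2 hb]
    by_contra! hc
    zify at *
    have e : (q : ℤ) = b * ((a + c) * q - p * (b + d)) + (b + d) * (p * b - a * q) := by
      linear_combination (-q : ℤ) * h
    nlinarith

theorem termAfter_fareySeq {a b c d : ℕ} (h : c * b = a * d + 1) (hb : 1 ≤ b) (hd : 1 ≤ d)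
    (hcd : c ≤ d) :
    termAfter (fareySeq (b + d)) (((a + c : ℕ) : ℚ) / ((b + d : ℕ) : ℚ)) = (c : ℚ) / d := by
  apply termAfter_eq
  · exact mem_fareySeq.2 ⟨c, d, by omega, hd, by omega, hcd, rfl⟩
  · rw [natCast_div_lt (by omega) hd]
    nlinarith
  · intro y hy hlt
    obtain ⟨p, q, h1, h2, h3, h4, rfl⟩ := mem_fareySeq.1 hy
    rw [natCast_div_lt (by omega) h2] at hlt
    rw [natCast_div_le hd h2]
    by_contra! hc
    zify at *
    have e : (q : ℤ) = d * (p * (b + d) - (a + c) * q) + (b + d) * (c * q - p * d) := by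
      linear_combination (-q : ℤ) * h
    nlinarith

/-- The state of the Farey plan algorithm when it reaches a Farey interval around its target. -/
theorem FareyPath.iterate {l C a b c d} (h : FareyPath l C a b c d) {f : ℚ}
    (h1 : (a : ℚ) / b < f) (h2 : f < (c : ℚ) / d ) :
    f ∉ C ∧ ∃ X : Finset ℚ, (fareyStep f)^[C.length] ⟨[], fareySeq 1, 1⟩ =
      ⟨C.reverse, X, ((a + c : ℕ) : ℚ) / ((b + d : ℕ) : ℚ)⟩ ∧
      (a : ℚ) / b ∈ X ∧ (c : ℚ) / d ∈ X ∧ ((a + c : ℕ) : ℚ) / ((b + d : ℕ) : ℚ) ∈ X ∧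
      ∀ x ∈ X, x ≤ (a : ℚ) / b ∨ x = ((a + c : ℕ) : ℚ) / ((b + d : ℕ) : ℚ) ∨ (c : ℚ) / d ≤ x := by
  induction h with
  | base =>
    simp at h1 h2
    refine ⟨by simpa using h2.ne, {1/2, 0, 1}, ?_, by simp, by simp, by norm_num, ?_⟩
    -- The first round starts at `1/1`, above the target, so it always turns to the predecessor
    -- `0/1` and inserts `1/2`.
    · simp only [List.length_singleton, Function.iterate_one, fareyStep, List.not_mem_nil,
        if_false, List.nil_append, List.reverse_singleton]
      rw [if_neg (by simpa using h2.le)]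
      have : termBefore (fareySeq 1) 1 = 0 := by
        rw [fareySeq_one]
        apply termBefore_eq <;> simp
      have e : mediant 1 0 = 1 / 2 := by
        have := mediant_natCast_div (a := 1) (b := 1) (c := 0) (d := 1)
        norm_num at this ⊢
        exact this
      rw [this, e, fareySeq_one]
      norm_num
    · intro x hx
      simp at hx
      rcases hx with rfl | rfl | rfl <;> norm_num
  | @left l C a b c d h ih =>
    obtain ⟨hd, hb1, hd1, hcd, hab, -⟩ := h.bounds
    have hm1 : (a : ℚ) / b < ((a + c : ℕ) : ℚ) / ((b + d : ℕ) : ℚ) := by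
      rw [natCast_div_lt (by omega) (by omega)]; nlinarith
    have hm2 : ((a + c : ℕ) : ℚ) / ((b + d : ℕ) : ℚ) < (c : ℚ) / d := by
      rw [natCast_div_lt (by omega) (by omega)]; nlinarith
    obtain ⟨hf, X, hX, m1, m2, m3, m4⟩ := ih h1 (h2.trans hm2)
    refine ⟨by simp only [List.mem_cons, not_or]; exact ⟨h2.ne, hf⟩,
      insert (((a + (a + c) : ℕ) : ℚ) / ((b + (b + d) : ℕ) : ℚ)) X, ?_, by simp [m1],
      Finset.mem_insert_of_mem m3, by simp, ?_⟩
    · rw [List.length_cons, Function.iterate_succ_apply', hX, fareyStep,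
        if_neg (by simpa using hf)]
      dsimp only
      have : termBefore X (((a + c : ℕ) : ℚ) / ((b + d : ℕ) : ℚ)) = (a : ℚ) / b := by
        apply termBefore_eq m1 hm1
        intro y hy hlt
        rcases m4 y hy with h | h | h
        · exact h
        · exact absurd h hlt.ne
        · exact absurd (hlt.trans hm2) h.not_gt
      rw [if_neg h2.le.not_gt, this, mediant_natCast_div (coprime_mediant hd) (by omega)
        (coprime_left hd) hb1, List.reverse_cons]
      congr 2 <;> push_cast <;> ring_nf
    · intro x hx
      rcases Finset.mem_insert.1 hx with h | h
      · exact Or.inr (Or.inl h)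
      · rcases m4 x h with h | h | h
        · exact Or.inl h
        · exact Or.inr (Or.inr h.ge)
        · exact Or.inr (Or.inr (hm2.le.trans h))
  | @right l C a b c d h ih =>
    obtain ⟨hd, hb1, hd1, hcd, hab, -⟩ := h.bounds
    have hm1 : (a : ℚ) / b < ((a + c : ℕ) : ℚ) / ((b + d : ℕ) : ℚ) := by
      rw [natCast_div_lt (by omega) (by omega)]; nlinarith
    have hm2 : ((a + c : ℕ) : ℚ) / ((b + d : ℕ) : ℚ) < (c : ℚ) / d := by
      rw [natCast_div_lt (by omega) (by omega)]; nlinarith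
    obtain ⟨hf, X, hX, m1, m2, m3, m4⟩ := ih (hm1.trans h1) h2
    refine ⟨by simp only [List.mem_cons, not_or]; exact ⟨h1.ne', hf⟩,
      insert (((a + c + c : ℕ) : ℚ) / ((b + d + d : ℕ) : ℚ)) X, ?_, Finset.mem_insert_of_mem m3,
      by simp [m2], by simp, ?_⟩
    · rw [List.length_cons, Function.iterate_succ_apply', hX, fareyStep,
        if_neg (by simpa using hf)]
      dsimp only
      have : termAfter X (((a + c : ℕ) : ℚ) / ((b + d : ℕ) : ℚ)) = (c : ℚ) / d := by
        apply termAfter_eq m2 hm2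
        intro y hy hlt
        rcases m4 y hy with h | h | h
        · exact absurd (hm1.trans hlt) h.not_gt
        · exact absurd h hlt.ne'
        · exact h
      rw [if_pos h1, this, mediant_natCast_div (coprime_mediant hd) (by omega)
        (coprime_right hd) hd1, List.reverse_cons]
    · intro x hx
      rcases Finset.mem_insert.1 hx with h | h
      · exact Or.inr (Or.inl h)
      · rcases m4 x h with h | h | h
        · exact Or.inl (h.trans hm1.le)
        · exact Or.inl h.le
        · exact Or.inr (Or.inr h)

/-- After `C.length` rounds the current fraction is the target itself; the next round appends it,
and from then on the state is a fixed point, so surplus rounds do no harm. -/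
theorem FareyPath.iterate_mediant {l C a b c d} (h : FareyPath l C a b c d) :
    ((fareyStep (((a + c : ℕ) : ℚ) / ((b + d : ℕ) : ℚ)))^[b + d] ⟨[], fareySeq 1, 1⟩).C =
      (((a + c : ℕ) : ℚ) / ((b + d : ℕ) : ℚ) :: C).reverse := by
  obtain ⟨hd, hb1, hd1, hcd, hab, hl⟩ := h.bounds
  have hm1 : (a : ℚ) / b < ((a + c : ℕ) : ℚ) / ((b + d : ℕ) : ℚ) := by
    rw [natCast_div_lt (by omega) (by omega)]; nlinarith
  have hm2 : ((a + c : ℕ) : ℚ) / ((b + d : ℕ) : ℚ) < (c : ℚ) / d := by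
    rw [natCast_div_lt (by omega) (by omega)]; nlinarith
  obtain ⟨hf, X, hX, -⟩ := h.iterate hm1 hm2
  set f := ((a + c : ℕ) : ℚ) / ((b + d : ℕ) : ℚ)
  obtain ⟨m, hm⟩ := Nat.exists_eq_add_of_le hl
  rw [hm, add_comm, Function.iterate_add_apply, Function.iterate_succ_apply', hX]
  have h0 : (fareyStep f ⟨C.reverse, X, f⟩).C = (f :: C).reverse := by
    rw [fareyStep, if_neg (by simpa using hf)]
    simp
  generalize fareyStep f ⟨C.reverse, X, f⟩ = s at h0
  rw [Function.iterate_fixed, h0]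
  rw [fareyStep, if_pos (by simp [h0])]

/-- This is the subtractive Euclidean algorithm. The target is the combination of the right and left
endpoints with weights `X` and `Y`; passing to the half interval on the side of the larger weight
subtracts the smaller weight from it. Coprimality makes the process stop at `X = Y = 1`, the
mediant. -/
theorem exists_fareyPath_of_coprime (n : ℕ) : ∀ {X Y : ℕ} {l C a b c d}, X + Y = n →
    X.Coprime Y → 1 ≤ X → 1 ≤ Y → FareyPath l C a b c d →
    ∃ l' C' a' b' c' d', FareyPath l' C' a' b' c' d' ∧ a' + c' = c * X + a * Y ∧
      b' + d' = d * X + b * Y := by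
  induction n using Nat.strong_induction_on with
  | _ n ih =>
    intro X Y l C a b c d hn hc hX hY h
    rcases lt_trichotomy X Y with hlt | rfl | hlt
    · obtain ⟨Z, rfl⟩ := Nat.exists_eq_add_of_lt hlt
      obtain ⟨l', C', a', b', c', d', h', e1, e2⟩ := ih (X + (Z + 1)) (by omega) rfl
        (by simpa [add_assoc] using hc) hX (by omega) h.left
      exact ⟨l', C', a', b', c', d', h', by rw [e1]; ring, by rw [e2]; ring⟩
    · have : X = 1 := by simpa using hc
      subst this
      exact ⟨l, C, a, b, c, d, h, by ring, by ring⟩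
    · obtain ⟨Z, rfl⟩ := Nat.exists_eq_add_of_lt hlt
      obtain ⟨l', C', a', b', c', d', h', e1, e2⟩ := ih ((Z + 1) + Y) (by omega) rfl
        (by simpa [add_assoc] using hc) (by omega) hY h.right
      exact ⟨l', C', a', b', c', d', h', by rw [e1]; ring, by rw [e2]; ring⟩

/-- Every reduced fraction between `0` and `1` is the mediant of a Farey interval. -/
theorem exists_fareyPath {h k : ℕ} (hc : h.Coprime k) (h0 : 1 ≤ h) (hk : h < k) :
    ∃ l C a b c d, FareyPath l C a b c d ∧ a + c = h ∧ b + d = k := by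
  obtain ⟨Z, rfl⟩ := Nat.exists_eq_add_of_lt hk
  obtain ⟨l', C', a', b', c', d', h', e1, e2⟩ := exists_fareyPath_of_coprime (h + (Z + 1)) rfl
    (by simpa [add_assoc] using hc) h0 (by omega) FareyPath.base
  exact ⟨l', C', a', b', c', d', h', by rw [e1]; ring, by rw [e2]; ring⟩

/-! ### The flip plan in terms of bases -/

/-- The edge of a reduced fraction, for either order of its coordinates. -/
def edgeOf (i : Fin 3) (s : Bool) {a b : ℕ} (h : a.Coprime b) : Edge :=
  if s then ⟨i, b, a, h.symm⟩ else ⟨i, a, b, h⟩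

/-- The vector of the edge of a fraction. -/
def fracVec (i : Fin 3) (s : Bool) (a b : ℕ) : Pt :=
  if s then (b : ℤ) • (coordPair i).1 + (a : ℤ) • (coordPair i).2
  else (a : ℤ) • (coordPair i).1 + (b : ℤ) • (coordPair i).2

theorem edgeOf_vec (i s) {a b : ℕ} (h : a.Coprime b) : (edgeOf i s h).vec = fracVec i s a b := by
  cases s <;> rfl

theorem fracVec_add (i s) (a b c d : ℕ) :
    fracVec i s (a + c) (b + d) = fracVec i s a b + fracVec i s c d := by
  cases s <;> simp only [fracVec, Bool.false_eq_true, if_true, if_false] <;> push_cast <;> module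

theorem lenSq_fracVec (i s) (a b : ℕ) : lenSq (fracVec i s a b) = a ^ 2 + a * b + b ^ 2 := by
  fin_cases i <;> cases s <;> simp [fracVec, coordPair, lenSq] <;> ring

theorem toFarey_edgeOf (i s) {a b : ℕ} (h : a.Coprime b) (hab : a < b) :
    (edgeOf i s h).toFarey = (a : ℚ) / b := by
  cases s
  · simp [edgeOf, Edge.toFarey, hab]
  · simp [edgeOf, Edge.toFarey, hab.not_gt]

theorem ofFarey_edgeOf (i s) {a b p q : ℕ} (h : a.Coprime b) (hab : a < b) (h' : p.Coprime q)
    (hq : 1 ≤ q) : (edgeOf i s h).ofFarey ((p : ℚ) / q) = edgeOf i s h' := by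
  have e1 := num_natCast_div h' hq
  have e2 := den_natCast_div h' hq
  have e1' : ((p : ℚ) / q).num.natAbs = p := by rw [e1]; rfl
  cases s
  · simp [edgeOf, Edge.ofFarey, hab, e1', e2]
  · simp [edgeOf, Edge.ofFarey, hab.not_gt, e1', e2]

theorem FareyPath.neighbors_edgeOf {l C a b c d} (h : FareyPath l C a b c d) (i s)
    (h0 : (a + c).Coprime (b + d)) :
    (edgeOf i s h0).neighbors =
      (edgeOf i s (coprime_left h.bounds.1), edgeOf i s (coprime_right h.bounds.1)) := by
  obtain ⟨hd, hb1, hd1, hcd, hab, hl⟩ := h.bounds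
  have hlt : a + c < b + d := by omega
  have hne : ¬ ((edgeOf i s h0).x = 1 ∧ (edgeOf i s h0).y = 1) := by
    cases s <;> simp [edgeOf] <;> omega
  rw [Edge.neighbors, if_neg hne, toFarey_edgeOf i s h0 hlt, den_natCast_div h0 (by omega),
    termBefore_fareySeq hd hb1 hd1 hab, termAfter_fareySeq hd hb1 hd1 hcd,
    ofFarey_edgeOf i s h0 hlt (coprime_left hd) hb1,
    ofFarey_edgeOf i s h0 hlt (coprime_right hd) hd1]

theorem FareyPath.fareyPlan_edgeOf {l C a b c d} (h : FareyPath l C a b c d) (i s)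
    (h0 : (a + c).Coprime (b + d)) :
    (fareyPlan (edgeOf i s h0)).reverse = ((a + c : ℕ) : ℚ) / ((b + d : ℕ) : ℚ) :: C := by
  obtain ⟨hd, hb1, hd1, hcd, hab, hl⟩ := h.bounds
  have hlt : a + c < b + d := by omega
  have hne : ¬ (edgeOf i s h0).IsUnit := by
    cases s <;> simp [edgeOf, Edge.IsUnit] <;> omega
  rw [fareyPlan, if_neg hne, toFarey_edgeOf i s h0 hlt, den_natCast_div h0 (by omega),
    h.iterate_mediant, List.reverse_reverse]

/-- The path in the tree of bases that belongs to a path of Farey intervals. -/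
def treePath (s : Bool) (l : List Bool) : List Bool :=
  if s then l ++ [true] else l.map not ++ [false]

/-- Fractions in `[0, 1]` see only half of the tree. The first tree step, stored at the end of the
list, records which coordinate is larger. Exchanging the coordinates reverses orientation, hence the
negated steps and the exchanged vectors when `s` is false. -/
theorem FareyPath.treeBasis_treePath {l C a b c d} (h : FareyPath l C a b c d) (i s) :
    treeBasis (coordPair i).1 (coordPair i).2 (treePath s l) =
      if s then (fracVec i s a b, fracVec i s c d) else (fracVec i s c d, fracVec i s a b) := by
  induction h with
  | base => cases s <;> simp [treePath, treeBasis, fracVec]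
  | left h ih =>
    cases s <;> simp only [treePath, Bool.false_eq_true, if_true, if_false] at ih ⊢ <;>
      simp [treeBasis, ih, fracVec_add, add_comm]
  | right h ih =>
    cases s <;> simp only [treePath, Bool.false_eq_true, if_true, if_false] at ih ⊢ <;>
      simp [treeBasis, ih, fracVec_add, add_comm]

theorem FareyPath.treeVec_treePath {l C a b c d} (h : FareyPath l C a b c d) (i s) :
    treeVec (coordPair i).1 (coordPair i).2 (treePath s l) = fracVec i s (a + c) (b + d) := by
  rw [treeVec, h.treeBasis_treePath, fracVec_add]
  cases s <;> simp [add_comm]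

theorem FareyPath.fareyParallelogram_edgeOf {l C a b c d} (h : FareyPath l C a b c d) (i s)
    (h0 : (a + c).Coprime (b + d)) (v : Pt) :
    fareyParallelogram (edgeOf i s h0) v =
      treeQuad (coordPair i).1 (coordPair i).2 (treePath s l) v := by
  rw [fareyParallelogram, treeQuad, h.treeVec_treePath, h.treeBasis_treePath,
    h.neighbors_edgeOf, edgeOf_vec, edgeOf_vec, edgeOf_vec]
  cases s
  · ext x
    simp only [Bool.false_eq_true, if_false, Finset.mem_insert, Finset.mem_singleton]
    tauto
  · rfl

theorem fareyParallelogram_one_one (e : Edge) (hx : e.x = 1) (hy : e.y = 1) (v : Pt) :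
    fareyParallelogram e v = treeQuad (coordPair e.pair).1 (coordPair e.pair).2 [] v := by
  rw [fareyParallelogram, treeQuad, Edge.neighbors, if_pos ⟨hx, hy⟩]
  simp only [Edge.vec, hx, hy, treeVec, treeBasis]
  ext x
  simp
  tauto

theorem edgeOf_congr_pair (i s) {a b : ℕ} (h : a.Coprime b) : (edgeOf i s h).pair = i := by
  cases s <;> rfl

theorem shorterNeighbor_of_neighbors {e e₁ e₂ : Edge} (h : e.neighbors = (e₁, e₂)) :
    e.shorterNeighbor = if lenSq e₁.vec ≤ lenSq e₂.vec then e₁ else e₂ := by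
  rw [Edge.shorterNeighbor, h]

/-- The endpoint kept by a bisection has smaller coordinates than the new one, so it is the shorter
neighbor. Hence the shift in the flip plan algorithm is the basis vector kept by the step. -/
theorem FareyPath.shorterNeighbor_left {l C a b c d} (h : FareyPath l C a b c d) (i s)
    (h0 : (a + (a + c)).Coprime (b + (b + d))) :
    (edgeOf i s h0).shorterNeighbor.vec = fracVec i s a b := by
  rw [shorterNeighbor_of_neighbors (h.left.neighbors_edgeOf i s h0), if_pos, edgeOf_vec]
  rw [edgeOf_vec, edgeOf_vec, lenSq_fracVec, lenSq_fracVec]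
  push_cast
  nlinarith [mul_nonneg a.cast_nonneg (α := ℤ) (c.cast_nonneg), sq_nonneg (c : ℤ),
    sq_nonneg (d : ℤ), (by positivity : (0 : ℤ) ≤ a * d + c * b + c * d + b * d)]

/-- Now the kept endpoint comes second, and `shorterNeighbor` resolves ties in favor of the first,
so the comparison has to be strict. -/
theorem FareyPath.shorterNeighbor_right {l C a b c d} (h : FareyPath l C a b c d) (i s)
    (h0 : (a + c + c).Coprime (b + d + d)) :
    (edgeOf i s h0).shorterNeighbor.vec = fracVec i s c d := by
  rw [shorterNeighbor_of_neighbors (h.right.neighbors_edgeOf i s h0), if_neg, edgeOf_vec]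
  rw [edgeOf_vec, edgeOf_vec, lenSq_fracVec, lenSq_fracVec]
  obtain ⟨hd, hb1, hd1, hcd, hab, hl⟩ := h.bounds
  push_cast
  have : (1 : ℤ) ≤ b := by exact_mod_cast hb1
  have : (1 : ℤ) ≤ d := by exact_mod_cast hd1
  nlinarith [(by positivity : (0 : ℤ) ≤ a * d + c * b + a * b + 2 * (a * c) + a ^ 2),
    mul_pos (by omega : (0 : ℤ) < b) (by omega : (0 : ℤ) < d)]

theorem flipDag_cons_cons (x g : ℚ) (C : List ℚ) (e : Edge) (v : Pt) :
    flipDag (x :: g :: C) e v =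
      ⟨{fareyParallelogram e v} ∪ (flipDag (g :: C) (e.ofFarey g) v).flips ∪
          (flipDag (g :: C) (e.ofFarey g) (v + e.shorterNeighbor.vec)).flips,
        {(fareyParallelogram (e.ofFarey g) v, fareyParallelogram e v),
          (fareyParallelogram (e.ofFarey g) (v + e.shorterNeighbor.vec),
            fareyParallelogram e v)} ∪ (flipDag (g :: C) (e.ofFarey g) v).arcs ∪
          (flipDag (g :: C) (e.ofFarey g) (v + e.shorterNeighbor.vec)).arcs⟩ := rfl

/-- The value at the head of the list is never read by `flipDag`, so `x` may be arbitrary. Removing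
the head undoes one bisection, and the next term is the mediant of the previous interval. -/
theorem FareyPath.flipDag_edgeOf {l C a b c d} (h : FareyPath l C a b c d) (i s) :
    ∀ (h0 : (a + c).Coprime (b + d)) (x : ℚ) (v : Pt),
      flipDag (x :: C) (edgeOf i s h0) v =
        treeDag (coordPair i).1 (coordPair i).2 (treePath s l) v := by
  induction h with
  | base =>
    intro h0 x v
    have e1 : (edgeOf i s h0).ofFarey 1 = edgeOf i s (Nat.coprime_one_left 1) := by
      simpa using ofFarey_edgeOf i s h0 (by norm_num) (Nat.coprime_one_left 1) le_rfl
    have e2 : ∀ w, fareyParallelogram (edgeOf i s (Nat.coprime_one_left 1)) w =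
        treeQuad (coordPair i).1 (coordPair i).2 [] w := by
      intro w
      rw [fareyParallelogram_one_one _ (by cases s <;> rfl) (by cases s <;> rfl),
        edgeOf_congr_pair]
    have e3 : (edgeOf i s h0).shorterNeighbor.vec = fracVec i s 0 1 := by
      rw [shorterNeighbor_of_neighbors (FareyPath.base.neighbors_edgeOf i s h0), if_pos,
        edgeOf_vec]
      rw [edgeOf_vec, edgeOf_vec, lenSq_fracVec, lenSq_fracVec]
      norm_num
    have e4 := fun w => FareyPath.base.fareyParallelogram_edgeOf i s h0 w
    rw [flipDag_cons_cons, e1, e2, e2, e3, e4]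
    simp only [flipDag, e2]
    cases s <;> simp [treePath, treeDag, treeShift, fracVec, treeBasis]
  | @left l C a b c d h ih =>
    intro h0 x v
    obtain ⟨hd, hb1, hd1, hcd, hab, hl⟩ := h.bounds
    have h1 := coprime_mediant hd
    rw [flipDag_cons_cons, ofFarey_edgeOf i s h0 (by omega) h1 (by omega), ih, ih,
      h.shorterNeighbor_left, h.fareyParallelogram_edgeOf, h.fareyParallelogram_edgeOf,
      h.left.fareyParallelogram_edgeOf]
    have hB := h.treeBasis_treePath i s
    cases s <;> simp only [treePath, Bool.false_eq_true, if_true, if_false] at hB ⊢ <;>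
      simp [treeDag, treeShift, hB]
  | @right l C a b c d h ih =>
    intro h0 x v
    obtain ⟨hd, hb1, hd1, hcd, hab, hl⟩ := h.bounds
    have h1 := coprime_mediant hd
    rw [flipDag_cons_cons, ofFarey_edgeOf i s h0 (by omega) h1 (by omega), ih, ih,
      h.shorterNeighbor_right, h.fareyParallelogram_edgeOf, h.fareyParallelogram_edgeOf,
      h.right.fareyParallelogram_edgeOf]
    have hB := h.treeBasis_treePath i s
    cases s <;> simp only [treePath, Bool.false_eq_true, if_true, if_false] at hB ⊢ <;>
      simp [treeDag, treeShift, hB]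

theorem fareyPlan_one_one (e : Edge) (hx : e.x = 1) (hy : e.y = 1) : fareyPlan e = [1] := by
  have h1 : e.toFarey = 1 := by simp [Edge.toFarey, hx, hy]
  rw [fareyPlan, if_neg (by simp [Edge.IsUnit, hx, hy]), h1]
  simp [fareyStep]

theorem exists_edgeOf (e : Edge) (h : ¬ e.IsUnit) :
    (e.x = 1 ∧ e.y = 1) ∨ ∃ (s : Bool) (a b : ℕ) (h : a.Coprime b), 1 ≤ a ∧ a < b ∧
      e = edgeOf e.pair s h := by
  obtain ⟨i, x, y, hc⟩ := e
  simp only [Edge.IsUnit] at h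
  rcases Nat.eq_zero_or_pos x with rfl | hx
  · rw [Nat.coprime_zero_left] at hc; omega
  rcases Nat.eq_zero_or_pos y with rfl | hy
  · rw [Nat.coprime_zero_right] at hc; omega
  rcases lt_trichotomy x y with hlt | rfl | hlt
  · exact Or.inr ⟨false, x, y, hc, hx, hlt, rfl⟩
  · left; simpa using hc
  · exact Or.inr ⟨true, y, x, hc.symm, hy, hlt, rfl⟩

/-- The flip plan algorithm, run on an edge that is not of unit length, follows a path in the tree
of bases. -/
theorem exists_flipDag_eq_treeDag (e : Edge) (h : ¬ e.IsUnit) :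
    ∃ l, e.vec = treeVec (coordPair e.pair).1 (coordPair e.pair).2 l ∧
      ∀ v, flipDag (fareyPlan e).reverse e v =
        treeDag (coordPair e.pair).1 (coordPair e.pair).2 l v := by
  rcases exists_edgeOf e h with ⟨hx, hy⟩ | ⟨s, p, q, hc, hp, hpq, he⟩
  · refine ⟨[], by simp [Edge.vec, hx, hy, treeVec, treeBasis], fun v => ?_⟩
    rw [fareyPlan_one_one e hx hy]
    simp [flipDag, treeDag, fareyParallelogram_one_one e hx hy]
  · obtain ⟨l, C, a, b, c, d, hP, rfl, rfl⟩ := exists_fareyPath hc hp hpq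
    generalize e.pair = i at he ⊢
    subst he
    refine ⟨treePath s l, by rw [edgeOf_vec, hP.treeVec_treePath], fun v => ?_⟩
    rw [hP.fareyPlan_edgeOf, hP.flipDag_edgeOf]

/-- Every sequence of bisections is a Farey path, so every nonempty tree path comes from one. Only
the root, the edge `(1, 1)`, has to be treated apart. -/
theorem exists_fareyPath_treePath (l : List Bool) (s : Bool) :
    ∃ l' C a b c d, FareyPath l' C a b c d ∧ treePath s l' = l ++ [s] := by
  suffices ∀ m, ∃ C a b c d, FareyPath m C a b c d by
    cases s
    · obtain ⟨C, a, b, c, d, h⟩ := this (l.map not)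
      exact ⟨_, C, a, b, c, d, h, by simp [treePath, Function.comp_def]⟩
    · obtain ⟨C, a, b, c, d, h⟩ := this l
      exact ⟨_, C, a, b, c, d, h, by simp [treePath]⟩
  intro m
  induction m with
  | nil => exact ⟨_, _, _, _, _, .base⟩
  | cons t m ih =>
    obtain ⟨C, a, b, c, d, h⟩ := ih
    cases t
    · exact ⟨_, _, _, _, _, h.right⟩
    · exact ⟨_, _, _, _, _, h.left⟩

/-- The parallelogram of a basis of the tree is a Farey parallelogram. -/
theorem exists_fareyParallelogram_eq (i : Fin 3) (l : List Bool) (v : Pt) :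
    ∃ g : Edge, ¬ g.IsUnit ∧
      treeQuad (coordPair i).1 (coordPair i).2 l v = fareyParallelogram g v := by
  rcases List.eq_nil_or_concat l with rfl | ⟨l, s, rfl⟩
  · refine ⟨⟨i, 1, 1, Nat.coprime_one_left 1⟩, by simp [Edge.IsUnit], ?_⟩
    rw [fareyParallelogram_one_one _ rfl rfl]
  · obtain ⟨l', C, a, b, c, d, h, hl⟩ := exists_fareyPath_treePath l s
    obtain ⟨hd, hb1, hd1, hcd, hab, -⟩ := h.bounds
    have h0 := coprime_mediant hd
    refine ⟨edgeOf i s h0, ?_, ?_⟩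
    · cases s <;> simp [edgeOf, Edge.IsUnit] <;> omega
    · rw [h.fareyParallelogram_edgeOf, hl, List.concat_eq_append]

/-! ### Hulls of lattice triangles -/

/-- The first coordinate of a point with respect to the basis `(p, q)` at `w`. -/
def coordX (w q : Pt) (x : Plane) : ℝ := (x.1 - w.1) * q.2 - (x.2 - w.2) * q.1

/-- The second coordinate of a point with respect to the basis `(p, q)` at `w`. -/
def coordY (w p : Pt) (x : Plane) : ℝ := p.1 * (x.2 - w.2) - p.2 * (x.1 - w.1)

theorem coordX_toPlane (w q z : Pt) : coordX w q (toPlane z) = cr (z - w) q := by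
  simp [coordX, toPlane, cr]

theorem coordY_toPlane (w p z : Pt) : coordY w p (toPlane z) = cr p (z - w) := by
  simp [coordY, toPlane, cr]

theorem hull_mono {s t : Finset Pt} (h : s ⊆ t) : hull s ⊆ hull t :=
  convexHull_mono (Set.image_mono (by exact_mod_cast h))

theorem toPlane_mem_hull {s : Finset Pt} {a : Pt} (h : a ∈ s) : toPlane a ∈ hull s :=
  subset_convexHull _ _ ⟨a, h, rfl⟩

theorem convex_hull (s : Finset Pt) : Convex ℝ (hull s) := convex_convexHull _ _

theorem mem_hull_pair {a b : Pt} {x : Plane} : x ∈ hull {a, b} ↔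
    ∃ α β : ℝ, 0 ≤ α ∧ 0 ≤ β ∧ α + β = 1 ∧ α • toPlane a + β • toPlane b = x := by
  have : hull {a, b} = segment ℝ (toPlane a) (toPlane b) := by
    rw [hull, Finset.coe_pair, Set.image_pair, convexHull_pair]
  rw [this, segment]
  rfl

theorem mem_hull_triple {a b c : Pt} {x : Plane} : x ∈ hull {a, b, c} ↔
    ∃ α β γ : ℝ, 0 ≤ α ∧ 0 ≤ β ∧ 0 ≤ γ ∧ α + β + γ = 1 ∧
      α • toPlane a + β • toPlane b + γ • toPlane c = x := by
  constructor
  · intro h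
    have e : hull {a, b, c} = convexJoin ℝ {toPlane a} (hull {b, c}) := by
      rw [hull, Finset.coe_insert, Set.image_insert_eq, convexHull_insert (by simp)]
      rfl
    rw [e, convexJoin_singleton_left] at h
    simp only [Set.mem_iUnion] at h
    obtain ⟨y, hy, hx⟩ := h
    obtain ⟨β, γ, hβ, hγ, h1, rfl⟩ := mem_hull_pair.1 hy
    obtain ⟨s, t, hs, ht, h2, rfl⟩ := hx
    refine ⟨s, t * β, t * γ, hs, by positivity, by positivity, ?_, by module⟩
    linear_combination h2 + t * h1
  · rintro ⟨α, β, γ, hα, hβ, hγ, h, rfl⟩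
    have := (convex_hull {a, b, c}).sum_mem (t := Finset.univ) (w := ![α, β, γ])
      (z := ![toPlane a, toPlane b, toPlane c])
      (by intro i _; fin_cases i <;> simpa) (by simpa [Fin.sum_univ_three] using h)
      (by intro i _; fin_cases i <;> exact toPlane_mem_hull (by simp))
    simpa [Fin.sum_univ_three] using this

/-- A lattice triangle with a basis on two of its sides, in coordinates. -/
theorem mem_hull_basis {w p q : Pt} (h : cr p q = 1) {x : Plane} :
    x ∈ hull {w, w + p, w + q} ↔
      0 ≤ coordX w q x ∧ 0 ≤ coordY w p x ∧ coordX w q x + coordY w p x ≤ 1 := by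
  have h' : (p.1 : ℝ) * q.2 - p.2 * q.1 = 1 := by exact_mod_cast h
  rw [mem_hull_triple]
  constructor
  · rintro ⟨α, β, γ, hα, hβ, hγ, hs, rfl⟩
    have e1 : coordX w q (α • toPlane w + β • toPlane (w + p) + γ • toPlane (w + q)) = β := by
      obtain rfl : α = 1 - β - γ := by linarith
      simp [coordX, toPlane]
      linear_combination β * h'
    have e2 : coordY w p (α • toPlane w + β • toPlane (w + p) + γ • toPlane (w + q)) = γ := by
      obtain rfl : α = 1 - β - γ := by linarith
      simp [coordY, toPlane]
      linear_combination γ * h'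
    rw [e1, e2]
    exact ⟨hβ, hγ, by linarith⟩
  · rintro ⟨h1, h2, h3⟩
    refine ⟨1 - coordX w q x - coordY w p x, coordX w q x, coordY w p x, by linarith, h1, h2,
      by ring, ?_⟩
    ext
    · simp [coordX, coordY, toPlane]
      linear_combination (x.1 - w.1) * h'
    · simp [coordX, coordY, toPlane]
      linear_combination (x.2 - w.2) * h'

/-- This is the criterion for the sheared basis `(p, p + q)`, which keeps the second coordinate and
subtracts it from the first. -/
theorem mem_hull_basis_diag {w p q : Pt} (h : cr p q = 1) {x : Plane} :
    x ∈ hull {w, w + p, w + (p + q)} ↔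
      0 ≤ coordY w p x ∧ coordY w p x ≤ coordX w q x ∧ coordX w q x ≤ 1 := by
  have h' : cr p (p + q) = 1 := by rw [← h]; simp [cr]; ring
  rw [mem_hull_basis h']
  have : coordX w (p + q) x = coordX w q x - coordY w p x := by simp [coordX, coordY]; ring
  rw [this]
  constructor <;> rintro ⟨h1, h2, h3⟩ <;> refine ⟨by linarith, by linarith, by linarith⟩

/-- The half turn of the parallelogram replaces `w, p, q` by `w + (p + q), -p, -q`. It preserves the
determinant and exchanges the two triangles on either side of a diagonal, so that facts about one
triangle transfer to the other. -/
theorem triple_rotate (w p q : Pt) :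
    ({w + (p + q), w + (p + q) + -p, w + (p + q) + -q} : Finset Pt) =
      {w + p, w + q, w + (p + q)} := by
  have e1 : w + (p + q) + -p = w + q := by abel
  have e2 : w + (p + q) + -q = w + p := by abel
  rw [e1, e2]
  ext x; simp; tauto

theorem triple_rotate_diag (w p q : Pt) :
    ({w + (p + q), w + (p + q) + -p, w + (p + q) + (-p + -q)} : Finset Pt) =
      {w, w + q, w + (p + q)} := by
  have e1 : w + (p + q) + -p = w + q := by abel
  have e2 : w + (p + q) + (-p + -q) = w := by abel
  rw [e1, e2]
  ext x; simp; tauto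

theorem cr_neg_neg (p q : Pt) : cr (-p) (-q) = cr p q := by simp [cr]

theorem coordX_rotate {w p q : Pt} (h : cr p q = 1) (x : Plane) :
    coordX (w + (p + q)) (-q) x = 1 - coordX w q x := by
  have h' : (p.1 : ℝ) * q.2 - p.2 * q.1 = 1 := by exact_mod_cast h
  simp [coordX]
  linear_combination h'

theorem coordY_rotate {w p q : Pt} (h : cr p q = 1) (x : Plane) :
    coordY (w + (p + q)) (-p) x = 1 - coordY w p x := by
  have h' : (p.1 : ℝ) * q.2 - p.2 * q.1 = 1 := by exact_mod_cast h
  simp [coordY]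
  linear_combination h'

theorem mem_hull_basis_opp {w p q : Pt} (h : cr p q = 1) {x : Plane} :
    x ∈ hull {w + p, w + q, w + (p + q)} ↔
      coordX w q x ≤ 1 ∧ coordY w p x ≤ 1 ∧ 1 ≤ coordX w q x + coordY w p x := by
  rw [← triple_rotate, mem_hull_basis (by rwa [cr_neg_neg]), coordX_rotate h, coordY_rotate h]
  constructor <;> rintro ⟨h1, h2, h3⟩ <;> refine ⟨by linarith, by linarith, by linarith⟩

theorem mem_hull_basis_diag_opp {w p q : Pt} (h : cr p q = 1) {x : Plane} :
    x ∈ hull {w, w + q, w + (p + q)} ↔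
      0 ≤ coordX w q x ∧ coordX w q x ≤ coordY w p x ∧ coordY w p x ≤ 1 := by
  rw [← triple_rotate_diag, mem_hull_basis_diag (by rwa [cr_neg_neg]), coordX_rotate h,
    coordY_rotate h]
  constructor <;> rintro ⟨h1, h2, h3⟩ <;> refine ⟨by linarith, by linarith, by linarith⟩

theorem eq_of_coord_eq {w p q : Pt} (h : cr p q = 1) {x y : Plane}
    (hX : coordX w q x = coordX w q y) (hY : coordY w p x = coordY w p y) : x = y := by
  have h' : (p.1 : ℝ) * q.2 - p.2 * q.1 = 1 := by exact_mod_cast h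
  simp only [coordX, coordY] at hX hY
  ext
  · linear_combination p.1 * hX + q.1 * hY - (x.1 - y.1) * h'
  · linear_combination p.2 * hX + q.2 * hY - (x.2 - y.2) * h'

theorem affineIndependent_triple {a b c : Pt} (hab : a ≠ b) (hac : a ≠ c) (hbc : b ≠ c) :
    AffineIndependent ℝ (fun p : ({a, b, c} : Finset Pt) => toPlane p) ↔
      cr (b - a) (c - a) ≠ 0 := by
  let f : Fin 3 → ({a, b, c} : Finset Pt) := ![⟨a, by simp⟩, ⟨b, by simp⟩, ⟨c, by simp⟩]
  have hf : Function.Bijective f := by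
    constructor
    · intro i j h
      fin_cases i <;> fin_cases j <;> simp_all [f]
    · rintro ⟨x, hx⟩
      simp only [Finset.mem_insert, Finset.mem_singleton] at hx
      rcases hx with rfl | rfl | rfl
      · exact ⟨0, rfl⟩
      · exact ⟨1, rfl⟩
      · exact ⟨2, rfl⟩
  rw [← affineIndependent_equiv (Equiv.ofBijective f hf)]
  have e : (fun p : ({a, b, c} : Finset Pt) => toPlane p) ∘ (Equiv.ofBijective f hf) =
      ![toPlane a, toPlane b, toPlane c] := by
    ext i <;> fin_cases i <;> rfl
  rw [e, affineIndependent_iff_linearIndependent_vsub ℝ _ (0 : Fin 3),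
    ← linearIndependent_equiv (finSuccAboveEquiv (0 : Fin 3))]
  have e2 : ((fun i : { x : Fin 3 // x ≠ 0 } =>
      (![toPlane a, toPlane b, toPlane c] i -ᵥ ![toPlane a, toPlane b, toPlane c] 0 : Plane)) ∘
        (finSuccAboveEquiv (0 : Fin 3))) = ![toPlane b - toPlane a, toPlane c - toPlane a] := by
    ext i <;> fin_cases i <;> rfl
  rw [e2, LinearIndependent.pair_iff]
  have hc : ((cr (b - a) (c - a) : ℤ) : ℝ) =
      ((b.1 : ℝ) - a.1) * (c.2 - a.2) - (b.2 - a.2) * (c.1 - a.1) := by simp [cr]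
  constructor
  · intro h h0
    rw [h0] at hc
    have h1 := h (c.2 - a.2) (-(b.2 - a.2)) (by
      ext
      · simp [toPlane]; push_cast at hc; linarith
      · simp [toPlane]; ring)
    have h2 := h (c.1 - a.1) (-(b.1 - a.1)) (by
      ext
      · simp [toPlane]; ring
      · simp [toPlane]; push_cast at hc; linarith)
    apply hac
    have e1 : (c.1 : ℝ) = a.1 := by linarith [h2.1]
    have e2 : (c.2 : ℝ) = a.2 := by linarith [h1.1]
    exact Prod.ext (by exact_mod_cast e1.symm) (by exact_mod_cast e2.symm)
  · intro h s t hst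
    have h0 : ((cr (b - a) (c - a) : ℤ) : ℝ) ≠ 0 := by exact_mod_cast h
    have h1 := congrArg Prod.fst hst
    have h2 := congrArg Prod.snd hst
    simp [toPlane] at h1 h2
    rw [hc] at h0
    constructor
    · apply (mul_eq_zero.1 (b := _ ) ?_).resolve_right h0
      linear_combination (c.2 - a.2 : ℝ) * h1 - (c.1 - a.1 : ℝ) * h2
    · apply (mul_eq_zero.1 (b := _ ) ?_).resolve_right h0
      linear_combination (b.1 - a.1 : ℝ) * h2 - (b.2 - a.2 : ℝ) * h1

theorem card_triple_of_cr_ne_zero {a b c : Pt} (h : cr (b - a) (c - a) ≠ 0) :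
    a ≠ b ∧ a ≠ c ∧ b ≠ c := by
  refine ⟨?_, ?_, ?_⟩
  · rintro rfl; simp [cr] at h
  · rintro rfl; simp [cr] at h
  · rintro rfl; apply h; simp only [cr]; ring

/-! ### Shared sides of facets and the existence of flips. -/

variable {Ω : Set Plane}

/-- A lattice point in a triangle of a triangulation is a vertex of the triangle. -/
theorem Triangulation.mem_of_toPlane_mem_hull (T : Triangulation Ω) {t : Finset Pt}
    (ht : t ∈ T.triangles) {p : Pt} (h : toPlane p ∈ hull t) : p ∈ t := by
  have hΩ : toPlane p ∈ Ω := by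
    rw [← T.cover]
    exact Set.mem_biUnion ht h
  obtain ⟨s, hs, hps⟩ := T.full p hΩ
  have h1 : toPlane p ∈ hull (s ∩ t) := by
    rw [← T.inter_eq s hs t ht]
    exact ⟨toPlane_mem_hull hps, h⟩
  -- By affine independence, a vertex of `s` in the affine span of `s ∩ t` belongs to `s ∩ t`.
  apply ((T.affineIndependent s hs).mem_affineSpan_iff ⟨p, hps⟩ {x : s | (x : Pt) ∈ t}).1
  refine convexHull_subset_affineSpan _ (convexHull_mono ?_ h1)
  rintro _ ⟨x, hx, rfl⟩
  rw [Finset.mem_coe, Finset.mem_inter] at hx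
  exact ⟨⟨x, hx.1⟩, hx.2, rfl⟩

/-- If a triangle shares the side opposite to `w` with another triangle, then it lies on the
opposite side of it. -/
theorem Triangulation.one_le_of_share_side (T : Triangulation Ω) {w p q : Pt} (h : cr p q = 1)
    (h1 : {w, w + p, w + q} ∈ T.triangles) {t : Finset Pt} (ht : t ∈ T.triangles)
    (hne : t ≠ {w, w + p, w + q}) (hp : w + p ∈ t) (hq : w + q ∈ t) {z : Pt} (hz : z ∈ t) :
    1 ≤ cr (z - w) q + cr p (z - w) := by
  by_contra! hlt
  have hlt' : coordX w q (toPlane z) + coordY w p (toPlane z) ≤ 0 := by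
    rw [coordX_toPlane, coordY_toPlane]
    exact_mod_cast (by omega)
  have h' : (p.1 : ℝ) * q.2 - p.2 * q.1 = 1 := by exact_mod_cast h
  have hw : w ∉ t := by
    intro hw
    apply hne
    symm
    apply Finset.eq_of_subset_of_card_le
    · intro x hx
      simp only [Finset.mem_insert, Finset.mem_singleton] at hx
      rcases hx with rfl | rfl | rfl <;> assumption
    · rw [T.card_eq_three _ ht, T.card_eq_three _ h1]
  set X := coordX w q (toPlane z)
  set Y := coordY w p (toPlane z)
  -- The point `y` below is the midpoint of the common side, moved towards `z`. This `ε` keeps its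
  -- two coordinates nonnegative, while their sum drops below 1; so `y` lies in both triangles but
  -- not on their common side.
  obtain ⟨ε, hε, hε2⟩ : ∃ ε : ℝ, 0 < ε ∧ ε * (1 + |X| + |Y|) = 1 / 2 :=
    ⟨1 / (2 * (1 + |X| + |Y|)), by positivity, by field_simp⟩
  have aX := neg_abs_le X
  have aY := neg_abs_le Y
  have hε1 : ε ≤ 1 / 2 := by nlinarith [abs_nonneg X, abs_nonneg Y]
  set y : Plane := ((1 - ε) / 2) • toPlane (w + p) + ((1 - ε) / 2) • toPlane (w + q) +
    ε • toPlane z with hy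
  have hyt : y ∈ hull t := by
    apply hull_mono (s := {w + p, w + q, z})
    · intro x hx
      simp only [Finset.mem_insert, Finset.mem_singleton] at hx
      rcases hx with rfl | rfl | rfl <;> assumption
    · exact mem_hull_triple.2 ⟨_, _, _, by linarith, by linarith, hε.le, by ring, rfl⟩
  have eX : coordX w q y = (1 - ε) / 2 + ε * X := by
    simp [hy, X, coordX, toPlane]
    linear_combination ((1 - ε) / 2) * h'
  have eY : coordY w p y = (1 - ε) / 2 + ε * Y := by
    simp [hy, Y, coordY, toPlane]
    linear_combination ((1 - ε) / 2) * h'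
  have hs : coordX w q y + coordY w p y < 1 := by
    rw [eX, eY]
    nlinarith
  have hy1 : y ∈ hull {w, w + p, w + q} := by
    rw [mem_hull_basis h]
    refine ⟨?_, ?_, hs.le⟩
    · rw [eX]; nlinarith [abs_nonneg X, abs_nonneg Y]
    · rw [eY]; nlinarith [abs_nonneg X, abs_nonneg Y]
  have hy2 : y ∈ hull {w + p, w + q} := by
    apply hull_mono (s := {w, w + p, w + q} ∩ t)
    · intro x hx
      simp only [Finset.mem_inter, Finset.mem_insert, Finset.mem_singleton] at hx ⊢
      rcases hx with ⟨rfl | h | h, hx⟩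
      · exact absurd hx hw
      · exact Or.inl h
      · exact Or.inr h
    · rw [← T.inter_eq _ h1 _ ht]
      exact ⟨hy1, hyt⟩
  obtain ⟨α, β, -, -, hαβ, e⟩ := mem_hull_pair.1 hy2
  rw [← e] at hs
  apply hs.ne
  obtain rfl : α = 1 - β := by linarith
  simp [coordX, coordY, toPlane]
  linear_combination h'

/-- A third facet on the diagonal would lie on the far side of both triangles. Its remaining vertex
would then be on the line of the diagonal, and the facet would be degenerate. -/
theorem Triangulation.eq_or_eq_of_share_side (T : Triangulation Ω) {w p q : Pt} (h : cr p q = 1)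
    (h1 : {w, w + p, w + q} ∈ T.triangles) (h2 : {w + p, w + q, w + (p + q)} ∈ T.triangles)
    {t : Finset Pt} (ht : t ∈ T.triangles) (hp : w + p ∈ t) (hq : w + q ∈ t) :
    t = {w, w + p, w + q} ∨ t = {w + p, w + q, w + (p + q)} := by
  by_contra! hc
  have hpq : w + p ≠ w + q := by
    intro e
    rw [add_right_inj] at e
    subst e
    simp [cr] at h
    rw [mul_comm, sub_self] at h
    exact zero_ne_one h
  obtain ⟨z, hz, hz1, hz2⟩ : ∃ z ∈ t, z ≠ w + p ∧ z ≠ w + q := by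
    obtain ⟨z, hz, hz'⟩ := Finset.exists_mem_notMem_of_card_lt_card
      (s := {w + p, w + q}) (t := t) (by
        rw [T.card_eq_three t ht]; exact Finset.card_le_two.trans_lt (by norm_num))
    exact ⟨z, hz, by simpa using hz'⟩
  have ht' : t = {w + p, w + q, z} := by
    symm
    apply Finset.eq_of_subset_of_card_le
    · intro x hx
      simp only [Finset.mem_insert, Finset.mem_singleton] at hx
      rcases hx with rfl | rfl | rfl <;> assumption
    · rw [T.card_eq_three _ ht, Finset.card_eq_three.2 ⟨_, _, _, hpq, hz1.symm, hz2.symm, rfl⟩]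
  have b1 := T.one_le_of_share_side h h1 ht hc.1 hp hq hz
  have b2 := T.one_le_of_share_side (w := w + (p + q)) (p := -p) (q := -q)
    (by rwa [cr_neg_neg]) (by rwa [triple_rotate]) ht (by rw [triple_rotate]; exact hc.2)
    (by convert hq using 1; abel) (by convert hp using 1; abel) hz
  have hA := T.affineIndependent t ht
  rw [ht'] at hA
  apply (affineIndependent_triple hpq hz1.symm hz2.symm).1 hA
  simp [cr] at b1 b2 h ⊢
  nlinarith

/-- The first of the two new triangles of a flip meets the old ones in common faces. -/
theorem Triangulation.inter_diag (T : Triangulation Ω) {w p q : Pt} (h : cr p q = 1)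
    (h1 : {w, w + p, w + q} ∈ T.triangles) (h2 : {w + p, w + q, w + (p + q)} ∈ T.triangles)
    {t : Finset Pt} (ht : t ∈ T.triangles) (ht1 : t ≠ {w, w + p, w + q})
    (ht2 : t ≠ {w + p, w + q, w + (p + q)}) :
    hull {w, w + p, w + (p + q)} ∩ hull t = hull ({w, w + p, w + (p + q)} ∩ t) := by
  apply Set.Subset.antisymm _
    (Set.subset_inter (hull_mono Finset.inter_subset_left) (hull_mono Finset.inter_subset_right))
  rintro x ⟨hx, hxt⟩
  have h' : (p.1 : ℝ) * q.2 - p.2 * q.1 = 1 := by exact_mod_cast h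
  obtain ⟨a1, a2, a3⟩ := (mem_hull_basis_diag h).1 hx
  -- The new triangle is covered by the two old ones, for which the common face property is known.
  have hor : x ∈ hull ({w, w + p, w + q} ∩ t) ∨ x ∈ hull ({w + p, w + q, w + (p + q)} ∩ t) := by
    rw [← T.inter_eq _ h1 _ ht, ← T.inter_eq _ h2 _ ht]
    rcases le_total (coordX w q x + coordY w p x) 1 with hle | hle
    · exact Or.inl ⟨(mem_hull_basis h).2 ⟨by linarith, a1, hle⟩, hxt⟩
    · exact Or.inr ⟨(mem_hull_basis_opp h).2 ⟨a3, by linarith, hle⟩, hxt⟩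
  by_cases hq : w + q ∈ t
  -- The only critical case is that `t` contains `w + q`, the vertex missing in the new triangle.
  -- Then `t` does not contain `w + p`, so `x` lies on a side at `w + q`, and this side meets the
  -- new triangle only in its other end.
  · have hp : w + p ∉ t := by
      intro hp
      rcases T.eq_or_eq_of_share_side h h1 h2 ht hp hq with h | h
      · exact ht1 h
      · exact ht2 h
    rcases hor with hx1 | hx1
    · have hx2 : x ∈ hull {w, w + q} := by
        apply hull_mono _ hx1
        intro y hy
        simp only [Finset.mem_inter, Finset.mem_insert, Finset.mem_singleton] at hy ⊢
        rcases hy with ⟨h | rfl | h, hy⟩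
        · exact Or.inl h
        · exact absurd hy hp
        · exact Or.inr h
      obtain ⟨α, β, hα, hβ, hαβ, rfl⟩ := mem_hull_pair.1 hx2
      obtain rfl : α = 1 - β := by linarith
      have eY : coordY w p ((1 - β) • toPlane w + β • toPlane (w + q)) = β := by
        simp [coordY, toPlane]; linear_combination β * h'
      have eX : coordX w q ((1 - β) • toPlane w + β • toPlane (w + q)) = 0 := by
        simp [coordX, toPlane]; ring
      have hβ0 : β = 0 := by linarith
      subst hβ0
      have hw : w ∈ t := by
        by_contra hw
        have hx3 : (1 - 0 : ℝ) • toPlane w + (0 : ℝ) • toPlane (w + q) ∈ hull {w + q, w + q} := by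
          apply hull_mono _ hx1
          intro y hy
          simp only [Finset.mem_inter, Finset.mem_insert, Finset.mem_singleton] at hy ⊢
          rcases hy with ⟨rfl | rfl | h, hy⟩
          · exact absurd hy hw
          · exact absurd hy hp
          · exact Or.inl h
        obtain ⟨α', β', -, -, e, e'⟩ := mem_hull_pair.1 hx3
        rw [← add_smul, e] at e'
        have := congrArg (coordY w p) e'
        rw [eY, one_smul, coordY_toPlane, add_sub_cancel_left, h] at this
        norm_num at this
      have : (1 - 0 : ℝ) • toPlane w + (0 : ℝ) • toPlane (w + q) = toPlane w := by simp
      rw [this]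
      exact toPlane_mem_hull (by simp [hw])
    · have hx2 : x ∈ hull {w + (p + q), w + q} := by
        apply hull_mono _ hx1
        intro y hy
        simp only [Finset.mem_inter, Finset.mem_insert, Finset.mem_singleton] at hy ⊢
        rcases hy with ⟨rfl | h | h, hy⟩
        · exact absurd hy hp
        · exact Or.inr h
        · exact Or.inl h
      obtain ⟨α, β, hα, hβ, hαβ, rfl⟩ := mem_hull_pair.1 hx2
      obtain rfl : α = 1 - β := by linarith
      have eY : coordY w p ((1 - β) • toPlane (w + (p + q)) + β • toPlane (w + q)) = 1 := by
        simp [coordY, toPlane]; linear_combination h'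
      have eX : coordX w q ((1 - β) • toPlane (w + (p + q)) + β • toPlane (w + q)) = 1 - β := by
        simp [coordX, toPlane]; linear_combination (1 - β) * h'
      have hβ0 : β = 0 := by linarith
      subst hβ0
      have hw : w + (p + q) ∈ t := by
        by_contra hw
        have hx3 : (1 - 0 : ℝ) • toPlane (w + (p + q)) + (0 : ℝ) • toPlane (w + q) ∈
            hull {w + q, w + q} := by
          apply hull_mono _ hx1
          intro y hy
          simp only [Finset.mem_inter, Finset.mem_insert, Finset.mem_singleton] at hy ⊢
          rcases hy with ⟨rfl | h | rfl, hy⟩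
          · exact absurd hy hp
          · exact Or.inl h
          · exact absurd hy hw
        obtain ⟨α', β', -, -, e, e'⟩ := mem_hull_pair.1 hx3
        rw [← add_smul, e] at e'
        have := congrArg (coordX w q) e'
        rw [eX, one_smul, coordX_toPlane, add_sub_cancel_left] at this
        have h0 : cr q q = 0 := by simp [cr]; ring
        rw [h0] at this
        norm_num at this
      have : (1 - 0 : ℝ) • toPlane (w + (p + q)) + (0 : ℝ) • toPlane (w + q) =
        toPlane (w + (p + q)) := by simp
      rw [this]
      exact toPlane_mem_hull (by simp [hw])
  · rcases hor with hx1 | hx1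
    · apply hull_mono _ hx1
      intro y hy
      simp only [Finset.mem_inter, Finset.mem_insert, Finset.mem_singleton] at hy ⊢
      rcases hy with ⟨h | h | rfl, hy⟩
      · exact ⟨Or.inl h, hy⟩
      · exact ⟨Or.inr (Or.inl h), hy⟩
      · exact absurd hy hq
    · apply hull_mono _ hx1
      intro y hy
      simp only [Finset.mem_inter, Finset.mem_insert, Finset.mem_singleton] at hy ⊢
      rcases hy with ⟨h | rfl | h, hy⟩
      · exact ⟨Or.inr (Or.inl h), hy⟩
      · exact absurd hy hq
      · exact ⟨Or.inr (Or.inr h), hy⟩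

theorem Triangulation.inter_diag_opp (T : Triangulation Ω) {w p q : Pt} (h : cr p q = 1)
    (h1 : {w, w + p, w + q} ∈ T.triangles) (h2 : {w + p, w + q, w + (p + q)} ∈ T.triangles)
    {t : Finset Pt} (ht : t ∈ T.triangles) (ht1 : t ≠ {w, w + p, w + q})
    (ht2 : t ≠ {w + p, w + q, w + (p + q)}) :
    hull {w, w + q, w + (p + q)} ∩ hull t = hull ({w, w + q, w + (p + q)} ∩ t) := by
  have e : ({w + (p + q) + -p, w + (p + q) + -q, w + (p + q) + (-p + -q)} : Finset Pt) =
      {w, w + p, w + q} := by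
    have e1 : w + (p + q) + -p = w + q := by abel
    have e2 : w + (p + q) + -q = w + p := by abel
    have e3 : w + (p + q) + (-p + -q) = w := by abel
    rw [e1, e2, e3]
    ext x; simp; tauto
  have := T.inter_diag (w := w + (p + q)) (p := -p) (q := -q) (by rwa [cr_neg_neg])
    (by rwa [triple_rotate]) (by rwa [e]) ht (by rwa [triple_rotate]) (by rwa [e])
  rwa [triple_rotate_diag] at this

theorem hull_diag_inter_hull_diag_opp {w p q : Pt} (h : cr p q = 1) :
    hull {w, w + p, w + (p + q)} ∩ hull {w, w + q, w + (p + q)} =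
      hull ({w, w + p, w + (p + q)} ∩ {w, w + q, w + (p + q)}) := by
  apply Set.Subset.antisymm _
    (Set.subset_inter (hull_mono Finset.inter_subset_left) (hull_mono Finset.inter_subset_right))
  rintro x ⟨h1, h2⟩
  obtain ⟨a1, a2, a3⟩ := (mem_hull_basis_diag h).1 h1
  obtain ⟨b1, b2, b3⟩ := (mem_hull_basis_diag_opp h).1 h2
  apply hull_mono (s := {w, w + (p + q)}) (by intro y; simp; tauto)
  have h' : (p.1 : ℝ) * q.2 - p.2 * q.1 = 1 := by exact_mod_cast h
  refine mem_hull_pair.2 ⟨1 - coordX w q x, coordX w q x, by linarith, by linarith, by ring, ?_⟩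
  apply eq_of_coord_eq (w := w) h
  · generalize coordX w q x = s
    simp [coordX, toPlane]
    linear_combination s * h'
  · rw [← le_antisymm b2 a2]
    generalize coordX w q x = s
    simp [coordY, toPlane]
    linear_combination s * h'

/-- The triangulation after a flip. -/
theorem Triangulation.exists_isFlip (T : Triangulation Ω) {w p q : Pt} (h : cr p q = 1)
    (h1 : {w, w + p, w + q} ∈ T.triangles) (h2 : {w + p, w + q, w + (p + q)} ∈ T.triangles) :
    ∃ T' : Triangulation Ω, T'.triangles =
      (T.triangles \ {{w, w + p, w + q}, {w + p, w + q, w + (p + q)}}) ∪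
        {{w, w + p, w + (p + q)}, {w, w + q, w + (p + q)}} ∧
      IsFlip T {w, w + p, w + (p + q), w + q} T' := by
  have h' : (p.1 : ℝ) * q.2 - p.2 * q.1 = 1 := by exact_mod_cast h
  have c1 : cr (w + p - w) (w + (p + q) - w) ≠ 0 := by
    simp [cr] at h ⊢; intro h0; linarith
  have c2 : cr (w + q - w) (w + (p + q) - w) ≠ 0 := by
    simp [cr] at h ⊢; intro h0; linarith
  obtain ⟨n1, n2, n3⟩ := card_triple_of_cr_ne_zero c1
  obtain ⟨m1, m2, m3⟩ := card_triple_of_cr_ne_zero c2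
  let T' : Triangulation Ω :=
    { triangles := (T.triangles \ {{w, w + p, w + q}, {w + p, w + q, w + (p + q)}}) ∪
        {{w, w + p, w + (p + q)}, {w, w + q, w + (p + q)}}
      card_eq_three := by
        rintro t (⟨ht, -⟩ | rfl | rfl)
        · exact T.card_eq_three t ht
        · exact Finset.card_eq_three.2 ⟨_, _, _, n1, n2, n3, rfl⟩
        · exact Finset.card_eq_three.2 ⟨_, _, _, m1, m2, m3, rfl⟩
      affineIndependent := by
        rintro t (⟨ht, -⟩ | rfl | rfl)
        · exact T.affineIndependent t ht
        · exact (affineIndependent_triple n1 n2 n3).2 c1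
        · exact (affineIndependent_triple m1 m2 m3).2 c2
      inter_eq := by
        rintro s (⟨hs, hs'⟩ | rfl | rfl) t (⟨ht, ht'⟩ | rfl | rfl)
        · exact T.inter_eq s hs t ht
        · simp only [Set.mem_insert_iff, Set.mem_singleton_iff, not_or] at hs'
          rw [Set.inter_comm, Finset.inter_comm]
          exact T.inter_diag h h1 h2 hs hs'.1 hs'.2
        · simp only [Set.mem_insert_iff, Set.mem_singleton_iff, not_or] at hs'
          rw [Set.inter_comm, Finset.inter_comm]
          exact T.inter_diag_opp h h1 h2 hs hs'.1 hs'.2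
        · simp only [Set.mem_insert_iff, Set.mem_singleton_iff, not_or] at ht'
          exact T.inter_diag h h1 h2 ht ht'.1 ht'.2
        · rw [Set.inter_self, Finset.inter_self]
        · exact hull_diag_inter_hull_diag_opp h
        · simp only [Set.mem_insert_iff, Set.mem_singleton_iff, not_or] at ht'
          exact T.inter_diag_opp h h1 h2 ht ht'.1 ht'.2
        · rw [Set.inter_comm, Finset.inter_comm]
          exact hull_diag_inter_hull_diag_opp h
        · rw [Set.inter_self, Finset.inter_self]
      cover := by
        refine Eq.trans ?_ T.cover
        ext x
        simp only [Set.mem_iUnion, exists_prop]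
        constructor
        · rintro ⟨t, ⟨ht, -⟩ | rfl | rfl, hx⟩
          · exact ⟨t, ht, hx⟩
          · obtain ⟨a1, a2, a3⟩ := (mem_hull_basis_diag h).1 hx
            rcases le_total (coordX w q x + coordY w p x) 1 with hle | hle
            · exact ⟨_, h1, (mem_hull_basis h).2 ⟨by linarith, a1, hle⟩⟩
            · exact ⟨_, h2, (mem_hull_basis_opp h).2 ⟨a3, by linarith, hle⟩⟩
          · obtain ⟨a1, a2, a3⟩ := (mem_hull_basis_diag_opp h).1 hx
            rcases le_total (coordX w q x + coordY w p x) 1 with hle | hle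
            · exact ⟨_, h1, (mem_hull_basis h).2 ⟨by linarith, by linarith, hle⟩⟩
            · exact ⟨_, h2, (mem_hull_basis_opp h).2 ⟨by linarith, by linarith, hle⟩⟩
        · rintro ⟨t, ht, hx⟩
          by_cases ht1 : t = {w, w + p, w + q}
          · subst ht1
            obtain ⟨a1, a2, a3⟩ := (mem_hull_basis h).1 hx
            rcases le_total (coordX w q x) (coordY w p x) with hle | hle
            · exact ⟨_, Or.inr (Or.inr rfl),
                (mem_hull_basis_diag_opp h).2 ⟨a1, hle, by linarith⟩⟩
            · exact ⟨_, Or.inr (Or.inl rfl), (mem_hull_basis_diag h).2 ⟨a2, hle, by linarith⟩⟩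
          by_cases ht2 : t = {w + p, w + q, w + (p + q)}
          · subst ht2
            obtain ⟨a1, a2, a3⟩ := (mem_hull_basis_opp h).1 hx
            rcases le_total (coordX w q x) (coordY w p x) with hle | hle
            · exact ⟨_, Or.inr (Or.inr rfl),
                (mem_hull_basis_diag_opp h).2 ⟨by linarith, hle, by linarith⟩⟩
            · exact ⟨_, Or.inr (Or.inl rfl),
                (mem_hull_basis_diag h).2 ⟨by linarith, hle, by linarith⟩⟩
          exact ⟨t, Or.inl ⟨ht, by simp [ht1, ht2]⟩, hx⟩
      full := by
        intro z hz
        obtain ⟨t, ht, hzt⟩ := T.full z hz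
        have hA1 : z = w ∨ z = w + p ∨ z = w + (p + q) →
            ∃ t ∈ (T.triangles \ {{w, w + p, w + q}, {w + p, w + q, w + (p + q)}}) ∪
              {{w, w + p, w + (p + q)}, {w, w + q, w + (p + q)}}, z ∈ t :=
          fun hz => ⟨{w, w + p, w + (p + q)}, Or.inr (Or.inl rfl), by simpa using hz⟩
        have hA2 : z = w + q →
            ∃ t ∈ (T.triangles \ {{w, w + p, w + q}, {w + p, w + q, w + (p + q)}}) ∪
              {{w, w + p, w + (p + q)}, {w, w + q, w + (p + q)}}, z ∈ t :=
          fun hz => ⟨{w, w + q, w + (p + q)}, Or.inr (Or.inr rfl), by simp [hz]⟩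
        by_cases ht1 : t = {w, w + p, w + q}
        · subst ht1
          simp only [Finset.mem_insert, Finset.mem_singleton] at hzt
          tauto
        by_cases ht2 : t = {w + p, w + q, w + (p + q)}
        · subst ht2
          simp only [Finset.mem_insert, Finset.mem_singleton] at hzt
          tauto
        exact ⟨t, Or.inl ⟨ht, by simp [ht1, ht2]⟩, hzt⟩ }
  -- The cyclic order starts at an end of the old diagonal, which `IsFlip` expects to join the first
  -- and third vertices.
  refine ⟨T', rfl, w + p, w + (p + q), w + q, w, ?_, ?_, ?_, ?_, ?_⟩
  · ext x; simp; tauto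
  · refine ⟨(1 / 2 : ℝ) • toPlane (w + p) + (1 / 2 : ℝ) • toPlane (w + q),
      ⟨1 / 2, 1 / 2, by norm_num, by norm_num, by norm_num, rfl⟩,
      ⟨1 / 2, 1 / 2, by norm_num, by norm_num, by norm_num, ?_⟩⟩
    ext <;> simp [toPlane] <;> ring
  · convert h2 using 1; ext x; simp; tauto
  · convert h1 using 1; ext x; simp; tauto
  · have e1 : ({w + p, w + (p + q), w + q} : Finset Pt) = {w + p, w + q, w + (p + q)} := by
      ext x; simp; tauto
    have e2 : ({w + p, w + q, w} : Finset Pt) = {w, w + p, w + q} := by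
      ext x; simp; tauto
    have e3 : ({w + p, w + (p + q), w} : Finset Pt) = {w, w + p, w + (p + q)} := by
      ext x; simp; tauto
    have e4 : ({w + (p + q), w + q, w} : Finset Pt) = {w, w + q, w + (p + q)} := by
      ext x; simp; tauto
    rw [e1, e2, e3, e4, Set.pair_comm {w + p, w + q, w + (p + q)}]

/-! ### Equilateral triangulations -/

theorem cr_combination (p q r : Pt) : (cr p r) • q = (cr q r) • p + (cr p q) • r := by
  ext <;> simp [cr] <;> ring

/-- An equilateral lattice triangle contains a lattice point at distance one from a vertex. -/
theorem exists_unit_between (p : Pt) : ∃ q : Pt, lenSq q = 1 ∧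
    0 ≤ cr q (-p.2, p.1 + p.2) ∧ 0 ≤ cr p q ∧
    cr q (-p.2, p.1 + p.2) + cr p q ≤ lenSq p := by
  obtain ⟨m, n⟩ := p
  have key : ∀ x y : ℤ, 0 ≤ x → 0 ≤ y → x + y ≤ x ^ 2 + x * y + y ^ 2 := by
    intro x y hx hy
    nlinarith [mul_nonneg hx hy, sq_nonneg (x - 1), sq_nonneg (y - 1), Int.le_self_sq x,
      Int.le_self_sq y]
  -- The six unit vectors are sixty degrees apart, so one of them lies in the closed cone between
  -- `p` and its rotation; the signs of `m`, `n` and `m + n` tell which one. The arguments of `key`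
  -- are the nonnegative coordinates of `p` in its own sector.
  rcases le_total 0 m with hm | hm <;> rcases le_total 0 n with hn | hn <;>
    rcases le_total 0 (m + n) with hs | hs
  · exact ⟨(0, 1), by simp [lenSq], by simp [cr]; omega, by simp [cr]; omega,
      by have := key m n hm hn; simp [cr, lenSq]; linarith⟩
  · exact ⟨(0, 1), by simp [lenSq], by simp [cr]; omega, by simp [cr]; omega,
      by have := key m n hm hn; simp [cr, lenSq]; linarith⟩
  · exact ⟨(1, 0), by simp [lenSq], by simp [cr]; omega, by simp [cr]; omega,
      by have := key (m + n) (-n) hs (by omega); simp [cr, lenSq]; linarith⟩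
  · exact ⟨(1, -1), by simp [lenSq], by simp [cr]; omega, by simp [cr]; omega,
      by have := key m (-m - n) hm (by omega); simp [cr, lenSq]; linarith⟩
  · exact ⟨(-1, 1), by simp [lenSq], by simp [cr]; omega, by simp [cr]; omega,
      by have := key (-m) (m + n) (by omega) (by omega); simp [cr, lenSq]; linarith⟩
  · exact ⟨(-1, 0), by simp [lenSq], by simp [cr]; omega, by simp [cr]; omega,
      by have := key n (-m - n) hn (by omega); simp [cr, lenSq]; linarith⟩
  · exact ⟨(0, -1), by simp [lenSq], by simp [cr]; omega, by simp [cr]; omega,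
      by have := key (-m) (-n) (by omega) (by omega); simp [cr, lenSq]; linarith⟩
  · exact ⟨(0, -1), by simp [lenSq], by simp [cr]; omega, by simp [cr]; omega,
      by have := key (-m) (-n) (by omega) (by omega); simp [cr, lenSq]; linarith⟩

/-- The two kinds of unit triangles. -/
def upTri (z : Pt) : Finset Pt := {z, z + (1, 0), z + (0, 1)}

/-- The two kinds of unit triangles. -/
def downTri (z : Pt) : Finset Pt := {z + (1, 0), z + (0, 1), z + ((1, 0) + (0, 1))}

theorem unit_triangle (a p : Pt) (h : lenSq p = 1) :
    ∃ z, ({a, a + p, a + (-p.2, p.1 + p.2)} : Finset Pt) = upTri z ∨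
      ({a, a + p, a + (-p.2, p.1 + p.2)} : Finset Pt) = downTri z := by
  obtain ⟨m, n⟩ := p
  obtain ⟨x, y⟩ := a
  simp only [lenSq] at h
  have hm1 : -1 ≤ m := by nlinarith [sq_nonneg (m + 2 * n)]
  have hm2 : m ≤ 1 := by nlinarith [sq_nonneg (m + 2 * n)]
  have hn1 : -1 ≤ n := by nlinarith [sq_nonneg (2 * m + n)]
  have hn2 : n ≤ 1 := by nlinarith [sq_nonneg (2 * m + n)]
  obtain rfl | rfl | rfl : m = -1 ∨ m = 0 ∨ m = 1 := by omega
  · obtain rfl | rfl | rfl : n = -1 ∨ n = 0 ∨ n = 1 := by omega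
    · omega
    · refine ⟨(x - 1, y - 1), Or.inr ?_⟩
      ext ⟨u, v⟩; simp [downTri]; omega
    · refine ⟨(x - 1, y), Or.inl ?_⟩
      ext ⟨u, v⟩; simp [upTri]; omega
  · obtain rfl | rfl | rfl : n = -1 ∨ n = 0 ∨ n = 1 := by omega
    · refine ⟨(x, y - 1), Or.inl ?_⟩
      ext ⟨u, v⟩; simp [upTri]; omega
    · omega
    · refine ⟨(x - 1, y), Or.inr ?_⟩
      ext ⟨u, v⟩; simp [downTri]; omega
  · obtain rfl | rfl | rfl : n = -1 ∨ n = 0 ∨ n = 1 := by omega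
    · refine ⟨(x, y - 1), Or.inr ?_⟩
      ext ⟨u, v⟩; simp [downTri]; omega
    · refine ⟨(x, y), Or.inl ?_⟩
      ext ⟨u, v⟩; simp [upTri]
    · omega

/-- The lattice point at distance one from `a` that lies in the triangle must be a vertex by
fullness, and both other vertices have squared distance `lenSq p` from `a`. -/
theorem Triangulation.unit_of_rotate (T : Triangulation Ω) {a p : Pt} (hp : 0 < lenSq p)
    (ht : {a, a + p, a + (-p.2, p.1 + p.2)} ∈ T.triangles) : lenSq p = 1 := by
  obtain ⟨q, h1, h2, h3, h4⟩ := exists_unit_between p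
  have hN : cr p (-p.2, p.1 + p.2) = lenSq p := by simp [cr, lenSq]; ring
  have hc := cr_combination p q (-p.2, p.1 + p.2)
  rw [hN] at hc
  have hmem : a + q ∈ ({a, a + p, a + (-p.2, p.1 + p.2)} : Finset Pt) := by
    apply T.mem_of_toPlane_mem_hull ht
    rw [mem_hull_triple]
    generalize (-p.2, p.1 + p.2) = r at *
    have hN' : (0 : ℝ) < lenSq p := by exact_mod_cast hp
    have h2' : (0 : ℝ) ≤ cr q r := by exact_mod_cast h2
    have h3' : (0 : ℝ) ≤ cr p q := by exact_mod_cast h3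
    have h4' : (cr q r : ℝ) + cr p q ≤ lenSq p := by exact_mod_cast h4
    refine ⟨1 - (cr q r + cr p q) / lenSq p, cr q r / lenSq p, cr p q / lenSq p, ?_,
      by positivity, by positivity, by ring, ?_⟩
    · rw [sub_nonneg, div_le_one hN']
      exact h4'
    · have e1 := congrArg Prod.fst hc
      have e2 := congrArg Prod.snd hc
      simp only [Prod.smul_fst, Prod.smul_snd, Prod.fst_add, Prod.snd_add, smul_eq_mul] at e1 e2
      have e1' : (lenSq p : ℝ) * q.1 = cr q r * p.1 + cr p q * r.1 := by exact_mod_cast e1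
      have e2' : (lenSq p : ℝ) * q.2 = cr q r * p.2 + cr p q * r.2 := by exact_mod_cast e2
      ext
      · simp [toPlane]
        field_simp
        linear_combination -e1'
      · simp [toPlane]
        field_simp
        linear_combination -e2'
  simp only [Finset.mem_insert, Finset.mem_singleton, add_right_inj, add_eq_left] at hmem
  rcases hmem with rfl | rfl | rfl
  · simp [lenSq] at h1
  · exact h1
  · rw [← h1]; simp [lenSq]; ring

/-- With `N` the common squared length, the law of cosines says that twice the inner product of `p`
and `r` is `N`. Lagrange's identity then gives `cr p r = N` or `cr p r = -N`, and these two linear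
equations determine one vector as a rotation of the other. -/
theorem rotate_of_equilateral {p r : Pt} (h1 : lenSq p = lenSq r) (h2 : lenSq p = lenSq (r - p))
    (hc : cr p r ≠ 0) :
    0 < lenSq p ∧ (r = (-p.2, p.1 + p.2) ∨ p = (-r.2, r.1 + r.2)) := by
  obtain ⟨x, y⟩ := p
  obtain ⟨s, t⟩ := r
  simp only [lenSq, cr, Prod.fst_sub, Prod.snd_sub, Prod.mk.injEq] at *
  set N := x ^ 2 + x * y + y ^ 2 with hN
  have hpos : 0 < N := by
    rcases eq_or_ne y 0 with rfl | hy
    · rcases eq_or_ne x 0 with rfl | hx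
      · simp at hc
      · have : 0 < x ^ 2 := by positivity
        nlinarith
    · have : 0 < y ^ 2 := by positivity
      nlinarith [sq_nonneg (2 * x + y)]
  refine ⟨hpos, ?_⟩
  have i1 : 2 * x * s + x * t + y * s + 2 * y * t = N := by nlinarith
  have i2 : (x * t - y * s - N) * (x * t - y * s + N) = 0 := by
    have : 3 * ((x * t - y * s) ^ 2 - N ^ 2) = 0 := by
      linear_combination 4 * (s ^ 2 + s * t + t ^ 2) * hN.symm - 4 * N * h1 -
        (2 * x * s + x * t + y * s + 2 * y * t + N) * i1
    linarith
  rcases mul_eq_zero.1 i2 with h | h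
  · left
    constructor
    · have : 2 * N * (s + y) = 0 := by
        linear_combination x * i1 - (x + 2 * y) * h - 2 * (s + y) * hN + 2 * y * hN
      have := (mul_eq_zero.1 this).resolve_left (by omega)
      linarith
    · have : 2 * N * (t - x - y) = 0 := by
        linear_combination y * i1 + (2 * x + y) * h + 2 * (- t) * hN
      have := (mul_eq_zero.1 this).resolve_left (by omega)
      linarith
  · right
    have e1 : 2 * N * (s - x - y) = 0 := by
      linear_combination x * i1 - (x + 2 * y) * h + 2 * (- s) * hN
    have e2 : 2 * N * (t + x) = 0 := by
      linear_combination y * i1 + (2 * x + y) * h + 2 * (- t) * hN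
    have e1 := (mul_eq_zero.1 e1).resolve_left (by omega)
    have e2 := (mul_eq_zero.1 e2).resolve_left (by omega)
    constructor <;> linarith

theorem Triangulation.IsEquilateral.eq_upTri_or_downTri {T : Triangulation Ω}
    (hT : T.IsEquilateral) {t : Finset Pt} (ht : t ∈ T.triangles) :
    ∃ z, t = upTri z ∨ t = downTri z := by
  obtain ⟨a, b, c, hab, hac, hbc, rfl⟩ := Finset.card_eq_three.1 (T.card_eq_three t ht)
  have hc := (affineIndependent_triple hab hac hbc).1 (T.affineIndependent _ ht)
  have e1 : T.HasEdge a b := ⟨hab, _, ht, by simp, by simp⟩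
  have e2 : T.HasEdge a c := ⟨hac, _, ht, by simp, by simp⟩
  have e3 : T.HasEdge b c := ⟨hbc, _, ht, by simp, by simp⟩
  obtain ⟨hpos, h | h⟩ := rotate_of_equilateral (hT _ _ _ _ e1 e2)
    (by rw [hT _ _ _ _ e1 e3, sub_sub_sub_cancel_right]) hc
  · have hb : a + (b - a) = b := by abel
    have hcc : a + (-(b - a).2, (b - a).1 + (b - a).2) = c := by rw [← h]; abel
    have e := unit_triangle a (b - a) (T.unit_of_rotate hpos (by rwa [hb, hcc]))
    rwa [hb, hcc] at e
  · have hb : a + (c - a) = c := by abel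
    have hcc : a + (-(c - a).2, (c - a).1 + (c - a).2) = b := by rw [← h]; abel
    have hs : ({a, b, c} : Finset Pt) = {a, c, b} := by ext; simp; tauto
    rw [hs] at ht ⊢
    have e := unit_triangle a (c - a) (T.unit_of_rotate
      (by rwa [← hT _ _ _ _ e1 e2]) (by rwa [hb, hcc]))
    rwa [hb, hcc] at e

/-! ### Unit triangles of an equilateral triangulation, located by interior points. -/

theorem mem_hull_upTri {z : Pt} {x : Plane} : x ∈ hull (upTri z) ↔
    (z.1 : ℝ) ≤ x.1 ∧ (z.2 : ℝ) ≤ x.2 ∧ x.1 + x.2 ≤ z.1 + z.2 + 1 := by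
  rw [upTri, mem_hull_basis (by simp [cr])]
  simp only [coordX, coordY]
  push_cast
  constructor <;> rintro ⟨h1, h2, h3⟩ <;> refine ⟨by linarith, by linarith, by linarith⟩

theorem mem_hull_downTri {z : Pt} {x : Plane} : x ∈ hull (downTri z) ↔
    x.1 ≤ z.1 + 1 ∧ x.2 ≤ z.2 + 1 ∧ (z.1 : ℝ) + z.2 + 1 ≤ x.1 + x.2 := by
  rw [downTri, mem_hull_basis_opp (by simp [cr])]
  simp only [coordX, coordY]
  push_cast
  constructor <;> rintro ⟨h1, h2, h3⟩ <;> refine ⟨by linarith, by linarith, by linarith⟩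

theorem Triangulation.IsEquilateral.exists_mem {T : Triangulation Ω} (hT : T.IsEquilateral)
    {x : Plane} (hx : x ∈ Ω) :
    ∃ z, (upTri z ∈ T.triangles ∧ x ∈ hull (upTri z)) ∨
      (downTri z ∈ T.triangles ∧ x ∈ hull (downTri z)) := by
  rw [← T.cover] at hx
  simp only [Set.mem_iUnion, exists_prop] at hx
  obtain ⟨t, ht, hx⟩ := hx
  obtain ⟨z, rfl | rfl⟩ := hT.eq_upTri_or_downTri ht
  · exact ⟨z, Or.inl ⟨ht, hx⟩⟩
  · exact ⟨z, Or.inr ⟨ht, hx⟩⟩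

/-- The point is interior to one unit triangle and so lies in no other. The facet that covers it is
a unit triangle, hence that one. -/
theorem Triangulation.IsEquilateral.upTri_mem {T : Triangulation Ω} (hT : T.IsEquilateral)
    {x : Plane} (hx : x ∈ Ω) {w : Pt} (h1 : (w.1 : ℝ) < x.1) (h2 : (w.2 : ℝ) < x.2)
    (h3 : x.1 + x.2 < w.1 + w.2 + 1) : upTri w ∈ T.triangles := by
  obtain ⟨z, ⟨ht, h⟩ | ⟨ht, h⟩⟩ := hT.exists_mem hx
  · obtain ⟨a1, a2, a3⟩ := mem_hull_upTri.1 h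
    have b1 : z.1 < w.1 + 1 := by exact_mod_cast (by linarith : (z.1 : ℝ) < w.1 + 1)
    have b2 : z.2 < w.2 + 1 := by exact_mod_cast (by linarith : (z.2 : ℝ) < w.2 + 1)
    have b3 : w.1 + w.2 < z.1 + z.2 + 1 := by
      exact_mod_cast (by linarith : (w.1 : ℝ) + w.2 < z.1 + z.2 + 1)
    have : w = z := Prod.ext (by omega) (by omega)
    rwa [this]
  · obtain ⟨a1, a2, a3⟩ := mem_hull_downTri.1 h
    have b1 : w.1 < z.1 + 1 := by exact_mod_cast (by linarith : (w.1 : ℝ) < z.1 + 1)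
    have b2 : w.2 < z.2 + 1 := by exact_mod_cast (by linarith : (w.2 : ℝ) < z.2 + 1)
    have b3 : z.1 + z.2 + 1 < w.1 + w.2 + 1 := by
      exact_mod_cast (by linarith : (z.1 : ℝ) + z.2 + 1 < w.1 + w.2 + 1)
    omega

theorem Triangulation.IsEquilateral.downTri_mem {T : Triangulation Ω} (hT : T.IsEquilateral)
    {x : Plane} (hx : x ∈ Ω) {w : Pt} (h1 : x.1 < w.1 + 1) (h2 : x.2 < w.2 + 1)
    (h3 : (w.1 : ℝ) + w.2 + 1 < x.1 + x.2) : downTri w ∈ T.triangles := by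
  obtain ⟨z, ⟨ht, h⟩ | ⟨ht, h⟩⟩ := hT.exists_mem hx
  · obtain ⟨a1, a2, a3⟩ := mem_hull_upTri.1 h
    have b1 : z.1 < w.1 + 1 := by exact_mod_cast (by linarith : (z.1 : ℝ) < w.1 + 1)
    have b2 : z.2 < w.2 + 1 := by exact_mod_cast (by linarith : (z.2 : ℝ) < w.2 + 1)
    have b3 : w.1 + w.2 + 1 < z.1 + z.2 + 1 := by
      exact_mod_cast (by linarith : (w.1 : ℝ) + w.2 + 1 < z.1 + z.2 + 1)
    omega
  · obtain ⟨a1, a2, a3⟩ := mem_hull_downTri.1 h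
    have c1 : z.1 + z.2 < w.1 + w.2 + 1 := by
      exact_mod_cast (by linarith : (z.1 : ℝ) + z.2 < w.1 + w.2 + 1)
    have c2 : w.1 < z.1 + 1 := by
      exact_mod_cast (by linarith : (w.1 : ℝ) < z.1 + 1)
    have c3 : w.2 < z.2 + 1 := by
      exact_mod_cast (by linarith : (w.2 : ℝ) < z.2 + 1)
    have : w = z := Prod.ext (by omega) (by omega)
    rwa [this]

/-! ### The nodes of the flip plan -/

/-- The bases and base points of the parallelograms in the flip plan. -/
def treeNodes (U W : Pt) : List Bool → Pt → Finset (List Bool × Pt)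
  | [], v => {([], v)}
  | b :: l, v =>
    insert (b :: l, v) (treeNodes U W l v ∪ treeNodes U W l (v + treeShift U W b l))

variable {U W : Pt}

theorem self_mem_treeNodes (l : List Bool) (v : Pt) : (l, v) ∈ treeNodes U W l v := by
  cases l <;> simp [treeNodes]

theorem mem_treeNodes_cons {b : Bool} {l : List Bool} {v : Pt} {n : List Bool × Pt} :
    n ∈ treeNodes U W (b :: l) v ↔ n = (b :: l, v) ∨ n ∈ treeNodes U W l v ∨
      n ∈ treeNodes U W l (v + treeShift U W b l) := by
  simp [treeNodes]

theorem mem_treeDag_flips {l : List Bool} {v : Pt} {Q : Quad} :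
    Q ∈ (treeDag U W l v).flips ↔ ∃ n ∈ treeNodes U W l v, Q = treeQuad U W n.1 n.2 := by
  induction l generalizing v with
  | nil => simp [treeDag, treeNodes]
  | cons b l ih =>
    simp only [treeDag, Finset.mem_union, Finset.mem_singleton, ih, mem_treeNodes_cons]
    constructor
    · rintro ((rfl | ⟨n, hn, rfl⟩) | ⟨n, hn, rfl⟩)
      · exact ⟨_, Or.inl rfl, rfl⟩
      · exact ⟨n, Or.inr (Or.inl hn), rfl⟩
      · exact ⟨n, Or.inr (Or.inr hn), rfl⟩
    · rintro ⟨n, rfl | hn | hn, rfl⟩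
      · exact Or.inl (Or.inl rfl)
      · exact Or.inl (Or.inr ⟨n, hn, rfl⟩)
      · exact Or.inr ⟨n, hn, rfl⟩

theorem mem_treeDag_arcs {l : List Bool} {v : Pt} {P Q : Quad} :
    (P, Q) ∈ (treeDag U W l v).arcs ↔ ∃ b l' w, (b :: l', w) ∈ treeNodes U W l v ∧
      Q = treeQuad U W (b :: l') w ∧
      (P = treeQuad U W l' w ∨ P = treeQuad U W l' (w + treeShift U W b l')) := by
  induction l generalizing v with
  | nil => simp [treeDag, treeNodes]
  | cons b l ih =>
    simp only [treeDag, Finset.mem_union, Finset.mem_insert, Finset.mem_singleton, ih,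
      mem_treeNodes_cons, Prod.mk.injEq]
    constructor
    · rintro (((⟨rfl, rfl⟩ | ⟨rfl, rfl⟩) | ⟨b', l', w, h, h'⟩) | ⟨b', l', w, h, h'⟩)
      · exact ⟨b, l, v, Or.inl ⟨rfl, rfl⟩, rfl, Or.inl rfl⟩
      · exact ⟨b, l, v, Or.inl ⟨rfl, rfl⟩, rfl, Or.inr rfl⟩
      · exact ⟨b', l', w, Or.inr (Or.inl h), h'⟩
      · exact ⟨b', l', w, Or.inr (Or.inr h), h'⟩
    · rintro ⟨b', l', w, ⟨h, rfl⟩ | h | h, h'⟩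
      · rw [List.cons.injEq] at h
        obtain ⟨rfl, rfl⟩ := h
        obtain ⟨rfl, rfl | rfl⟩ := h' <;> simp
      · exact Or.inl (Or.inr ⟨b', l', w, h, h'⟩)
      · exact Or.inr ⟨b', l', w, h, h'⟩

theorem suffix_of_mem_treeNodes {l : List Bool} {v : Pt} {n : List Bool × Pt}
    (h : n ∈ treeNodes U W l v) : n.1 <:+ l := by
  induction l generalizing v with
  | nil => simp [treeNodes] at h; simp [h]
  | cons b l ih =>
    rcases mem_treeNodes_cons.1 h with rfl | h | h
    · exact List.suffix_rfl
    · exact (ih h).trans (List.suffix_cons b l)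
    · exact (ih h).trans (List.suffix_cons b l)

theorem children_mem_treeNodes {l l' : List Bool} {b : Bool} {v w : Pt}
    (h : (b :: l', w) ∈ treeNodes U W l v) :
    (l', w) ∈ treeNodes U W l v ∧ (l', w + treeShift U W b l') ∈ treeNodes U W l v := by
  induction l generalizing v with
  | nil => simp [treeNodes] at h
  | cons c l ih =>
    simp only [mem_treeNodes_cons] at h ⊢
    rcases h with h | h | h
    · rw [Prod.mk.injEq, List.cons.injEq] at h
      obtain ⟨⟨rfl, rfl⟩, rfl⟩ := h
      exact ⟨Or.inr (Or.inl (self_mem_treeNodes _ _)), Or.inr (Or.inr (self_mem_treeNodes _ _))⟩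
    · exact ⟨Or.inr (Or.inl (ih h).1), Or.inr (Or.inl (ih h).2)⟩
    · exact ⟨Or.inr (Or.inr (ih h).1), Or.inr (Or.inr (ih h).2)⟩

/-- The first child keeps the base point, so the plans at `v` grow along a path in the tree. This
makes a detour through a deeper tree vector contain the shorter plan. -/
theorem treeNodes_subset_append (m l : List Bool) (v : Pt) :
    treeNodes U W l v ⊆ treeNodes U W (m ++ l) v := by
  induction m with
  | nil => exact Finset.Subset.refl _
  | cons b m ih =>
    intro n hn
    exact mem_treeNodes_cons.2 (Or.inr (Or.inl (ih hn)))

theorem cr_treeBasis (hUW : cr U W = 1) (l : List Bool) :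
    cr (treeBasis U W l).1 (treeBasis U W l).2 = 1 := by
  induction l with
  | nil => exact hUW
  | cons b l ih =>
    cases b <;> simp [treeBasis, cr] at ih ⊢ <;> linarith

theorem treeVec_cons (b : Bool) (l : List Bool) :
    treeVec U W (b :: l) = treeVec U W l + treeShift U W b l := by
  cases b
  · simp [treeVec, treeBasis, treeShift]
  · simp only [treeVec, treeBasis, treeShift, if_true]; abel

/-! ### Levels -/

/-- The sum of the coordinates with respect to `(U, W)`. -/
def level (U W p : Pt) : ℤ := cr p W + cr U p

theorem level_add (p q : Pt) : level U W (p + q) = level U W p + level U W q := by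
  simp [level, cr]; ring

theorem level_treeBasis (hUW : cr U W = 1) (l : List Bool) :
    1 ≤ level U W (treeBasis U W l).1 ∧ 1 ≤ level U W (treeBasis U W l).2 := by
  induction l with
  | nil =>
    have e1 : level U W U = 1 := by rw [level, hUW]; simp [cr]; ring
    have e2 : level U W W = 1 := by rw [level, hUW]; simp [cr]; ring
    simp [treeBasis, e1, e2]
  | cons b l ih =>
    cases b <;> simp [treeBasis, level_add] <;> omega

theorem level_treeVec (l : List Bool) : level U W (treeVec U W l) =
    level U W (treeBasis U W l).1 + level U W (treeBasis U W l).2 := level_add _ _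

theorem level_treeVec_lt_cons (hUW : cr U W = 1) (b : Bool) (l : List Bool) :
    level U W (treeVec U W l) < level U W (treeVec U W (b :: l)) := by
  have := level_treeBasis hUW l
  rw [treeVec_cons, level_add]
  cases b <;> simp [treeShift] <;> omega

theorem level_treeVec_le_append (hUW : cr U W = 1) (m l : List Bool) :
    level U W (treeVec U W l) ≤ level U W (treeVec U W (m ++ l)) := by
  induction m with
  | nil => exact le_rfl
  | cons b m ih => exact ih.trans (level_treeVec_lt_cons hUW b _).le

/-- Two suffixes of one list are comparable, and the level increases strictly with every step. -/
theorem eq_of_level_eq_of_suffix (hUW : cr U W = 1) {l l₁ l₂ : List Bool} (h₁ : l₁ <:+ l)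
    (h₂ : l₂ <:+ l) (h : level U W (treeVec U W l₁) = level U W (treeVec U W l₂)) : l₁ = l₂ := by
  have key : ∀ {l₁ l₂ : List Bool}, l₁ <:+ l₂ →
      level U W (treeVec U W l₁) = level U W (treeVec U W l₂) → l₁ = l₂ := by
    rintro l₁ _ ⟨m, rfl⟩ h
    cases m with
    | nil => rfl
    | cons b m =>
      have h1 := level_treeVec_le_append hUW m l₁
      have h2 := level_treeVec_lt_cons hUW b (m ++ l₁)
      rw [List.cons_append] at h
      omega
  rcases List.suffix_or_suffix_of_suffix h₁ h₂ with h' | h'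
  · exact key h' h
  · exact (key h' h.symm).symm

/-- The largest difference of levels in a set of lattice points. -/
def levelRange (U W : Pt) (Q : Finset Pt) : ℕ :=
  (Q ×ˢ Q).sup fun x => (level U W x.1 - level U W x.2).toNat

theorem levelRange_eq {Q : Finset Pt} {a b : Pt} (ha : a ∈ Q) (hb : b ∈ Q)
    (h : ∀ x ∈ Q, level U W b ≤ level U W x ∧ level U W x ≤ level U W a) :
    levelRange U W Q = (level U W a - level U W b).toNat := by
  apply le_antisymm
  · apply Finset.sup_le
    intro x hx
    rw [Finset.mem_product] at hx
    have h1 := h _ hx.1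
    have h2 := h _ hx.2
    omega
  · exact Finset.le_sup (f := fun x : Pt × Pt => (level U W x.1 - level U W x.2).toNat)
      (Finset.mk_mem_product ha hb)

theorem levelRange_treeQuad (hUW : cr U W = 1) (l : List Bool) (w : Pt) :
    levelRange U W (treeQuad U W l w) = (level U W (treeVec U W l)).toNat := by
  have := level_treeBasis hUW l
  have e := level_treeVec (U := U) (W := W) l
  rw [levelRange_eq (a := w + treeVec U W l) (b := w) (by simp [treeQuad]) (by simp [treeQuad])]
  · rw [level_add, add_sub_cancel_left]
  · intro x hx
    simp only [treeQuad, Finset.mem_insert, Finset.mem_singleton] at hx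
    rcases hx with rfl | rfl | rfl | rfl <;> simp only [level_add] <;> omega

/-- The two triangles removed by a flip of the plan. -/
def removed (U W : Pt) (l : List Bool) (w : Pt) : Set (Finset Pt) :=
  {{w, w + (treeBasis U W l).1, w + (treeBasis U W l).2},
    {w + (treeBasis U W l).1, w + (treeBasis U W l).2, w + treeVec U W l}}

/-- The two triangles added by a flip of the plan. -/
def added (U W : Pt) (l : List Bool) (w : Pt) : Set (Finset Pt) :=
  {{w, w + (treeBasis U W l).1, w + treeVec U W l}, {w, w + (treeBasis U W l).2, w + treeVec U W l}}

/-- Level ranges separate the generations of the plan: an added triangle spans the whole new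
diagonal, a removed one only the basis vector of larger level. -/
theorem levelRange_of_mem_added (hUW : cr U W = 1) {l : List Bool} {w : Pt} {t : Finset Pt}
    (ht : t ∈ added U W l w) : levelRange U W t = (level U W (treeVec U W l)).toNat := by
  have := level_treeBasis hUW l
  have e := level_treeVec (U := U) (W := W) l
  rw [levelRange_eq (a := w + treeVec U W l) (b := w)]
  · rw [level_add, add_sub_cancel_left]
  · rcases ht with rfl | rfl <;> simp
  · rcases ht with rfl | rfl <;> simp
  · intro x hx
    rcases ht with rfl | rfl <;> simp only [Finset.mem_insert, Finset.mem_singleton] at hx <;>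
      rcases hx with rfl | rfl | rfl <;> simp only [level_add] <;> omega

theorem levelRange_of_mem_removed (hUW : cr U W = 1) {l : List Bool} {w : Pt} {t : Finset Pt}
    (ht : t ∈ removed U W l w) : levelRange U W t =
      (max (level U W (treeBasis U W l).1) (level U W (treeBasis U W l).2)).toNat := by
  have := level_treeBasis hUW l
  have e := level_treeVec (U := U) (W := W) l
  rcases le_total (level U W (treeBasis U W l).1) (level U W (treeBasis U W l).2) with hle | hle
  · rw [max_eq_right hle]
    rcases ht with rfl | rfl
    · rw [levelRange_eq (a := w + (treeBasis U W l).2) (b := w) (by simp) (by simp)]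
      · rw [level_add, add_sub_cancel_left]
      · intro x hx
        simp only [Finset.mem_insert, Finset.mem_singleton] at hx
        rcases hx with rfl | rfl | rfl <;> simp only [level_add] <;> omega
    · rw [levelRange_eq (a := w + treeVec U W l) (b := w + (treeBasis U W l).1) (by simp) (by simp)]
      · simp only [level_add, level_treeVec]; congr 1; ring
      · intro x hx
        simp only [Finset.mem_insert, Finset.mem_singleton] at hx
        rcases hx with rfl | rfl | rfl <;> simp only [level_add] <;> omega
  · rw [max_eq_left hle]
    rcases ht with rfl | rfl
    · rw [levelRange_eq (a := w + (treeBasis U W l).1) (b := w) (by simp) (by simp)]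
      · rw [level_add, add_sub_cancel_left]
      · intro x hx
        simp only [Finset.mem_insert, Finset.mem_singleton] at hx
        rcases hx with rfl | rfl | rfl <;> simp only [level_add] <;> omega
    · rw [levelRange_eq (a := w + treeVec U W l) (b := w + (treeBasis U W l).2) (by simp) (by simp)]
      · simp only [level_add, level_treeVec]; congr 1; ring
      · intro x hx
        simp only [Finset.mem_insert, Finset.mem_singleton] at hx
        rcases hx with rfl | rfl | rfl <;> simp only [level_add] <;> omega

theorem max_level_treeBasis_nil (hUW : cr U W = 1) :
    max (level U W (treeBasis U W []).1) (level U W (treeBasis U W []).2) = 1 := by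
  have e1 : level U W U = 1 := by rw [level, hUW]; simp [cr]; ring
  have e2 : level U W W = 1 := by rw [level, hUW]; simp [cr]; ring
  simp [treeBasis, e1, e2]

/-- The new basis vector is the previous sum, which dominates the kept vector. So the triangles
removed after a step have the range of those added before it. -/
theorem max_level_treeBasis_cons (hUW : cr U W = 1) (b : Bool) (l : List Bool) :
    max (level U W (treeBasis U W (b :: l)).1) (level U W (treeBasis U W (b :: l)).2) =
      level U W (treeVec U W l) := by
  have := level_treeBasis hUW l
  cases b <;> simp [treeBasis, treeVec, level_add] <;> omega

/-- A triangle removed in the plan determines the basis of the flip. -/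
theorem eq_of_mem_removed_of_suffix (hUW : cr U W = 1) {l l₁ l₂ : List Bool} (h₁ : l₁ <:+ l)
    (h₂ : l₂ <:+ l) {w₁ w₂ : Pt} {t : Finset Pt} (ht₁ : t ∈ removed U W l₁ w₁)
    (ht₂ : t ∈ removed U W l₂ w₂) : l₁ = l₂ := by
  have e := (levelRange_of_mem_removed hUW ht₁).symm.trans (levelRange_of_mem_removed hUW ht₂)
  -- This separates the root of the tree, where removed triangles have range 1, from all other
  -- nodes.
  have two : ∀ l, 2 ≤ level U W (treeVec U W l) := fun l => by
    have := level_treeBasis hUW l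
    rw [level_treeVec]; omega
  cases l₁ with
  | nil =>
    cases l₂ with
    | nil => rfl
    | cons b₂ l₂ =>
      rw [max_level_treeBasis_nil hUW, max_level_treeBasis_cons hUW] at e
      have := two l₂
      omega
  | cons b₁ l₁ =>
    cases l₂ with
    | nil =>
      rw [max_level_treeBasis_nil hUW, max_level_treeBasis_cons hUW] at e
      have := two l₁
      omega
    | cons b₂ l₂ =>
      rw [max_level_treeBasis_cons hUW, max_level_treeBasis_cons hUW] at e
      have := two l₁
      have := two l₂
      have h : l₁ = l₂ := eq_of_level_eq_of_suffix hUW ((List.suffix_cons _ _).trans h₁)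
        ((List.suffix_cons _ _).trans h₂) (by omega)
      subst h
      have := List.suffix_or_suffix_of_suffix h₁ h₂
      rcases this with h | h
      · exact h.eq_of_length (by simp)
      · exact (h.eq_of_length (by simp)).symm

theorem exists_eq_cons_of_mem_added_of_mem_removed (hUW : cr U W = 1) {l l₁ l₂ : List Bool}
    (h₁ : l₁ <:+ l) (h₂ : l₂ <:+ l) {w₁ w₂ : Pt} {t : Finset Pt} (ht₁ : t ∈ added U W l₁ w₁)
    (ht₂ : t ∈ removed U W l₂ w₂) : ∃ b, l₂ = b :: l₁ := by
  have e := (levelRange_of_mem_added hUW ht₁).symm.trans (levelRange_of_mem_removed hUW ht₂)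
  have two : ∀ l, 2 ≤ level U W (treeVec U W l) := fun l => by
    have := level_treeBasis hUW l
    rw [level_treeVec]; omega
  have := two l₁
  cases l₂ with
  | nil =>
    rw [max_level_treeBasis_nil hUW] at e
    omega
  | cons b₂ l₂ =>
    rw [max_level_treeBasis_cons hUW] at e
    have := two l₂
    rw [eq_of_level_eq_of_suffix hUW h₁ ((List.suffix_cons _ _).trans h₂) (by omega)]
    exact ⟨b₂, rfl⟩

/-! ### Vertex sums of triangles, which determine base points. -/

theorem sum_triple {a b c : Pt} (h : cr (b - a) (c - a) ≠ 0) :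
    ∑ x ∈ ({a, b, c} : Finset Pt), x = a + b + c := by
  obtain ⟨h1, h2, h3⟩ := card_triple_of_cr_ne_zero h
  rw [Finset.sum_insert (by simp [h1, h2]), Finset.sum_pair h3, add_assoc]

theorem cr_add_right (p q r : Pt) : cr p (q + r) = cr p q + cr p r := by
  simp [cr]; ring

theorem cr_add_left (p q r : Pt) : cr (p + q) r = cr p r + cr q r := by
  simp [cr]; ring

theorem cr_self (p : Pt) : cr p p = 0 := by simp [cr]; ring

theorem cr_swap (p q : Pt) : cr q p = -cr p q := by simp [cr]; ring

theorem sum_lower {w p q : Pt} (h : cr p q = 1) :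
    ∑ x ∈ ({w, w + p, w + q} : Finset Pt), x = 3 • w + p + q := by
  rw [sum_triple (by simp [h])]; module

theorem sum_upper {w p q : Pt} (h : cr p q = 1) :
    ∑ x ∈ ({w + p, w + q, w + (p + q)} : Finset Pt), x = 3 • w + 2 • (p + q) := by
  rw [sum_triple]
  · module
  · have e1 : w + q - (w + p) = q - p := by abel
    have e2 : w + (p + q) - (w + p) = q := by abel
    rw [e1, e2]
    simp [cr] at h ⊢
    intro h'
    linarith

theorem sum_diag {w p q : Pt} (h : cr p q = 1) :
    ∑ x ∈ ({w, w + p, w + (p + q)} : Finset Pt), x = 3 • w + 2 • p + q := by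
  rw [sum_triple (by simp [cr_add_right, cr_self, h])]; module

theorem sum_diag_opp {w p q : Pt} (h : cr p q = 1) :
    ∑ x ∈ ({w, w + q, w + (p + q)} : Finset Pt), x = 3 • w + p + 2 • q := by
  rw [sum_triple (by simp [cr_add_right, cr_self, h, cr_swap p q])]; module

theorem eq_of_three_smul_eq {x y : Pt} (h : 3 • x = 3 • y) : x = y := by
  have h1 := congrArg Prod.fst h
  have h2 := congrArg Prod.snd h
  simp at h1 h2
  exact Prod.ext h1 h2

/-- A vector that belongs to a lattice basis is primitive. -/
theorem not_three_smul {p d e : Pt} (h : cr p d = 1 ∨ cr p d = -1) : d ≠ 3 • e := by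
  rintro rfl
  have : cr p (3 • e) = 3 * cr p e := by simp [cr]; ring
  omega

/-- A triangle removed by a flip of a given basis determines the base point. -/
theorem eq_of_mem_removed (hUW : cr U W = 1) {l : List Bool} {w₁ w₂ : Pt} {t : Finset Pt}
    (ht₁ : t ∈ removed U W l w₁) (ht₂ : t ∈ removed U W l w₂) : w₁ = w₂ := by
  have h := cr_treeBasis hUW l
  rw [removed, treeVec] at ht₁ ht₂
  generalize (treeBasis U W l).1 = p at *
  generalize (treeBasis U W l).2 = q at *
  have hd : cr p (p + q) = 1 := by rw [cr_add_right, cr_self, h, zero_add]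
  -- Comparison of vertex sums: two triangles of the same kind give equal base points, while
  -- different kinds would make the primitive vector `p + q` divisible by three.
  rcases ht₁ with rfl | rfl <;> rcases ht₂ with e | e <;>
    have e := congrArg (fun t : Finset Pt => ∑ x ∈ t, x) e <;>
    simp only [sum_lower h, sum_upper h] at e
  · apply eq_of_three_smul_eq
    linear_combination e
  · exact absurd (by linear_combination -e : p + q = 3 • (w₁ - w₂))
      (not_three_smul (Or.inl hd))
  · exact absurd (by linear_combination e : p + q = 3 • (w₂ - w₁))
      (not_three_smul (Or.inl hd))
  · apply eq_of_three_smul_eq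
    linear_combination e

/-- A triangle added by a flip and removed by another one: the first flip is a child. -/
theorem eq_or_eq_of_mem_added_of_mem_removed (hUW : cr U W = 1) {l : List Bool} {b : Bool}
    {w₁ w₂ : Pt} {t : Finset Pt} (ht₁ : t ∈ added U W l w₁) (ht₂ : t ∈ removed U W (b :: l) w₂) :
    w₁ = w₂ ∨ w₁ = w₂ + treeShift U W b l := by
  have h := cr_treeBasis hUW l
  rw [removed, treeVec] at ht₂
  rw [added, treeVec] at ht₁
  have h' := cr_treeBasis hUW (b :: l)
  -- Of the four combinations for each step, two yield the base points of the children; the other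
  -- two make a primitive vector divisible by three.
  cases b <;>
    simp only [treeBasis, treeShift, if_true, if_false, Bool.false_eq_true] at ht₂ h' ⊢ <;>
    generalize (treeBasis U W l).1 = p at * <;> generalize (treeBasis U W l).2 = q at * <;>
    rcases ht₁ with rfl | rfl <;> rcases ht₂ with e | e <;>
    have e := congrArg (fun t : Finset Pt => ∑ x ∈ t, x) e <;>
    simp only [sum_lower h', sum_upper h', sum_diag h, sum_diag_opp h] at e
  · exact absurd (by linear_combination -e : q + -p = 3 • (w₁ - w₂))
      (not_three_smul (p := p) (Or.inl (by rw [← h]; simp [cr]; ring)))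
  · right; apply eq_of_three_smul_eq; linear_combination e
  · left; apply eq_of_three_smul_eq; linear_combination e
  · exact absurd (by linear_combination -e : p + (q + q) = 3 • (w₁ - w₂))
      (not_three_smul (p := q) (Or.inr (by rw [← h]; simp [cr]; ring)))
  · left; apply eq_of_three_smul_eq; linear_combination e
  · exact absurd (by linear_combination -e : p + (p + q) = 3 • (w₁ - w₂))
      (not_three_smul (p := p) (Or.inl (by rw [← h]; simp [cr]; ring)))
  · exact absurd (by linear_combination -e : p + -q = 3 • (w₁ - w₂))
      (not_three_smul (p := p) (Or.inr (by rw [← h]; simp [cr]; ring)))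
  · right; apply eq_of_three_smul_eq; linear_combination e

/-- The level range recovers the basis, and the base point is the unique vertex of lowest level.
Hence flips coincide only if their nodes do. -/
theorem treeQuad_injective (hUW : cr U W = 1) {l l₁ l₂ : List Bool} (h₁ : l₁ <:+ l)
    (h₂ : l₂ <:+ l) {w₁ w₂ : Pt} (h : treeQuad U W l₁ w₁ = treeQuad U W l₂ w₂) :
    l₁ = l₂ ∧ w₁ = w₂ := by
  have hb₁ := level_treeBasis hUW l₁
  have hb₂ := level_treeBasis hUW l₂
  have e : l₁ = l₂ := by
    apply eq_of_level_eq_of_suffix hUW h₁ h₂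
    have := congrArg (levelRange U W) h
    rw [levelRange_treeQuad hUW, levelRange_treeQuad hUW, level_treeVec, level_treeVec] at this
    rw [level_treeVec, level_treeVec]
    omega
  subst e
  refine ⟨rfl, ?_⟩
  have key : ∀ {a b : Pt}, a ∈ treeQuad U W l₁ b → a = b ∨ level U W b < level U W a := by
    intro a b hab
    simp only [treeQuad, Finset.mem_insert, Finset.mem_singleton] at hab
    rcases hab with rfl | rfl | rfl | rfl
    · exact Or.inl rfl
    all_goals right; simp only [level_add, level_treeVec]; omega
  have k1 : w₁ ∈ treeQuad U W l₁ w₂ := by rw [← h]; simp [treeQuad]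
  have k2 : w₂ ∈ treeQuad U W l₁ w₁ := by rw [h]; simp [treeQuad]
  rcases key k1 with h | h
  · exact h
  · rcases key k2 with h' | h'
    · exact h'.symm
    · omega

/-- The triangles removed by a flip are added by its children. -/
theorem mem_added_of_mem_removed_cons {b : Bool} {l : List Bool} {w : Pt} {t : Finset Pt}
    (ht : t ∈ removed U W (b :: l) w) :
    t ∈ added U W l w ∨ t ∈ added U W l (w + treeShift U W b l) := by
  rw [removed, treeVec] at ht
  simp only [added, treeVec]
  cases b <;> simp only [treeBasis, treeShift, if_true, if_false, Bool.false_eq_true] at ht ⊢ <;>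
    generalize (treeBasis U W l).1 = p at * <;> generalize (treeBasis U W l).2 = q at * <;>
    rcases ht with rfl | rfl
  · left; right; ext x; simp; tauto
  · right; left
    rw [add_assoc w, add_assoc w, add_comm q p, add_comm q (p + q)]
    ext x; simp; tauto
  · left; left; rfl
  · right; right
    rw [add_assoc w, add_assoc w]
    rfl

/-! ### The unit rhombi crossed by an edge -/

/-- A vector with first coordinate `x₁` and level `n₁` meets level `s` at `s x₁ / n₁`, which has
distance at least `1 / n₁` from the integers when it lies strictly between `a` and `a + 1`. Adding a
vector of determinant `±1` moves this point by `s / (n₁ (n₁ + n₂)) < 1 / n₁`, so it stays in the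
same unit interval. -/
theorem crossing_of_crossing {x₁ n₁ x₂ n₂ a s : ℤ} (hd : x₁ * n₂ - x₂ * n₁ = 1 ∨
    x₁ * n₂ - x₂ * n₁ = -1) (hn₂ : 1 ≤ n₂) (h0 : 0 < s) (h1 : s < n₁) (h2 : a * n₁ < s * x₁)
    (h3 : s * x₁ < (a + 1) * n₁) :
    s < n₁ + n₂ ∧ a * (n₁ + n₂) < s * (x₁ + x₂) ∧ s * (x₁ + x₂) < (a + 1) * (n₁ + n₂) := by
  have e : n₁ * (s * (x₁ + x₂)) = s * x₁ * (n₁ + n₂) - s * (x₁ * n₂ - x₂ * n₁) := by ring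
  have hn : 0 < n₁ + n₂ := by omega
  have a1 : (a * n₁ + 1) * (n₁ + n₂) ≤ s * x₁ * (n₁ + n₂) :=
    mul_le_mul_of_nonneg_right (by omega) hn.le
  have a2 : s * x₁ * (n₁ + n₂) ≤ ((a + 1) * n₁ - 1) * (n₁ + n₂) :=
    mul_le_mul_of_nonneg_right (by omega) hn.le
  have hs : s * (x₁ * n₂ - x₂ * n₁) ≤ s ∧ -s ≤ s * (x₁ * n₂ - x₂ * n₁) := by
    rcases hd with h | h <;> rw [h] <;> constructor <;> linarith
  refine ⟨by omega, ?_, ?_⟩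
  · have : n₁ * (a * (n₁ + n₂)) < n₁ * (s * (x₁ + x₂)) := by
      rw [e]; linarith [hs.1]
    exact lt_of_mul_lt_mul_left this (by omega)
  · have : n₁ * (s * (x₁ + x₂)) < n₁ * ((a + 1) * (n₁ + n₂)) := by
      rw [e]; linarith [hs.2]
    exact lt_of_mul_lt_mul_left this (by omega)

theorem cr_mul_sub (hUW : cr U W = 1) (p q : Pt) : cr p W * cr U q - cr q W * cr U p = cr p q := by
  have : cr p W * cr U q - cr q W * cr U p = cr p q * cr U W := by simp [cr]; ring
  rw [this, hUW, mul_one]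

theorem cr_treeVec_treeShift (hUW : cr U W = 1) (b : Bool) (l : List Bool) :
    cr (treeVec U W l) (treeShift U W b l) = 1 ∨ cr (treeVec U W l) (treeShift U W b l) = -1 := by
  have := cr_treeBasis hUW l
  cases b
  · left; simp [treeVec, treeShift, cr_add_left, cr_self, this]
  · right; simp [treeVec, treeShift, cr_add_left, cr_self,
      cr_swap (treeBasis U W l).1 (treeBasis U W l).2, this]

theorem one_le_level_treeShift (hUW : cr U W = 1) (b : Bool) (l : List Bool) :
    1 ≤ level U W (treeShift U W b l) := by
  have := level_treeBasis hUW l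
  cases b <;> simp [treeShift, this]

/-- The inequalities say that the edge from `v` crosses the diagonal from `w + U` to `w + W` of the
unit rhombus at `w` in its interior; this diagonal is at level `level U W (w - v) + 1` above `v`. -/
theorem crossing_of_mem_treeNodes (hUW : cr U W = 1) {l : List Bool} {v w : Pt}
    (h : ([], w) ∈ treeNodes U W l v) :
    0 < level U W (w - v) + 1 ∧ level U W (w - v) + 1 < level U W (treeVec U W l) ∧
    cr (w - v) W * level U W (treeVec U W l) <
      (level U W (w - v) + 1) * cr (treeVec U W l) W ∧
    (level U W (w - v) + 1) * cr (treeVec U W l) W <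
      (cr (w - v) W + 1) * level U W (treeVec U W l) := by
  induction l generalizing v with
  | nil =>
    simp [treeNodes] at h
    subst h
    have e1 : level U W (treeVec U W []) = 2 := by
      simp [treeVec, treeBasis, level, cr_add_left, cr_add_right, hUW, cr_self]
    have e2 : cr (treeVec U W []) W = 1 := by
      simp [treeVec, treeBasis, cr_add_left, hUW, cr_self]
    rw [e1, e2]
    simp [level, cr]
  | cons b l ih =>
    have hn₂ := one_le_level_treeShift hUW b l
    have hd : cr (treeVec U W l) W * level U W (treeShift U W b l) -
        cr (treeShift U W b l) W * level U W (treeVec U W l) = 1 ∨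
        cr (treeVec U W l) W * level U W (treeShift U W b l) -
        cr (treeShift U W b l) W * level U W (treeVec U W l) = -1 := by
      have e : cr (treeVec U W l) W * level U W (treeShift U W b l) -
        cr (treeShift U W b l) W * level U W (treeVec U W l) =
          cr (treeVec U W l) (treeShift U W b l) := by
        rw [← cr_mul_sub hUW (treeVec U W l) (treeShift U W b l)]; simp only [level]; ring
      rw [e]
      exact cr_treeVec_treeShift hUW b l
    rw [treeVec_cons, level_add, cr_add_left]
    rcases mem_treeNodes_cons.1 h with h | h | h
    · simp at h
    · obtain ⟨h1, h2, h3, h4⟩ := ih h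
      exact ⟨h1, crossing_of_crossing hd hn₂ h1 h2 h3 h4⟩
    · obtain ⟨h1, h2, h3, h4⟩ := ih h
      have eX : cr (w - v) W =
          cr (w - (v + treeShift U W b l)) W + cr (treeShift U W b l) W := by
        rw [← cr_add_left]; congr 1; abel
      have eL : level U W (w - v) =
          level U W (w - (v + treeShift U W b l)) + level U W (treeShift U W b l) := by
        rw [← level_add]; congr 1; abel
      rw [eX, eL]
      generalize cr (w - (v + treeShift U W b l)) W = a at *
      generalize level U W (w - (v + treeShift U W b l)) = s at *
      generalize cr (treeVec U W l) W = x₁ at *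
      generalize level U W (treeVec U W l) = n₁ at *
      generalize cr (treeShift U W b l) W = x₂ at *
      generalize level U W (treeShift U W b l) = n₂ at *
      -- The edge of the second child ends where the whole edge ends. A point reflection makes this
      -- common end the starting point, and turns `a` and `s + 1` into `x₁ - a - 1` and `n₁ - (s +
      -- 1)`.
      obtain ⟨k1, k2, k3⟩ := crossing_of_crossing (a := x₁ - a - 1) (s := n₁ - (s + 1)) hd hn₂
        (by omega) (by omega) (by linarith) (by linarith)
      refine ⟨by omega, by omega, by linarith, by linarith⟩

theorem cr_treeBasis_nonneg (hUW : cr U W = 1) (l : List Bool) :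
    (0 ≤ cr (treeBasis U W l).1 W ∧ 0 ≤ cr U (treeBasis U W l).1) ∧
    (0 ≤ cr (treeBasis U W l).2 W ∧ 0 ≤ cr U (treeBasis U W l).2) := by
  induction l with
  | nil => simp [treeBasis, hUW, cr_self]
  | cons b l ih =>
    cases b <;> simp [treeBasis, cr_add_left, cr_add_right] <;> omega

/-- The points are taken on the edge just before and just after the crossing, in the interiors of
the lower and the upper triangle. -/
theorem exists_crossing_points {e v w : Pt} (hx : 0 ≤ cr e W)
    (hy : 0 ≤ cr U e) (h0 : 0 < level U W (w - v) + 1)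
    (h1 : level U W (w - v) + 1 < level U W e)
    (h2 : cr (w - v) W * level U W e < (level U W (w - v) + 1) * cr e W)
    (h3 : (level U W (w - v) + 1) * cr e W < (cr (w - v) W + 1) * level U W e) :
    (∃ x ∈ segment ℝ (toPlane v) (toPlane (v + e)), 0 < coordX w W x ∧ 0 < coordY w U x ∧
      coordX w W x + coordY w U x < 1) ∧
    (∃ x ∈ segment ℝ (toPlane v) (toPlane (v + e)), coordX w W x < 1 ∧ coordY w U x < 1 ∧
      1 < coordX w W x + coordY w U x) := by
  have cX : ∀ t : ℝ, coordX w W (toPlane v + t • toPlane e) = t * cr e W - cr (w - v) W := by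
    intro t; simp [coordX, toPlane, cr]; ring
  have cY : ∀ t : ℝ, coordY w U (toPlane v + t • toPlane e) = t * cr U e - cr U (w - v) := by
    intro t; simp [coordY, toPlane, cr]; ring
  have hseg : ∀ t : ℝ, 0 ≤ t → t ≤ 1 →
      toPlane v + t • toPlane e ∈ segment ℝ (toPlane v) (toPlane (v + e)) := by
    intro t ht ht'
    refine ⟨1 - t, t, by linarith, ht, by ring, ?_⟩
    ext <;> simp [toPlane] <;> ring
  simp only [level] at h0 h1 h2 h3
  generalize cr (w - v) W = a at *
  generalize cr U (w - v) = b at *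
  generalize cr e W = x at *
  generalize cr U e = y at *
  have i1 : a * (x + y) + 1 ≤ (a + b + 1) * x := h2
  have i2 : (a + b + 1) * x + 1 ≤ (a + 1) * (x + y) := h3
  have i0 : (0 : ℤ) + 1 ≤ a + b + 1 := h0
  have i3 : a + b + 1 + 1 ≤ x + y := h1
  have i1' : (a : ℝ) * (x + y) + 1 ≤ (a + b + 1) * x := by exact_mod_cast i1
  have i2' : (a + b + 1 : ℝ) * x + 1 ≤ (a + 1) * (x + y) := by exact_mod_cast i2
  have i0' : (0 : ℝ) + 1 ≤ a + b + 1 := by exact_mod_cast i0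
  have i3' : (a + b + 1 + 1 : ℝ) ≤ x + y := by exact_mod_cast i3
  have hx' : (0 : ℝ) ≤ x := by exact_mod_cast hx
  have hy' : (0 : ℝ) ≤ y := by exact_mod_cast hy
  clear h0 h1 h2 h3 i0 i1 i2 i3 hx hy
  generalize (a : ℝ) = a at *
  generalize (b : ℝ) = b at *
  generalize (x : ℝ) = x at *
  generalize (y : ℝ) = y at *
  have hn : 0 < x + y := by linarith
  set n := x + y with hn_def
  have hn1 : 1 ≤ n := by linarith
  -- The points have distance `δ` in level from the crossing. After multiplication by `n`,
  -- integrality leaves a margin of at least 1, of which the shift uses at most 1/2.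
  obtain ⟨δ, hδ, hδn⟩ : ∃ δ : ℝ, 0 < δ ∧ δ * n = 1 / 2 :=
    ⟨1 / (2 * n), by positivity, by field_simp⟩
  obtain ⟨τ, hτ⟩ : ∃ τ : ℝ, τ * n = 1 := ⟨1 / n, by field_simp⟩
  have hτ0 : 0 < τ := by
    by_contra! h; nlinarith
  have hδ1 : δ ≤ 1 / 2 := by nlinarith
  have m0 : ∀ z : ℝ, 0 < z * n → 0 < z := fun z hz => by
    by_contra! h; nlinarith
  have hxδ : δ * x ≤ 1 / 2 := by nlinarith
  have hyδ : δ * y ≤ 1 / 2 := by nlinarith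
  constructor
  · refine ⟨_, hseg ((a + b + 1 - δ) * τ) (mul_nonneg (by linarith) hτ0.le) (by nlinarith),
      ?_, ?_, ?_⟩
    · rw [cX]; apply m0
      have : ((a + b + 1 - δ) * τ * x - a) * n = (a + b + 1) * x - δ * x - a * n := by
        linear_combination (a + b + 1 - δ) * x * hτ
      rw [this]; linarith
    · rw [cY]; apply m0
      have : ((a + b + 1 - δ) * τ * y - b) * n = (a + 1) * n - (a + b + 1) * x - δ * y := by
        linear_combination (a + b + 1 - δ) * y * hτ - (a + b + 1) * hn_def
      rw [this]; linarith
    · rw [cX, cY]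
      have : (a + b + 1 - δ) * τ * x - a + ((a + b + 1 - δ) * τ * y - b) = 1 - δ := by
        linear_combination (a + b + 1 - δ) * hτ - (a + b + 1 - δ) * τ * hn_def
      rw [this]; linarith
  · refine ⟨_, hseg ((a + b + 1 + δ) * τ) (mul_nonneg (by linarith) hτ0.le) (by nlinarith),
      ?_, ?_, ?_⟩
    · rw [cX, ← sub_pos]; apply m0
      have : (1 - ((a + b + 1 + δ) * τ * x - a)) * n =
          (a + 1) * n - (a + b + 1) * x - δ * x := by
        linear_combination -(a + b + 1 + δ) * x * hτ
      rw [this]; linarith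
    · rw [cY, ← sub_pos]; apply m0
      have : (1 - ((a + b + 1 + δ) * τ * y - b)) * n = (a + b + 1) * x - δ * y - a * n := by
        linear_combination -(a + b + 1 + δ) * y * hτ + (a + b + 1) * hn_def
      rw [this]; linarith
    · rw [cX, cY]
      have : (a + b + 1 + δ) * τ * x - a + ((a + b + 1 + δ) * τ * y - b) = 1 + δ := by
        linear_combination (a + b + 1 + δ) * hτ - (a + b + 1 + δ) * τ * hn_def
      rw [this]; linarith

theorem cr_coordPair (i : Fin 3) : cr (coordPair i).1 (coordPair i).2 = 1 := by
  fin_cases i <;> simp [coordPair, cr]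

theorem Triangulation.IsEquilateral.lower_mem {T : Triangulation Ω} (hT : T.IsEquilateral)
    (i : Fin 3) {x : Plane} (hx : x ∈ Ω) {w : Pt} (h1 : 0 < coordX w (coordPair i).2 x)
    (h2 : 0 < coordY w (coordPair i).1 x)
    (h3 : coordX w (coordPair i).2 x + coordY w (coordPair i).1 x < 1) :
    {w, w + (coordPair i).1, w + (coordPair i).2} ∈ T.triangles := by
  obtain ⟨a, b⟩ := w
  fin_cases i <;> simp [coordPair, coordX, coordY] at h1 h2 h3 ⊢
  · have := hT.upTri_mem hx (w := (a, b)) (by simp; linarith) (by simp; linarith)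
      (by simp; linarith)
    simpa [upTri] using this
  · have := hT.downTri_mem hx (w := (a - 1, b)) (by simp; linarith) (by simp; linarith)
      (by simp; linarith)
    convert this using 1
    ext ⟨x, y⟩; simp [downTri]; omega
  · have := hT.upTri_mem hx (w := (a - 1, b)) (by simp; linarith) (by simp; linarith)
      (by simp; linarith)
    convert this using 1
    ext ⟨x, y⟩; simp [upTri]; omega

theorem Triangulation.IsEquilateral.upper_mem {T : Triangulation Ω} (hT : T.IsEquilateral)
    (i : Fin 3) {x : Plane} (hx : x ∈ Ω) {w : Pt} (h1 : coordX w (coordPair i).2 x < 1)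
    (h2 : coordY w (coordPair i).1 x < 1)
    (h3 : 1 < coordX w (coordPair i).2 x + coordY w (coordPair i).1 x) :
    {w + (coordPair i).1, w + (coordPair i).2, w + ((coordPair i).1 + (coordPair i).2)} ∈
      T.triangles := by
  obtain ⟨a, b⟩ := w
  fin_cases i <;> simp [coordPair, coordX, coordY] at h1 h2 h3 ⊢
  · have := hT.downTri_mem hx (w := (a, b)) (by simp; linarith) (by simp; linarith)
      (by simp; linarith)
    simpa [downTri] using this
  · have := hT.upTri_mem hx (w := (a - 1, b + 1)) (by simp; linarith) (by simp; linarith)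
      (by simp; linarith)
    convert this using 1
    ext ⟨x, y⟩; simp [upTri]; omega
  · have := hT.downTri_mem hx (w := (a - 2, b)) (by simp; linarith) (by simp; linarith)
      (by simp; linarith)
    convert this using 1
    ext ⟨x, y⟩; simp [downTri]; omega

/-- The unit rhombi of the plan lie in an equilateral triangulation whose region contains the
edge. -/
theorem Triangulation.IsEquilateral.removed_nil_subset {T : Triangulation Ω}
    (hT : T.IsEquilateral) (i : Fin 3) {l : List Bool} {v w : Pt}
    (hΩ : segment ℝ (toPlane v)
      (toPlane (v + treeVec (coordPair i).1 (coordPair i).2 l)) ⊆ Ω)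
    (h : ([], w) ∈ treeNodes (coordPair i).1 (coordPair i).2 l v) :
    removed (coordPair i).1 (coordPair i).2 [] w ⊆ T.triangles := by
  have hUW := cr_coordPair i
  obtain ⟨h0, h1, h2, h3⟩ := crossing_of_mem_treeNodes hUW h
  obtain ⟨⟨a1, a2⟩, a3, a4⟩ := cr_treeBasis_nonneg hUW l
  obtain ⟨⟨x, hx, hx1, hx2, hx3⟩, y, hy, hy1, hy2, hy3⟩ := exists_crossing_points
    (by rw [treeVec, cr_add_left]; omega) (by rw [treeVec, cr_add_right]; omega) h0 h1 h2 h3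
  rintro t (rfl | rfl)
  · exact hT.lower_mem i (hΩ hx) hx1 hx2 hx3
  · exact hT.upper_mem i (hΩ hy) hy1 hy2 hy3

theorem Triangulation.IsEquilateral.hasEdge_of_isUnit {T : Triangulation Ω}
    (hT : T.IsEquilateral) {e : Edge} (he : e.IsUnit) {v : Pt}
    (hΩ : segment ℝ (toPlane v) (toPlane (v + e.vec)) ⊆ Ω) : T.HasEdge v (v + e.vec) := by
  have hv : e.vec = (1, 0) ∨ e.vec = (0, 1) ∨ e.vec = (-1, 1) ∨ e.vec = (-1, 0) := by
    obtain ⟨i, x, y, hc⟩ := e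
    rcases he with ⟨hx, hy⟩ | ⟨hx, hy⟩ <;> simp only at hx hy <;> subst hx hy <;>
      fin_cases i <;> simp [Edge.vec, coordPair]
  -- Doubling the coordinates of the midpoint turns its position in a unit triangle into integer
  -- inequalities, which force both ends of the unit edge to be vertices of that triangle.
  have hm : (1 / 2 : ℝ) • toPlane v + (1 / 2 : ℝ) • toPlane (v + e.vec) ∈ Ω :=
    hΩ ⟨1 / 2, 1 / 2, by norm_num, by norm_num, by norm_num, rfl⟩
  generalize e.vec = d at *
  refine ⟨by rcases hv with rfl | rfl | rfl | rfl <;> simp, ?_⟩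
  obtain ⟨a, b⟩ := v
  obtain ⟨m, n⟩ := d
  obtain ⟨⟨x, y⟩, ⟨ht, h⟩ | ⟨ht, h⟩⟩ := hT.exists_mem hm
  · obtain ⟨h1, h2, h3⟩ := mem_hull_upTri.1 h
    simp [toPlane] at h1 h2 h3
    have h1 : 2 * x ≤ a + (a + m) := by
      exact_mod_cast (by linarith : (2 * x : ℝ) ≤ a + (a + m))
    have h2 : 2 * y ≤ b + (b + n) := by
      exact_mod_cast (by linarith : (2 * y : ℝ) ≤ b + (b + n))
    have h3 : a + (a + m) + (b + (b + n)) ≤ 2 * x + 2 * y + 2 := by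
      exact_mod_cast (by linarith : (a + (a + m) + (b + (b + n)) : ℝ) ≤ 2 * x + 2 * y + 2)
    refine ⟨_, ht, ?_⟩
    simp [upTri] at hv ⊢
    omega
  · obtain ⟨h1, h2, h3⟩ := mem_hull_downTri.1 h
    simp [toPlane] at h1 h2 h3
    have h1 : a + (a + m) ≤ 2 * x + 2 := by
      exact_mod_cast (by linarith : (a + (a + m) : ℝ) ≤ 2 * x + 2)
    have h2 : b + (b + n) ≤ 2 * y + 2 := by
      exact_mod_cast (by linarith : (b + (b + n) : ℝ) ≤ 2 * y + 2)
    have h3 : 2 * x + 2 * y + 2 ≤ a + (a + m) + (b + (b + n)) := by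
      exact_mod_cast (by linarith : (2 * x + 2 * y + 2 : ℝ) ≤ a + (a + m) + (b + (b + n)))
    refine ⟨_, ht, ?_⟩
    simp [downTri] at hv ⊢
    omega

/-! ### Flips of unimodular triangulations -/

/-- All triangles have the least possible area. -/
def Triangulation.IsUnimodular (T : Triangulation Ω) : Prop :=
  ∀ a b c : Pt, {a, b, c} ∈ T.triangles → cr (b - a) (c - a) = 1 ∨ cr (b - a) (c - a) = -1

theorem card_eq_three_imp {a b c : Pt} (h : ({a, b, c} : Finset Pt).card = 3) :
    a ≠ b ∧ a ≠ c ∧ b ≠ c := by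
  refine ⟨?_, ?_, ?_⟩ <;> rintro rfl
  · have := Finset.card_le_two (a := a) (b := c)
    simp at h this; omega
  · have := Finset.card_le_two (a := b) (b := a)
    rw [Finset.insert_eq_of_mem (by simp)] at h; omega
  · have := Finset.card_le_two (a := a) (b := b)
    simp at h this; omega

theorem unimodular_of_eq {a b c a' b' c' : Pt} (h : ({a, b, c} : Finset Pt) = {a', b', c'})
    (hc : cr (b' - a') (c' - a') = 1) : cr (b - a) (c - a) = 1 ∨ cr (b - a) (c - a) = -1 := by
  obtain ⟨n1, n2, n3⟩ := card_triple_of_cr_ne_zero (by rw [hc]; exact one_ne_zero)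
  have h3 : ({a, b, c} : Finset Pt).card = 3 := by
    rw [h]; exact Finset.card_eq_three.2 ⟨_, _, _, n1, n2, n3, rfl⟩
  obtain ⟨m1, m2, m3⟩ := card_eq_three_imp h3
  have ha : a ∈ ({a', b', c'} : Finset Pt) := by rw [← h]; simp
  have hb : b ∈ ({a', b', c'} : Finset Pt) := by rw [← h]; simp
  have hcc : c ∈ ({a', b', c'} : Finset Pt) := by rw [← h]; simp
  simp only [Finset.mem_insert, Finset.mem_singleton] at ha hb hcc
  simp only [cr, Prod.fst_sub, Prod.snd_sub] at hc ⊢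
  clear h h3 n1 n2 n3
  rcases ha with rfl | rfl | rfl <;> rcases hb with rfl | rfl | rfl <;>
    first
    | exact absurd rfl m1
    | (rcases hcc with rfl | rfl | rfl <;>
        first
        | exact absurd rfl m2
        | exact absurd rfl m3
        | (left; linear_combination hc)
        | (right; linear_combination -hc))

/-- The flip of the parallelogram `(p, q)` at `w` that creates the diagonal at `w`. -/
structure IsFlipAt (T : Triangulation Ω) (Q : Quad) (T' : Triangulation Ω) (w p q : Pt) :
    Prop where
  cr_eq : cr p q = 1
  quad_eq : Q = {w, w + p, w + (p + q), w + q}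
  lower_mem : {w, w + p, w + q} ∈ T.triangles
  upper_mem : {w + p, w + q, w + (p + q)} ∈ T.triangles
  triangles_eq : T'.triangles =
    (T.triangles \ {{w, w + p, w + q}, {w + p, w + q, w + (p + q)}}) ∪
      {{w, w + p, w + (p + q)}, {w, w + q, w + (p + q)}}

theorem IsFlipAt.rotate {T : Triangulation Ω} {Q : Quad} {T' : Triangulation Ω} {w p q : Pt}
    (h : IsFlipAt T Q T' w p q) : IsFlipAt T Q T' (w + (p + q)) (-p) (-q) := by
  have e1 : w + (p + q) + -p = w + q := by abel
  have e2 : w + (p + q) + -q = w + p := by abel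
  have e3 : w + (p + q) + (-p + -q) = w := by abel
  refine ⟨by rw [cr_neg_neg, h.cr_eq], ?_, ?_, ?_, ?_⟩
  · rw [e1, e2, e3, h.quad_eq]; ext; simp; tauto
  · rw [triple_rotate]; exact h.upper_mem
  · rw [e1, e2, e3]; convert h.lower_mem using 1; ext; simp; tauto
  · have f1 : ({w + q, w + p, w} : Finset Pt) = {w, w + p, w + q} := by ext; simp; tauto
    have f2 : ({w + (p + q), w + q, w} : Finset Pt) = {w, w + q, w + (p + q)} := by
      ext; simp; tauto
    have f3 : ({w + (p + q), w + p, w} : Finset Pt) = {w, w + p, w + (p + q)} := by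
      ext; simp; tauto
    have f4 : ({w + (p + q), w + q, w + p} : Finset Pt) = {w + p, w + q, w + (p + q)} := by
      ext; simp; tauto
    rw [e1, e2, e3, h.triangles_eq, f1, f2, f3, f4,
      Set.pair_comm {w + p, w + q, w + (p + q)}, Set.pair_comm {w, w + q, w + (p + q)}]

/-- Equal areas on both sides of `ac` make `ac` bisect `bd`, so `r = 1/2`. Then `2 s` is, up to
sign, the integer `cr (b - a) (d - a)`; as `0 < s < 1`, also `s = 1/2`, and the diagonals bisect
each other. -/
theorem parallelogram_of_cross {a b c d : Pt}
    (hx : (openSegment ℝ (toPlane a) (toPlane c) ∩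
      openSegment ℝ (toPlane b) (toPlane d)).Nonempty)
    (h1 : cr (b - a) (c - a) = 1 ∨ cr (b - a) (c - a) = -1)
    (h2 : cr (c - a) (d - a) = 1 ∨ cr (c - a) (d - a) = -1) : b = a + c - d := by
  obtain ⟨x, ⟨s', s, hs', hs, hss, rfl⟩, r', r, hr', hr, hrr, e⟩ := hx
  obtain rfl : s' = 1 - s := by linarith
  obtain rfl : r' = 1 - r := by linarith
  have e1 := congrArg Prod.fst e
  have e2 := congrArg Prod.snd e
  simp only [toPlane, Prod.fst_add, Prod.snd_add, Prod.smul_fst, Prod.smul_snd, smul_eq_mul]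
    at e1 e2
  have g1 : ((cr (b - a) (c - a) : ℤ) : ℝ) =
      ((b.1 : ℝ) - a.1) * (c.2 - a.2) - (b.2 - a.2) * (c.1 - a.1) := by simp [cr]
  have g2 : ((cr (c - a) (d - a) : ℤ) : ℝ) =
      ((c.1 : ℝ) - a.1) * (d.2 - a.2) - (c.2 - a.2) * (d.1 - a.1) := by simp [cr]
  have g3 : ((cr (b - a) (d - a) : ℤ) : ℝ) =
      ((b.1 : ℝ) - a.1) * (d.2 - a.2) - (b.2 - a.2) * (d.1 - a.1) := by simp [cr]
  have k1 : (1 - r) * (cr (b - a) (c - a) : ℝ) = r * (cr (c - a) (d - a) : ℝ) := by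
    rw [g1, g2]
    linear_combination (c.2 - a.2 : ℝ) * e1 - (c.1 - a.1 : ℝ) * e2
  have k2 : r * (cr (b - a) (d - a) : ℝ) = s * (cr (b - a) (c - a) : ℝ) := by
    rw [g1, g3]
    linear_combination -(b.2 - a.2 : ℝ) * e1 + (b.1 - a.1 : ℝ) * e2
  have hr2 : r = 1 / 2 := by
    rcases h1 with h1 | h1 <;> rcases h2 with h2 | h2 <;> rw [h1, h2] at k1 <;>
      push_cast at k1 <;> linarith
  subst hr2
  have hs2 : s = 1 / 2 := by
    have hlt : s < 1 := by linarith
    rcases h1 with h1 | h1 <;> rw [h1] at k2 <;> push_cast at k2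
    · have b1 : cr (b - a) (d - a) < 2 := by
        exact_mod_cast (by linarith : (cr (b - a) (d - a) : ℝ) < 2)
      have b2 : 0 < cr (b - a) (d - a) := by
        exact_mod_cast (by linarith : (0 : ℝ) < cr (b - a) (d - a))
      have : cr (b - a) (d - a) = 1 := by omega
      rw [this] at k2; push_cast at k2; linarith
    · have b1 : -2 < cr (b - a) (d - a) := by
        exact_mod_cast (by linarith : (-2 : ℝ) < (cr (b - a) (d - a) : ℝ))
      have b2 : cr (b - a) (d - a) < 0 := by
        exact_mod_cast (by linarith : (cr (b - a) (d - a) : ℝ) < 0)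
      have : cr (b - a) (d - a) = -1 := by omega
      rw [this] at k2; push_cast at k2; linarith
  subst hs2
  apply Prod.ext
  · have : (b.1 : ℝ) = a.1 + c.1 - d.1 := by linarith
    exact_mod_cast this
  · have : (b.2 : ℝ) = a.2 + c.2 - d.2 := by linarith
    exact_mod_cast this

/-- Every flip of a unimodular triangulation is performed on a parallelogram. -/
theorem IsFlip.exists_isFlipAt {T T' : Triangulation Ω} {Q : Quad} (h : IsFlip T Q T')
    (hT : T.IsUnimodular) : ∃ w p q, IsFlipAt T Q T' w p q := by
  obtain ⟨a, b, c, d, rfl, hx, h1, h2, h3⟩ := h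
  have hu2 := hT _ _ _ h2
  have hb := parallelogram_of_cross hx (hT _ _ _ h1) hu2
  have hca : cr (a - d) (c - d) = cr (c - a) (d - a) := by simp [cr]; ring
  rw [← hca] at hu2
  rcases hu2 with hu | hu
  · have e1 : d + (a - d) = a := by abel
    have e2 : d + (c - d) = c := by abel
    have e3 : d + (a - d + (c - d)) = b := by rw [hb]; abel
    have f1 : ({d, a, c} : Finset Pt) = {a, c, d} := by ext; simp; tauto
    have f2 : ({a, c, b} : Finset Pt) = {a, b, c} := by ext; simp; tauto
    have f3 : ({d, a, b} : Finset Pt) = {a, b, d} := by ext; simp; tauto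
    have f4 : ({d, c, b} : Finset Pt) = {b, c, d} := by ext; simp; tauto
    refine ⟨d, a - d, c - d, hu, ?_, ?_, ?_, ?_⟩
    · rw [e1, e2, e3]; ext; simp; tauto
    · rwa [e1, e2, f1]
    · rwa [e1, e2, e3, f2]
    · rw [e1, e2, e3, f1, f2, f3, f4, h3,
        Set.pair_comm ({a, b, c} : Finset Pt)]
  · have e1 : d + (a - d) = a := by abel
    have e2 : d + (c - d) = c := by abel
    have e3 : d + (c - d + (a - d)) = b := by rw [hb]; abel
    have f1 : ({d, c, a} : Finset Pt) = {a, c, d} := by ext; simp; tauto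
    have f2 : ({c, a, b} : Finset Pt) = {a, b, c} := by ext; simp; tauto
    have f3 : ({d, a, b} : Finset Pt) = {a, b, d} := by ext; simp; tauto
    have f4 : ({d, c, b} : Finset Pt) = {b, c, d} := by ext; simp; tauto
    refine ⟨d, c - d, a - d, by rw [cr_swap, hu, neg_neg], ?_, ?_, ?_, ?_⟩
    · rw [e1, e2, e3]; ext; simp; tauto
    · rwa [e1, e2, f1]
    · rwa [e1, e2, e3, f2]
    · rw [e1, e2, e3, f1, f2, f3, f4, h3,
        Set.pair_comm ({a, b, c} : Finset Pt), Set.pair_comm ({a, b, d} : Finset Pt)]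

theorem IsFlipAt.isUnimodular {T T' : Triangulation Ω} {Q : Quad} {w p q : Pt}
    (h : IsFlipAt T Q T' w p q) (hT : T.IsUnimodular) : T'.IsUnimodular := by
  intro a b c ht
  have hc := h.cr_eq
  rw [h.triangles_eq] at ht
  rcases ht with ⟨ht, -⟩ | ht | ht
  · exact hT a b c ht
  · exact unimodular_of_eq ht (by simp [cr_add_right, cr_self, hc])
  · have e : ({a, b, c} : Finset Pt) = {w, w + (p + q), w + q} := by
      rw [show ({a, b, c} : Finset Pt) = _ from ht]; ext; simp; tauto
    exact unimodular_of_eq e (by simp [cr_add_left, cr_self, hc])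

/-- All pairs of vertices of a flipped quadrilateral but the new diagonal are edges before the
flip. -/
theorem IsFlipAt.hasEdge_or {T T' : Triangulation Ω} {Q : Quad} {w p q : Pt}
    (h : IsFlipAt T Q T' w p q) {x y : Pt} (hx : x ∈ Q) (hy : y ∈ Q) (hxy : x ≠ y) :
    T.HasEdge x y ∨ (x = w ∧ y = w + (p + q)) ∨ (x = w + (p + q) ∧ y = w) := by
  rw [h.quad_eq] at hx hy
  simp only [Finset.mem_insert, Finset.mem_singleton] at hx hy
  have h1 : (x = w ∨ x = w + p ∨ x = w + q) → (y = w ∨ y = w + p ∨ y = w + q) →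
      T.HasEdge x y := fun h1 h2 => ⟨hxy, _, h.lower_mem, by simpa using h1, by simpa using h2⟩
  have h2 : (x = w + p ∨ x = w + q ∨ x = w + (p + q)) →
      (y = w + p ∨ y = w + q ∨ y = w + (p + q)) → T.HasEdge x y :=
    fun h1 h2 => ⟨hxy, _, h.upper_mem, by simpa using h1, by simpa using h2⟩
  tauto

theorem IsFlipAt.hasEdge_of_hasEdge {T T' : Triangulation Ω} {Q : Quad} {w p q : Pt}
    (h : IsFlipAt T Q T' w p q) {x y : Pt} (hxy : T'.HasEdge x y) :
    T.HasEdge x y ∨ (x = w ∧ y = w + (p + q)) ∨ (x = w + (p + q) ∧ y = w) := by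
  obtain ⟨hne, t, ht, hx, hy⟩ := hxy
  rw [h.triangles_eq] at ht
  rcases ht with ⟨ht, -⟩ | rfl | rfl
  · exact Or.inl ⟨hne, t, ht, hx, hy⟩
  · apply h.hasEdge_or _ _ hne <;> rw [h.quad_eq]
    · revert hx; simp; tauto
    · revert hy; simp; tauto
  · apply h.hasEdge_or _ _ hne <;> rw [h.quad_eq]
    · revert hx; simp; tauto
    · revert hy; simp; tauto

/-- A flip that creates an edge, seen from one end of the edge. -/
theorem IsFlip.exists_isFlipAt_of_hasEdge {T T' : Triangulation Ω} {Q : Quad}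
    (h : IsFlip T Q T') (hT : T.IsUnimodular) {x y : Pt} (h1 : T'.HasEdge x y)
    (h2 : ¬ T.HasEdge x y) : ∃ p q, IsFlipAt T Q T' x p q ∧ y = x + (p + q) := by
  obtain ⟨w, p, q, hw⟩ := h.exists_isFlipAt hT
  rcases hw.hasEdge_of_hasEdge h1 with h | ⟨rfl, rfl⟩ | ⟨rfl, rfl⟩
  · exact absurd h h2
  · exact ⟨p, q, hw, rfl⟩
  · exact ⟨-p, -q, hw.rotate, by abel⟩

/-! ### Flip paths -/

theorem isFlipPath_append {T T'' : Triangulation Ω} {L M : List Quad} :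
    IsFlipPath T (L ++ M) T'' ↔ ∃ T', IsFlipPath T L T' ∧ IsFlipPath T' M T'' := by
  induction L generalizing T with
  | nil =>
    constructor
    · exact fun h => ⟨T, .nil T, h⟩
    · rintro ⟨T', h1, h2⟩
      cases h1
      exact h2
  | cons Q L ih =>
    constructor
    · intro h
      cases h with
      | cons h1 h2 =>
        obtain ⟨T', h3, h4⟩ := ih.1 h2
        exact ⟨T', .cons h1 h3, h4⟩
    · rintro ⟨T', h1, h2⟩
      cases h1 with
      | cons h3 h4 => exact .cons h3 (ih.2 ⟨T', h4, h2⟩)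

theorem isFlipPath_singleton {T T' : Triangulation Ω} {Q : Quad} :
    IsFlipPath T [Q] T' ↔ IsFlip T Q T' := by
  constructor
  · intro h
    cases h with
    | cons h1 h2 => cases h2; exact h1
  · exact fun h => .cons h (.nil _)

theorem IsFlipPath.isUnimodular {T T' : Triangulation Ω} {L : List Quad}
    (h : IsFlipPath T L T') (hT : T.IsUnimodular) : T'.IsUnimodular := by
  induction h with
  | nil => exact hT
  | cons h1 _ ih =>
    obtain ⟨w, p, q, hw⟩ := h1.exists_isFlipAt hT
    exact ih (hw.isUnimodular hT)

theorem Triangulation.IsEquilateral.isUnimodular {T : Triangulation Ω} (hT : T.IsEquilateral) :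
    T.IsUnimodular := by
  intro a b c ht
  obtain ⟨z, h | h⟩ := hT.eq_upTri_or_downTri ht
  · exact unimodular_of_eq h (by simp [cr])
  · apply unimodular_of_eq (a' := z + (1, 0)) (b' := z + ((1, 0) + (0, 1))) (c' := z + (0, 1))
    · rw [h, downTri]; ext; simp; tauto
    · simp [cr]

/-- This starts the necessity argument: tree vectors have level at least 2, so none of them is an
edge at the beginning. -/
theorem Triangulation.IsEquilateral.level_le_one {T : Triangulation Ω} (hT : T.IsEquilateral)
    (i : Fin 3) {x y : Pt} (h : T.HasEdge x y) :
    level (coordPair i).1 (coordPair i).2 (y - x) ≤ 1 := by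
  obtain ⟨-, t, ht, hx, hy⟩ := h
  obtain ⟨⟨a, b⟩, rfl | rfl⟩ := hT.eq_upTri_or_downTri ht
  · simp only [upTri, Finset.mem_insert, Finset.mem_singleton] at hx hy
    rcases hx with rfl | rfl | rfl <;> rcases hy with rfl | rfl | rfl <;> fin_cases i <;>
      simp [level, coordPair, cr]
  · simp only [downTri, Finset.mem_insert, Finset.mem_singleton] at hx hy
    rcases hx with rfl | rfl | rfl <;> rcases hy with rfl | rfl | rfl <;> fin_cases i <;>
      simp [level, coordPair, cr]

/-- These vectors appear as sides of the parallelograms, other than the one of the tree, that have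
`treeVec U W l` as a diagonal. -/
theorem treeVec_replicate_false (m : ℕ) (l : List Bool) :
    treeVec U W (List.replicate m false ++ true :: l) =
      (treeBasis U W l).1 + (m + 1 : ℤ) • treeVec U W l := by
  have : treeBasis U W (List.replicate m false ++ true :: l) =
      ((treeBasis U W l).1 + (m : ℤ) • treeVec U W l, treeVec U W l) := by
    induction m with
    | zero => simp [treeBasis, treeVec]
    | succ m ih =>
      rw [List.replicate_succ, List.cons_append, treeBasis, ih]
      ext1
      · push_cast; module
      · rfl
  rw [treeVec, this]
  module

theorem treeVec_replicate_true (m : ℕ) (l : List Bool) :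
    treeVec U W (List.replicate m true ++ false :: l) =
      (treeBasis U W l).2 + (m + 1 : ℤ) • treeVec U W l := by
  have : treeBasis U W (List.replicate m true ++ false :: l) =
      (treeVec U W l, (treeBasis U W l).2 + (m : ℤ) • treeVec U W l) := by
    induction m with
    | zero => simp [treeBasis, treeVec]
    | succ m ih =>
      rw [List.replicate_succ, List.cons_append, treeBasis, ih]
      ext1
      · rfl
      · push_cast; module
  rw [treeVec, this]
  module

theorem treeNodes_subset_cons_append (m : List Bool) (b : Bool) (l : List Bool) (v : Pt) :
    treeNodes U W l v ⊆ treeNodes U W (m ++ b :: l) v := by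
  have := treeNodes_subset_append (U := U) (W := W) (m ++ [b]) l v
  simpa using this

/-- Every flip path that generates an edge contains all flips of its plan. -/
theorem IsFlipPath.mem_of_hasEdge (hUW : cr U W = 1) {T : Triangulation Ω}
    (hT : T.IsUnimodular) (h1 : ∀ x y, T.HasEdge x y → level U W (y - x) ≤ 1) {L : List Quad} :
    ∀ {T' : Triangulation Ω}, IsFlipPath T L T' → ∀ {l : List Bool} {v : Pt},
      T'.HasEdge v (v + treeVec U W l) → ∀ n ∈ treeNodes U W l v, treeQuad U W n.1 n.2 ∈ L := by
  induction L using List.reverseRecOn with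
  | nil =>
    intro T' h l v he
    cases h
    have := h1 _ _ he
    have hb := level_treeBasis hUW l
    rw [add_sub_cancel_left, level_treeVec] at this
    omega
  | append_singleton L Q ih =>
    intro T' h l v he n hn
    obtain ⟨T₁, hL, hQ⟩ := isFlipPath_append.1 h
    rw [isFlipPath_singleton] at hQ
    rw [List.mem_append, List.mem_singleton]
    by_cases he1 : T₁.HasEdge v (v + treeVec U W l)
    · exact Or.inl (ih hL he1 n hn)
    obtain ⟨p', q', hw, hpq⟩ := hQ.exists_isFlipAt_of_hasEdge (hL.isUnimodular hT) he he1
    rw [add_right_inj] at hpq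
    have hc := cr_treeBasis hUW l
    have hc' := hw.cr_eq
    -- Both bases have the sum `e`, so `p'` and `p` have the same determinant with the primitive
    -- vector `e` and differ by an integer multiple of it.
    obtain ⟨k, hk⟩ : ∃ k : ℤ, p' = (treeBasis U W l).1 + k • treeVec U W l := by
      refine ⟨cr (treeBasis U W l).1 p', ?_⟩
      rw [treeVec] at hpq ⊢
      generalize (treeBasis U W l).1 = p at *
      generalize (treeBasis U W l).2 = q at *
      obtain rfl : q' = p + q - p' := by rw [hpq]; abel
      simp only [cr, Prod.fst_add, Prod.fst_sub, Prod.snd_add, Prod.snd_sub] at hc hc'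
      ext
      · simp [cr]
        linear_combination (p.1) * hc' - p'.1 * hc
      · simp [cr]
        linear_combination (p.2) * hc' - p'.2 * hc
    have hv0 : ∀ {f : Pt}, cr f (treeVec U W l) = 1 ∨ cr (treeVec U W l) f = 1 → v ≠ v + f := by
      intro f hf h0
      rw [left_eq_add] at h0
      subst h0
      simp [cr] at hf
    have hep : cr p' (treeVec U W l) = 1 := by rw [hpq, cr_add_right, cr_self, hc', zero_add]
    have heq : cr (treeVec U W l) q' = 1 := by rw [hpq, cr_add_left, cr_self, hc', add_zero]
    -- If `k` is not zero, then `q'` or `p'` is a tree vector below `l` that is an edge at `v`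
    -- before the flip. Its plan contains the plan of `l`, so the induction hypothesis already
    -- yields every flip.
    rcases lt_trichotomy k 0 with hk0 | rfl | hk0
    · left
      obtain ⟨m, rfl⟩ : ∃ m : ℕ, k = -(m + 1 : ℤ) := ⟨(-k - 1).toNat, by omega⟩
      have hq : q' = treeVec U W (List.replicate m true ++ false :: l) := by
        rw [treeVec_replicate_true]
        have : q' = treeVec U W l - p' := by rw [hpq]; abel
        rw [this, hk, treeVec]
        module
      refine ih hL (l := List.replicate m true ++ false :: l) (v := v) ?_ n
        (treeNodes_subset_cons_append _ _ _ _ hn)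
      rw [← hq]
      exact ⟨hv0 (Or.inr heq), _, hw.lower_mem, by simp, by simp⟩
    · rw [zero_smul, add_zero] at hk
      have hq : q' = (treeBasis U W l).2 := by
        rw [hk, treeVec, add_right_inj] at hpq; exact hpq.symm
      have hQ : Q = treeQuad U W l v := by
        rw [hw.quad_eq, treeQuad, ← hpq, hk, hq]
      cases l with
      | nil =>
        simp [treeNodes] at hn
        right; rw [hn, hQ]
      | cons b l =>
        have ne : ∀ {x y : Pt}, x + p' = y ∨ x + q' = y → x ≠ y := by
          rintro x y h rfl
          rcases h with h | h <;> rw [add_eq_left] at h <;> rw [h] at hc' <;> simp [cr] at hc'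
        -- For the expected parallelogram, the two sides parallel to the parent vector are edges
        -- before the flip, and the induction hypothesis applies to each of them.
        rcases mem_treeNodes_cons.1 hn with rfl | hn | hn
        · exact Or.inr hQ.symm
        · left
          apply ih hL (l := l) (v := v) _ n hn
          cases b
          · have hp' : treeVec U W l = p' := by rw [hk]; rfl
            rw [hp']
            exact ⟨ne (Or.inl rfl), _, hw.lower_mem, by simp, by simp⟩
          · have hq' : treeVec U W l = q' := by rw [hq]; rfl
            rw [hq']
            exact ⟨ne (Or.inr rfl), _, hw.lower_mem, by simp, by simp⟩
        · left
          apply ih hL (l := l) (v := v + treeShift U W b l) _ n hn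
          cases b
          · have hp' : treeVec U W l = p' := by rw [hk]; rfl
            have hq' : treeShift U W false l = q' := by rw [hq]; rfl
            rw [hp', hq']
            exact ⟨ne (Or.inl rfl), _, hw.upper_mem, by simp, by simp [add_assoc, add_comm q']⟩
          · have hp' : treeShift U W true l = p' := by rw [hk]; rfl
            have hq' : treeVec U W l = q' := by rw [hq]; rfl
            rw [hp', hq']
            exact ⟨ne (Or.inr rfl), _, hw.upper_mem, by simp, by simp [add_assoc]⟩
    · left
      obtain ⟨m, rfl⟩ : ∃ m : ℕ, k = (m + 1 : ℤ) := ⟨(k - 1).toNat, by omega⟩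
      refine ih hL (l := List.replicate m false ++ true :: l) (v := v) ?_ n
        (treeNodes_subset_cons_append _ _ _ _ hn)
      rw [treeVec_replicate_false, ← hk]
      exact ⟨hv0 (Or.inl hep), _, hw.lower_mem, by simp, by simp⟩

/-- On a flip path without repetitions, the children of a flip come before it. -/
theorem IsFlipPath.children_mem (hUW : cr U W = 1) {T T' : Triangulation Ω}
    (hT : T.IsUnimodular) (h1 : ∀ x y, T.HasEdge x y → level U W (y - x) ≤ 1)
    {X Y : List Quad} {b : Bool} {l : List Bool} {w : Pt}
    (h : IsFlipPath T (X ++ treeQuad U W (b :: l) w :: Y) T')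
    (hX : treeQuad U W (b :: l) w ∉ X) :
    treeQuad U W l w ∈ X ∧ treeQuad U W l (w + treeShift U W b l) ∈ X := by
  obtain ⟨T₁, hL, hQ⟩ := isFlipPath_append.1 h
  cases hQ with
  | @cons _ T₂ _ _ _ hQ _ =>
  obtain ⟨z, p, q, hz⟩ := hQ.exists_isFlipAt (hL.isUnimodular hT)
  have hb := level_treeBasis hUW (b :: l)
  have hb' := level_treeBasis hUW l
  have hne : ∀ {x f : Pt}, 1 ≤ level U W f → x ≠ x + f := by
    intro x f hf h0
    rw [left_eq_add] at h0
    subst h0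
    simp [level, cr] at hf
  -- The quadrilateral alone does not tell which diagonal the flip creates. If the diagonal of the
  -- plan were not the new one, it would be an edge earlier, and its generation would have put this
  -- very flip into `X`.
  have key : ∀ x y, x ∈ treeQuad U W (b :: l) w → y ∈ treeQuad U W (b :: l) w → x ≠ y →
      ¬ ((x = w ∧ y = w + treeVec U W (b :: l)) ∨ (x = w + treeVec U W (b :: l) ∧ y = w)) →
      T₁.HasEdge x y := by
    intro x y hx hy hxy hn
    rcases hz.hasEdge_or hx hy hxy with h | h
    · exact h
    exfalso
    have hroot : T₁.HasEdge w (w + treeVec U W (b :: l)) := by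
      refine (hz.hasEdge_or (by simp [treeQuad]) (by simp [treeQuad])
        (hne (by rw [level_treeVec]; omega))).resolve_right ?_
      intro h'
      apply hn
      rcases h with ⟨h3, h4⟩ | ⟨h3, h4⟩ <;> rcases h' with ⟨h1, h2⟩ | ⟨h1, h2⟩ <;>
        rw [h3, h4, h2, h1] <;> simp
    exact hX (hL.mem_of_hasEdge hUW hT h1 hroot _ (self_mem_treeNodes (b :: l) w))
  have hlt := level_treeVec_lt_cons hUW b l
  have hs : treeVec U W (b :: l) = treeVec U W l + treeShift U W b l := treeVec_cons b l
  have hsh := one_le_level_treeShift hUW b l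
  have hl1 : 1 ≤ level U W (treeVec U W l) := by rw [level_treeVec]; omega
  have m1 : w + treeVec U W l ∈ treeQuad U W (b :: l) w := by
    cases b <;> simp [treeQuad, treeBasis, treeVec]
  have m2 : w + treeShift U W b l ∈ treeQuad U W (b :: l) w := by
    cases b <;> simp [treeQuad, treeBasis, treeShift]
  have hlv : ∀ {x y : Pt}, x = y → level U W x = level U W y := fun h => by rw [h]
  constructor
  · refine hL.mem_of_hasEdge hUW hT h1 (key w (w + treeVec U W l) (by simp [treeQuad]) m1
      (hne hl1) ?_) _ (self_mem_treeNodes l w)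
    rintro (⟨-, h⟩ | ⟨-, h⟩) <;> have := hlv h <;> simp only [level_add] at this <;> omega
  · refine hL.mem_of_hasEdge hUW hT h1 (key (w + treeShift U W b l)
      (w + treeShift U W b l + treeVec U W l) m2 ?_ (hne hl1) ?_) _ (self_mem_treeNodes l _)
    · rw [add_assoc, add_comm (treeShift U W b l), ← hs]; simp [treeQuad]
    · rintro (⟨h, -⟩ | ⟨-, h⟩) <;> have := hlv h <;> simp only [level_add] at this <;> omega

/-! ### Linear orderings of finite posets -/

/-- The partially ordered set of a directed acyclic graph of flips. -/
def FlipDag.toPoset (D : FlipDag) : FlipPoset :=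
  ⟨D.flips, fun P Q => P ∈ D.flips ∧ Q ∈ D.flips ∧
    Relation.ReflTransGen (fun A B => (A, B) ∈ D.arcs) P Q⟩

theorem FlipPoset.IsPoset.exists_isLinearOrdering {π : FlipPoset} (h : π.IsPoset) :
    ∃ L, π.IsLinearOrdering L := by
  classical
  -- Equality is added because the order of `π` is reflexive only on its own flips.
  have hP : IsPartialOrder Quad (fun P Q => π.le P Q ∨ P = Q) :=
    { refl := fun P => Or.inr rfl
      trans := by
        rintro P Q R (h1 | rfl) (h2 | rfl)
        · exact Or.inl (h.trans _ _ _ h1 h2)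
        · exact Or.inl h1
        · exact Or.inl h2
        · exact Or.inr rfl
      antisymm := by
        rintro P Q (h1 | h1) (h2 | h2)
        · exact h.antisymm _ _ h1 h2
        · exact h2.symm
        · exact h1
        · exact h1 }
  obtain ⟨s, hs, hle⟩ := extend_partialOrder (fun P Q => π.le P Q ∨ P = Q)
  refine ⟨π.flips.sort s, ⟨Finset.sort_nodup _ _, fun Q => Finset.mem_sort _⟩, ?_⟩
  have h1 := (Finset.pairwise_sort π.flips s).and (Finset.sort_nodup π.flips s)
  refine h1.imp ?_
  rintro P Q ⟨hPQ, hne⟩ hQP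
  exact hne (antisymm_of s hPQ (hle _ _ (Or.inl hQP)))

/-- Two unrelated elements come in either order in suitable linear orderings. -/
theorem FlipPoset.IsPoset.exists_isLinearOrdering_of_not_le {π : FlipPoset} (h : π.IsPoset)
    {P Q : Quad} (hP : P ∈ π.flips) (hQ : Q ∈ π.flips) (hPQ : ¬ π.le P Q) :
    ∃ L, π.IsLinearOrdering L ∧ ∀ σ : FlipPoset, σ.IsLinearOrdering L → ¬ σ.le P Q := by
  -- The order `ρ` is generated by `π` together with `Q` below `P`; it is antisymmetric because `P`
  -- is not below `Q`. Its linear orderings put `Q` before `P`.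
  let ρ : FlipPoset := ⟨π.flips, fun A B => π.le A B ∨ (π.le A Q ∧ π.le P B)⟩
  have hρ : ρ.IsPoset :=
    { mem_of_le := by
        rintro A B (h1 | ⟨h1, h2⟩)
        · exact h.mem_of_le _ _ h1
        · exact ⟨(h.mem_of_le _ _ h1).1, (h.mem_of_le _ _ h2).2⟩
      refl := fun A hA => Or.inl (h.refl A hA)
      trans := by
        rintro A B C (h1 | ⟨h1, h2⟩) (h3 | ⟨h3, h4⟩)
        · exact Or.inl (h.trans _ _ _ h1 h3)
        · exact Or.inr ⟨h.trans _ _ _ h1 h3, h4⟩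
        · exact Or.inr ⟨h1, h.trans _ _ _ h2 h3⟩
        · exact absurd (h.trans _ _ _ h2 h3) hPQ
      antisymm := by
        rintro A B (h1 | ⟨h1, h2⟩) (h3 | ⟨h3, h4⟩)
        · exact h.antisymm _ _ h1 h3
        · exact absurd (h.trans _ _ _ (h.trans _ _ _ h4 h1) h3) hPQ
        · exact absurd (h.trans _ _ _ (h.trans _ _ _ h2 h3) h1) hPQ
        · exact absurd (h.trans _ _ _ h2 h3) hPQ }
  obtain ⟨L, hL, hL'⟩ := hρ.exists_isLinearOrdering
  refine ⟨L, ⟨hL, hL'.imp fun hn h => hn (Or.inl h)⟩, ?_⟩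
  rintro σ ⟨-, hσ⟩ hle
  have hne : P ≠ Q := by
    rintro rfl
    exact hPQ (h.refl P hP)
  obtain ⟨i, hi, rfl⟩ := List.getElem_of_mem ((hL.2 P).2 hP)
  obtain ⟨j, hj, rfl⟩ := List.getElem_of_mem ((hL.2 Q).2 hQ)
  rw [List.pairwise_iff_getElem] at hL' hσ
  rcases lt_trichotomy i j with hij | rfl | hij
  · exact hL' i j hi hj hij (Or.inr ⟨h.refl _ hQ, h.refl _ hP⟩)
  · exact hne rfl
  · exact hσ j i hj hi hij hle

/-- A poset is determined by its linear orderings. -/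
theorem FlipPoset.eq_of_isLinearOrdering_iff {π σ : FlipPoset} (hπ : π.IsPoset)
    (hσ : σ.IsPoset) (hf : π.flips = σ.flips)
    (h : ∀ L, π.IsLinearOrdering L ↔ σ.IsLinearOrdering L) : π = σ := by
  apply FlipPoset.ext hf
  have key : ∀ {π σ : FlipPoset}, π.IsPoset → σ.IsPoset → π.flips = σ.flips →
      (∀ L, π.IsLinearOrdering L ↔ σ.IsLinearOrdering L) → ∀ P Q, σ.le P Q → π.le P Q := by
    intro π σ hπ hσ hf h P Q hle
    by_contra hn
    obtain ⟨hP, hQ⟩ := hσ.mem_of_le _ _ hle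
    rw [← hf] at hP hQ
    obtain ⟨L, hL, hL'⟩ := hπ.exists_isLinearOrdering_of_not_le hP hQ hn
    exact hL' σ ((h L).1 hL) hle
  funext P Q
  exact propext ⟨key hσ hπ hf.symm (fun L => (h L).symm) P Q, key hπ hσ hf h P Q⟩

theorem FlipPoset.ListsFlips.length_eq {π : FlipPoset} {L : List Quad} (h : π.ListsFlips L) :
    L.length = π.flips.card := by
  have : L.toFinset = π.flips := by ext Q; simp [h.2]
  rw [← this, List.toFinset_card_of_nodup h.1]

/-- A flip plan all of whose flips are necessary is the unique minimum flip plan. -/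
theorem FlipPoset.IsFlipPlan.isMinimum_and_unique {π : FlipPoset} {T : Triangulation Ω}
    {a b : Pt} (h : π.IsFlipPlan T a b)
    (hn : ∀ L, Generates T L a b → ∀ Q ∈ π.flips, Q ∈ L) :
    π.IsMinimumFlipPlan T a b ∧ ∀ σ : FlipPoset, σ.IsMinimumFlipPlan T a b → σ = π := by
  constructor
  · refine ⟨h, fun L hL L' hL' => ?_⟩
    rw [hL.1.length_eq]
    calc π.flips.card ≤ L'.toFinset.card :=
          Finset.card_le_card fun Q hQ => List.mem_toFinset.2 (hn L' hL' Q hQ)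
      _ ≤ L'.length := L'.toFinset_card_le
  · rintro σ ⟨hσ, hmin⟩
    obtain ⟨L, hL⟩ := h.1.exists_isLinearOrdering
    obtain ⟨M, hM⟩ := hσ.1.exists_isLinearOrdering
    have hlen := hmin M hM L ((h.2 L).1 hL).1
    rw [hM.1.length_eq, hL.1.length_eq] at hlen
    -- The necessary flips of `π` occur in every ordering of `σ`, and minimality of `σ` bounds its
    -- size by that of `π`.
    have hf : π.flips = σ.flips := by
      apply Finset.eq_of_subset_of_card_le _ hlen
      intro Q hQ
      exact (hM.1.2 Q).1 (hn M ((hσ.2 M).1 hM).1 Q hQ)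
    symm
    apply FlipPoset.eq_of_isLinearOrdering_iff h.1 hσ.1 hf
    intro L
    rw [h.2, hσ.2]
    simp only [FlipPoset.ListsFlips, hf]

/-! ### The flip plan -/

/-- The level range grades the graph, which makes it acyclic and the descendant relation
antisymmetric. -/
theorem levelRange_lt_of_arc (hUW : cr U W = 1) {l : List Bool} {v : Pt} {P Q : Quad}
    (h : (P, Q) ∈ (treeDag U W l v).arcs) : levelRange U W P < levelRange U W Q := by
  obtain ⟨b, l', w, -, rfl, h | h⟩ := mem_treeDag_arcs.1 h <;> subst h <;>
    rw [levelRange_treeQuad hUW, levelRange_treeQuad hUW] <;>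
    have h1 := level_treeVec_lt_cons hUW b l' <;> have h2 := level_treeBasis hUW l' <;>
    have h3 := level_treeVec (U := U) (W := W) l' <;> omega

theorem isPoset_treeDag (hUW : cr U W = 1) (l : List Bool) (v : Pt) :
    (treeDag U W l v).toPoset.IsPoset := by
  have key : ∀ {P Q}, Relation.ReflTransGen (fun A B => (A, B) ∈ (treeDag U W l v).arcs) P Q →
      P = Q ∨ levelRange U W P < levelRange U W Q := by
    intro P Q h
    induction h with
    | refl => exact Or.inl rfl
    | tail _ h ih =>
      have := levelRange_lt_of_arc hUW h
      rcases ih with rfl | ih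
      · exact Or.inr this
      · exact Or.inr (ih.trans this)
  refine ⟨fun P Q h => ⟨h.1, h.2.1⟩, fun P h => ⟨h, h, .refl⟩,
    fun P Q R h h' => ⟨h.1, h'.2.1, h.2.2.trans h'.2.2⟩, fun P Q h h' => ?_⟩
  rcases key h.2.2 with h1 | h1
  · exact h1
  · rcases key h'.2.2 with h2 | h2
    · exact h2.symm
    · omega

theorem child_le (l : List Bool) (v : Pt) {b : Bool} {l' : List Bool} {w : Pt}
    (h : (b :: l', w) ∈ treeNodes U W l v) :
    (treeDag U W l v).toPoset.le (treeQuad U W l' w) (treeQuad U W (b :: l') w) ∧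
    (treeDag U W l v).toPoset.le (treeQuad U W l' (w + treeShift U W b l'))
      (treeQuad U W (b :: l') w) := by
  obtain ⟨h1, h2⟩ := children_mem_treeNodes h
  have h0 := mem_treeDag_flips.2 ⟨_, h, rfl⟩
  exact ⟨⟨mem_treeDag_flips.2 ⟨_, h1, rfl⟩, h0,
      .single (mem_treeDag_arcs.2 ⟨b, l', w, h, rfl, Or.inl rfl⟩)⟩,
    mem_treeDag_flips.2 ⟨_, h2, rfl⟩, h0,
      .single (mem_treeDag_arcs.2 ⟨b, l', w, h, rfl, Or.inr rfl⟩)⟩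

/-- In a linear ordering of the plan, the children of a flip come before it. -/
theorem children_mem_of_isLinearOrdering (hUW : cr U W = 1) {l : List Bool} {v : Pt}
    {X Y : List Quad} {b : Bool} {l' : List Bool} {w : Pt}
    (h : (b :: l', w) ∈ treeNodes U W l v)
    (hL : (treeDag U W l v).toPoset.IsLinearOrdering (X ++ treeQuad U W (b :: l') w :: Y)) :
    treeQuad U W l' w ∈ X ∧ treeQuad U W l' (w + treeShift U W b l') ∈ X := by
  have key : ∀ P, (treeDag U W l v).toPoset.le P (treeQuad U W (b :: l') w) →
      P ≠ treeQuad U W (b :: l') w → P ∈ X := by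
    intro P hP hne
    have hm := (hL.1.2 P).2 hP.1
    rcases List.mem_append.1 hm with hm | hm
    · exact hm
    · rcases List.mem_cons.1 hm with hm | hm
      · exact absurd hm hne
      · exact absurd hP (List.rel_of_pairwise_cons (List.pairwise_append.1 hL.2).2.1 hm)
  have hne : ∀ z, treeQuad U W l' z ≠ treeQuad U W (b :: l') w := by
    intro z hz
    have := (treeQuad_injective hUW (List.suffix_cons b l') List.suffix_rfl hz).1
    exact absurd (congrArg List.length this) (by simp)
  exact ⟨key _ (child_le l v h).1 (hne _), key _ (child_le l v h).2 (hne _)⟩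

/-- Performing flips of the plan in a linear ordering is possible, and leads to the triangulation
with all added and none of the removed triangles. -/
theorem exists_isFlipPath_of_isLinearOrdering (hUW : cr U W = 1) {T : Triangulation Ω}
    {l : List Bool} {v : Pt}
    (h0 : ∀ w, ([], w) ∈ treeNodes U W l v → removed U W [] w ⊆ T.triangles) {A : List Quad} :
    ∀ {B : List Quad}, (treeDag U W l v).toPoset.IsLinearOrdering (A ++ B) →
      ∃ T' : Triangulation Ω, IsFlipPath T A T' ∧ ∀ t, t ∈ T'.triangles ↔
        (t ∈ T.triangles ∨ ∃ n ∈ treeNodes U W l v, treeQuad U W n.1 n.2 ∈ A ∧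
          t ∈ added U W n.1 n.2) ∧
        ¬ ∃ n ∈ treeNodes U W l v, treeQuad U W n.1 n.2 ∈ A ∧ t ∈ removed U W n.1 n.2 := by
  induction A using List.reverseRecOn with
  | nil => exact fun _ => ⟨T, .nil T, by simp⟩
  | append_singleton A Q ih =>
    intro B hL
    rw [List.append_assoc] at hL
    obtain ⟨T₁, hT₁, hS⟩ := ih hL
    obtain ⟨⟨l', w⟩, hn, rfl⟩ := mem_treeDag_flips.1 ((hL.1.2 Q).1 (by simp))
    dsimp only at *
    have hinj : ∀ m ∈ treeNodes U W l v, treeQuad U W m.1 m.2 = treeQuad U W l' w →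
        m = (l', w) := by
      intro m hm e
      obtain ⟨e1, e2⟩ := treeQuad_injective hUW (suffix_of_mem_treeNodes hm)
        (suffix_of_mem_treeNodes hn) e
      exact Prod.ext e1 e2
    have hQA : treeQuad U W l' w ∉ A := by
      intro h
      exact (List.disjoint_of_nodup_append hL.1.1) h (by simp)
    have hch : ∀ b m z, (b :: m, z) ∈ treeNodes U W l v → treeQuad U W (b :: m) z ∈ A →
        treeQuad U W m z ∈ A ∧ treeQuad U W m (z + treeShift U W b m) ∈ A := by
      intro b m z hm hA
      obtain ⟨X, Y, rfl⟩ := List.append_of_mem hA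
      rw [List.append_assoc, List.cons_append] at hL
      have := children_mem_of_isLinearOrdering hUW hm hL
      exact ⟨List.mem_append_left _ this.1, List.mem_append_left _ this.2⟩
    -- The triangles to be removed come from `T` or from the children, which precede the flip, and
    -- no earlier flip has removed them, since a removed triangle determines its node.
    have hrem : removed U W l' w ⊆ T₁.triangles := by
      intro t ht
      rw [hS]
      constructor
      · cases l' with
        | nil => exact Or.inl (h0 w hn ht)
        | cons b m =>
          right
          obtain ⟨c1, c2⟩ := children_mem_of_isLinearOrdering hUW hn hL
          obtain ⟨k1, k2⟩ := children_mem_treeNodes hn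
          rcases mem_added_of_mem_removed_cons ht with h | h
          · exact ⟨_, k1, c1, h⟩
          · exact ⟨_, k2, c2, h⟩
      · rintro ⟨⟨m, z⟩, hm, hA, htm⟩
        have e := eq_of_mem_removed_of_suffix hUW (suffix_of_mem_treeNodes hm)
          (suffix_of_mem_treeNodes hn) htm ht
        dsimp only at e hA htm
        subst e
        rw [eq_of_mem_removed hUW htm ht] at hA
        exact hQA hA
    obtain ⟨T₂, hT₂, hflip⟩ := T₁.exists_isFlip (cr_treeBasis hUW l') (hrem (Or.inl rfl))
      (hrem (Or.inr rfl))
    refine ⟨T₂, isFlipPath_append.2 ⟨T₁, hT₁, isFlipPath_singleton.2 hflip⟩, fun t => ?_⟩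
    have hT₂' : t ∈ T₂.triangles ↔
        (t ∈ T₁.triangles ∧ t ∉ removed U W l' w) ∨ t ∈ added U W l' w := by
      rw [hT₂]; rfl
    -- Only a parent could remove a triangle that this flip adds; a parent performed earlier would
    -- require this flip in `A`.
    have hadd : t ∈ added U W l' w → ∀ n ∈ treeNodes U W l v,
        (treeQuad U W n.1 n.2 ∈ A ∨ n = (l', w)) → t ∉ removed U W n.1 n.2 := by
      rintro ht ⟨m, z⟩ hm hor hr
      obtain ⟨b, e⟩ := exists_eq_cons_of_mem_added_of_mem_removed hUW
        (suffix_of_mem_treeNodes hn) (suffix_of_mem_treeNodes hm) ht hr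
      dsimp only at *
      subst e
      rcases hor with hA | e
      · rcases eq_or_eq_of_mem_added_of_mem_removed hUW ht hr with rfl | rfl
        · exact hQA (hch _ _ _ hm hA).1
        · exact hQA (hch _ _ _ hm hA).2
      · rw [Prod.mk.injEq] at e
        exact absurd (congrArg List.length e.1) (by simp)
    have hmem : ∀ n ∈ treeNodes U W l v, (treeQuad U W n.1 n.2 ∈ A ++ [treeQuad U W l' w] ↔
        treeQuad U W n.1 n.2 ∈ A ∨ n = (l', w)) := by
      intro n hn'
      rw [List.mem_append, List.mem_singleton]
      constructor
      · rintro (h | h)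
        · exact Or.inl h
        · exact Or.inr (hinj n hn' h)
      · rintro (h | rfl)
        · exact Or.inl h
        · exact Or.inr rfl
    rw [hT₂', hS]
    constructor
    · rintro (⟨⟨h1, h2⟩, h3⟩ | h)
      · refine ⟨?_, ?_⟩
        · rcases h1 with h1 | ⟨n, k1, k2, k3⟩
          · exact Or.inl h1
          · exact Or.inr ⟨n, k1, List.mem_append_left _ k2, k3⟩
        · rintro ⟨n, k1, k2, k3⟩
          rcases (hmem n k1).1 k2 with k2 | rfl
          · exact h2 ⟨n, k1, k2, k3⟩
          · exact h3 k3
      · refine ⟨Or.inr ⟨_, hn, by simp, h⟩, ?_⟩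
        rintro ⟨n, k1, k2, k3⟩
        exact hadd h n k1 ((hmem n k1).1 k2) k3
    · rintro ⟨h1, h2⟩
      have h2' : ¬ ∃ n ∈ treeNodes U W l v, treeQuad U W n.1 n.2 ∈ A ∧
          t ∈ removed U W n.1 n.2 := by
        rintro ⟨n, k1, k2, k3⟩
        exact h2 ⟨n, k1, List.mem_append_left _ k2, k3⟩
      have h2'' : t ∉ removed U W l' w := fun h => h2 ⟨_, hn, by simp, h⟩
      rcases h1 with h1 | ⟨n, k1, k2, k3⟩
      · exact Or.inl ⟨⟨Or.inl h1, h2'⟩, h2''⟩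
      · rcases (hmem n k1).1 k2 with k2 | rfl
        · exact Or.inl ⟨⟨Or.inr ⟨n, k1, k2, k3⟩, h2'⟩, h2''⟩
        · exact Or.inr k3

/-- The plan of an edge is a flip plan that generates the edge. -/
theorem isFlipPlan_treeDag (hUW : cr U W = 1) {T : Triangulation Ω} (hT : T.IsUnimodular)
    (h1 : ∀ x y, T.HasEdge x y → level U W (y - x) ≤ 1) {l : List Bool} {v : Pt}
    (h0 : ∀ w, ([], w) ∈ treeNodes U W l v → removed U W [] w ⊆ T.triangles) :
    (treeDag U W l v).toPoset.IsFlipPlan T v (v + treeVec U W l) := by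
  refine ⟨isPoset_treeDag hUW l v, fun L => ⟨fun hL => ⟨?_, hL.1⟩, ?_⟩⟩
  · obtain ⟨T', hT', hS⟩ := exists_isFlipPath_of_isLinearOrdering hUW h0 (A := L) (B := [])
      (by rwa [List.append_nil])
    refine ⟨T', hT', ?_, {v, v + (treeBasis U W l).1, v + treeVec U W l}, ?_, by simp, by simp⟩
    · intro h
      have hb := level_treeBasis hUW l
      have := level_treeVec (U := U) (W := W) l
      rw [left_eq_add] at h
      have e : level U W (0 : Pt) = 0 := by simp [level, cr]
      rw [h, e] at this
      omega
    · rw [hS]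
      refine ⟨Or.inr ⟨(l, v), self_mem_treeNodes l v,
        (hL.1.2 _).2 (mem_treeDag_flips.2 ⟨_, self_mem_treeNodes l v, rfl⟩), Or.inl rfl⟩, ?_⟩
      -- The triangle at the new edge survives: a flip removing it would belong to a path longer
      -- than `l`.
      rintro ⟨n, hn, -, hr⟩
      obtain ⟨b, e⟩ := exists_eq_cons_of_mem_added_of_mem_removed hUW List.suffix_rfl
        (suffix_of_mem_treeNodes hn) (Or.inl rfl) hr
      have := (suffix_of_mem_treeNodes hn).length_le
      rw [e] at this
      simp at this
  · rintro ⟨⟨T', hT', -⟩, hL⟩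
    refine ⟨hL, ?_⟩
    -- Each arc moves one position back in the path, by `IsFlipPath.children_mem`; hence all
    -- descendants precede.
    have key : ∀ {P Q}, Relation.ReflTransGen (fun A B => (A, B) ∈ (treeDag U W l v).arcs) P Q →
        ∀ X Y, L = X ++ Q :: Y → P = Q ∨ P ∈ X := by
      intro P Q h
      induction h with
      | refl => exact fun _ _ _ => Or.inl rfl
      | @tail R Q _ h ih =>
        intro X Y e
        obtain ⟨b, l', w, hn, rfl, hR⟩ := mem_treeDag_arcs.1 h
        have hX : treeQuad U W (b :: l') w ∉ X := by
          have := hL.1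
          rw [e] at this
          intro hmem
          exact (List.disjoint_of_nodup_append this) hmem (by simp)
        rw [e] at hT'
        obtain ⟨c1, c2⟩ := hT'.children_mem hUW hT h1 hX
        have hRX : R ∈ X := by
          rcases hR with rfl | rfl
          · exact c1
          · exact c2
        obtain ⟨X₁, X₂, rfl⟩ := List.append_of_mem hRX
        right
        rcases ih X₁ (X₂ ++ treeQuad U W (b :: l') w :: Y) (by rw [e]; simp) with rfl | h
        · exact hRX
        · exact List.mem_append_left _ h
    rw [List.pairwise_iff_getElem]
    intro i j hi hj hij hle
    have e : L = L.take i ++ L[i] :: L.drop (i + 1) := by simp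
    rcases key hle.2.2 _ _ e with h | h
    · exact absurd ((hL.1.getElem_inj_iff).1 h) hij.ne'
    · obtain ⟨k, hk, hk'⟩ := List.mem_take_iff_getElem.1 h
      have := (hL.1.getElem_inj_iff).1 hk'
      omega

theorem flipPlan_eq (e : Edge) (v : Pt) :
    flipPlan e v = (flipDag (fareyPlan e).reverse e v).toPoset := rfl

/-- A unit edge inside the region is already present, so the empty plan works; all other edges
reduce to the tree of bases. -/
theorem flipPlan_isFlipPlan {T : Triangulation Ω} (hT : T.IsEquilateral) (e : Edge) (v : Pt)
    (he : segment ℝ (toPlane v) (toPlane (v + e.vec)) ⊆ Ω) :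
    (flipPlan e v).IsFlipPlan T v (v + e.vec) ∧
    (∀ L, Generates T L v (v + e.vec) → ∀ Q ∈ (flipPlan e v).flips, Q ∈ L) ∧
    (∀ Q ∈ (flipPlan e v).flips, ∃ (g : Edge) (w : Pt), ¬ g.IsUnit ∧
      Q = fareyParallelogram g w) := by
  by_cases hu : e.IsUnit
  · have hf : (flipPlan e v).flips = ∅ := by
      rw [flipPlan_eq, fareyPlan, if_pos hu]; rfl
    have hle : ∀ P Q, ¬ (flipPlan e v).le P Q := by
      rintro P Q ⟨h, -⟩
      have : P ∈ (flipPlan e v).flips := h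
      simp [hf] at this
    refine ⟨⟨⟨fun P Q h => absurd h (hle P Q), fun P h => by simp [hf] at h,
      fun P Q R h => absurd h (hle P Q), fun P Q h => absurd h (hle P Q)⟩, fun L => ?_⟩,
      fun L _ Q hQ => by simp [hf] at hQ, fun Q hQ => by simp [hf] at hQ⟩
    constructor
    · rintro ⟨hL, -⟩
      refine ⟨?_, hL⟩
      obtain rfl : L = [] := List.eq_nil_iff_forall_not_mem.2 fun Q hQ => by
        have := (hL.2 Q).1 hQ
        simp [hf] at this
      exact ⟨T, .nil T, hT.hasEdge_of_isUnit hu he⟩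
    · rintro ⟨-, hL⟩
      exact ⟨hL, List.pairwise_of_forall fun P Q => hle Q P⟩
  · obtain ⟨l, hl, hD⟩ := exists_flipDag_eq_treeDag e hu
    have hUW := cr_coordPair e.pair
    rw [flipPlan_eq, hD, hl]
    rw [hl] at he
    have h1 : ∀ x y, T.HasEdge x y → level (coordPair e.pair).1 (coordPair e.pair).2 (y - x) ≤ 1 :=
      fun x y => hT.level_le_one e.pair
    refine ⟨isFlipPlan_treeDag hUW hT.isUnimodular h1
      fun w hw => hT.removed_nil_subset e.pair he hw, ?_, ?_⟩
    · rintro L ⟨T', hL, hE⟩ Q hQ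
      obtain ⟨n, hn, rfl⟩ := mem_treeDag_flips.1 hQ
      exact hL.mem_of_hasEdge hUW hT.isUnimodular h1 hE n hn
    · intro Q hQ
      obtain ⟨n, hn, rfl⟩ := mem_treeDag_flips.1 hQ
      obtain ⟨g, hg, e⟩ := exists_fareyParallelogram_eq e.pair n.1 n.2
      exact ⟨g, n.2, hg, e⟩

end LatticeFlip

/-! ### The main theorem. -/

open LatticeFlip
theorem mainTheorem3 (Ω : Set Plane) (T : Triangulation Ω) (hT : T.IsEquilateral)
    (e : Edge) (v : Pt) (he : segment ℝ (toPlane v) (toPlane (v + e.vec)) ⊆ Ω) :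
    (∃! π : FlipPoset, π.IsMinimumFlipPlan T v (v + e.vec)) ∧
    (flipPlan e v).IsMinimumFlipPlan T v (v + e.vec) ∧
    (∀ π : FlipPoset, π.IsMinimumFlipPlan T v (v + e.vec) → π.flips = (flipPlan e v).flips) ∧
    (∀ Q ∈ (flipPlan e v).flips, ∃ (g : Edge) (w : Pt), ¬ g.IsUnit ∧ Q = fareyParallelogram g w) := by
  obtain ⟨h1, h2, h3⟩ := flipPlan_isFlipPlan hT e v he
  obtain ⟨h4, h5⟩ := h1.isMinimum_and_unique h2
  exact ⟨⟨_, h4, h5⟩, h4, fun π hπ => by rw [h5 π hπ], h3⟩
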